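/- Let $\Bbbk$ be a field of any characteristic, $q,Q\in\Bbbk^{\times}$, and let $n,m\ge 0$ be integers; put $r=\lfloor m/2\rfloor$. Let $\mathcal H_n$ be the type B Hecke algebra over $\Bbbk$ with generators $T_0,\dots,T_{n-1}$ and relations $(T_0-Q)(T_0+1)=0$, $(T_i-q)(T_i+1)=0$ for $i\ge 1$, $T_0T_1T_0T_1=T_1T_0T_1T_0$, $T_iT_{i+1}T_i=T_{i+1}T_iT_{i+1}$ for $1\le i\le n-2$, and $T_iT_j=T_jT_i$ for $|i-j|>1$. Put $L_1=T_0$ and $L_{i+1}=q^{-1}T_iL_iT_i$. Let $\Lambda_{n,m}$ be the set of bicompositions $\lambda=(\lambda^{(1)},\lambda^{(2)})$ of $n$ such that $\lambda^{(1)}$ has $n$ parts and $\lambda^{(2)}$ has $r$ parts (parts may be zero). For $\lambda\in\Lambda_{n,m}$ let $\mathfrak S_\lambda\subseteq\mathfrak S_n$ be its Young subgroup, $m_\lambda=\prod_{i=1}^{|\lambda^{(1)}|}(L_i+1)\cdot\sum_{w\in\mathfrak S_\lambda}T_w$ and $M^\lambda=m_\lambda\mathcal H_n$. Let $\mathcal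 S^n(\Lambda_{n,m})=\operatorname{End}_{\mathcal H_n}\bigl(\bigoplus_{\lambda\in\Lambda_{n,m}}M^\lambda\bigr)$ be the Dipper--James--Mathas cyclotomic $q$-Schur algebra, and let $\varphi_\lambda\in\mathcal S^n(\Lambda_{n,m})$ be the idempotent projecting onto the summand $M^\lambda$. Let $\Lambda^B_{n,m}\subseteq\Lambda_{n,m}$ be the set of those $\lambda$ with $\lambda^{(1)}=(a,0,\dots,0)$ for some $a\ge0$ if $m$ is odd, and with $\lambda^{(1)}=(0,\dots,0)$ if $m$ is even, and put $e_n=\sum_{\lambda\in\Lambda^B_{n,m}}\varphi_\lambda$. Let $I(m)=\{-r,\dots,r\}$ if $m$ is odd and $I(m)=\{-r,\dots,-1,1,\dots,r\}$ if $m$ is even, $V=\Bbbk^{I(m)}$, and let $\mathcal H_n$ act on $V^{\otimes n}$ from the right as follows, where $v_d=v_{d_1}\otimes\cdots\otimes v_{d_n}$, where $d\cdot s_0$ is $d$ with $d_1$ replaced by $-d_1$ and, for $t\ge1$, $d\cdot s_t$ is $d$ with $d_t$ and $d_{t+1}$ interchanged: $v_dT_0$ equals $v_{d\cdot s_0}$,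 $Qv_{d\cdot s_0}$, or $Qv_{d\cdot s_0}+(Q-1)v_d$ according as $0<d_1$, $0=d_1$, or $0>d_1$; and, for $1\le t\le n-1$, $v_dT_t$ equals $v_{d\cdot s_t}$, $qv_{d\cdot s_t}$, or $qv_{d\cdot s_t}+(q-1)v_d$ according as $d_t<d_{t+1}$, $d_t=d_{t+1}$, or $d_t>d_{t+1}$. Let $\mathcal L^n(m)=\operatorname{End}_{\mathcal H_n}(V^{\otimes n})$ be the type B $q$-Schur algebra. Modules over these algebras are right modules, and a quotient functor is an exact functor that identifies its target with the Serre quotient of its source by the subcategory of objects it kills. Then: (1) There is an isomorphism of $\Bbbk$-algebras $\mathcal L^n(m)\cong e_n\mathcal S^n(\Lambda_{n,m})e_n$. (2) Through this isomorphism, $M\mapsto Me_n$ is a quotient functor $\mathcal S^n(\Lambda_{n,m})\text{-mod}\to\mathcal L^n(m)\text{-mod}$. (3) Suppose $m\ge 2n$, and let $e_{\mathcal H}=\varphi_{\omega}$ for $\omega=(\emptyset,(1^n))$ (padded with zero parts). Then $M^\omega=\mathcal H_n$, and left multiplication on $M^\omega$ gives an isomorphism $\mathcal H_n\cong e_{\mathcal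 H}\mathcal S^n(\Lambda_{n,m})e_{\mathcal H}$. The resulting Schur functor $\Omega_n\colon\mathcal S^n(\Lambda_{n,m})\text{-mod}\to\mathcal H_n\text{-mod}$, $M\mapsto Me_{\mathcal H}$, factors, up to natural isomorphism, as the quotient functor of (2) followed by a quotient functor $\mathcal L^n(m)\text{-mod}\to\mathcal H_n\text{-mod}$, namely $N\mapsto Nf$, where $f\in\mathcal L^n(m)$ is the idempotent corresponding to $e_{\mathcal H}$. Statements (2) and (3) hold both for the categories of all right modules and for those of finitely generated right modules. -/

import Mathlib

open CategoryTheory MulOpposite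
open scoped TensorProduct DirectSum
universe u
namespace TypeBSchur

/-- The parameter `q_i` of the generator `T_i`: `q_0 = Q` and `q_i = q` for `i ≥ 1`. -/
def heckeParam {k : Type u} (q Q : k) (i : ℕ) : k := if i = 0 then Q else q

/-- Defining relations of the type B Hecke algebra with generators `T_0, …, T_{n-1}`. -/
inductive HeckeRel {k : Type u} [Field k] (q Q : k) (n : ℕ) :
    FreeAlgebra k (Fin n) → FreeAlgebra k (Fin n) → Prop
  | quadratic (i : Fin n) :
      HeckeRel q Q n
        ((FreeAlgebra.ι k i - algebraMap k _ (heckeParam q Q i.1)) * (FreeAlgebra.ι k i + 1)) 0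
  | braid_four (h : 1 < n) :
      HeckeRel q Q n
        (FreeAlgebra.ι k ⟨0, by omega⟩ * FreeAlgebra.ι k ⟨1, h⟩ *
          FreeAlgebra.ι k ⟨0, by omega⟩ * FreeAlgebra.ι k ⟨1, h⟩)
        (FreeAlgebra.ι k ⟨1, h⟩ * FreeAlgebra.ι k ⟨0, by omega⟩ *
          FreeAlgebra.ι k ⟨1, h⟩ * FreeAlgebra.ι k ⟨0, by omega⟩)
  | braid_three (i : ℕ) (hi : 0 < i) (h : i + 1 < n) :
      HeckeRel q Q n
        (FreeAlgebra.ι k ⟨i, by omega⟩ * FreeAlgebra.ι k ⟨i + 1, h⟩ * FreeAlgebra.ι k ⟨i, by omega⟩)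
        (FreeAlgebra.ι k ⟨i + 1, h⟩ * FreeAlgebra.ι k ⟨i, by omega⟩ * FreeAlgebra.ι k ⟨i + 1, h⟩)
  | comm (i j : Fin n) (h : i.1 + 1 < j.1) :
      HeckeRel q Q n (FreeAlgebra.ι k i * FreeAlgebra.ι k j) (FreeAlgebra.ι k j * FreeAlgebra.ι k i)

/-- The type B Hecke algebra `H_n = H_n^B(Q,q)`, by generators and relations. -/
def Hecke {k : Type u} [Field k] (q Q : k) (n : ℕ) : Type u := RingQuot (HeckeRel q Q n)

instance {k : Type u} [Field k] (q Q : k) (n : ℕ) : Ring (Hecke q Q n) :=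
  inferInstanceAs (Ring (RingQuot (HeckeRel q Q n)))

instance {k : Type u} [Field k] (q Q : k) (n : ℕ) : Algebra k (Hecke q Q n) :=
  inferInstanceAs (Algebra k (RingQuot (HeckeRel q Q n)))

/-- The quotient map from the free algebra. -/
noncomputable def Hecke.mk {k : Type u} [Field k] (q Q : k) (n : ℕ) :
    FreeAlgebra k (Fin n) →ₐ[k] Hecke q Q n :=
  RingQuot.mkAlgHom k (HeckeRel q Q n)

/-- The universal property of the presentation. -/
noncomputable def Hecke.lift {k : Type u} [Field k] (q Q : k) (n : ℕ) {B : Type*} [Ring B]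
    [Algebra k B] (f : FreeAlgebra k (Fin n) →ₐ[k] B)
    (hf : ∀ ⦃x y⦄, HeckeRel q Q n x y → f x = f y) : Hecke q Q n →ₐ[k] B :=
  RingQuot.liftAlgHom k ⟨f, hf⟩

theorem Hecke.lift_mk {k : Type u} [Field k] (q Q : k) (n : ℕ) {B : Type*} [Ring B]
    [Algebra k B] (f : FreeAlgebra k (Fin n) →ₐ[k] B)
    (hf : ∀ ⦃x y⦄, HeckeRel q Q n x y → f x = f y) (x : FreeAlgebra k (Fin n)) :
    Hecke.lift q Q n f hf (Hecke.mk q Q n x) = f x :=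
  RingQuot.liftAlgHom_mkAlgHom_apply k f hf x

/-- `I(m) = {-r, …, r}` for `m = 2r+1` and `{-r, …, -1, 1, …, r}` for `m = 2r`. -/
def IndexSet (m : ℕ) : Type := {i : ℤ // |i| ≤ ((m / 2 : ℕ) : ℤ) ∧ (Even m → i ≠ 0)}

namespace IndexSet

instance (m : ℕ) : Finite (IndexSet m) :=
  Set.Finite.to_subtype <| (Set.finite_Icc (-((m / 2 : ℕ) : ℤ)) ((m / 2 : ℕ) : ℤ)).subset
    fun _ hi => ⟨(abs_le.1 hi.1).1, (abs_le.1 hi.1).2⟩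

instance (m : ℕ) : Neg (IndexSet m) :=
  ⟨fun i => ⟨-i.1, by rw [abs_neg]; exact i.2.1, fun h => neg_ne_zero.2 (i.2.2 h)⟩⟩

end IndexSet

/-- `V^{⊗n}` for `V = k^{I(m)}`. The parameters are recorded for the Hecke action. -/
def TensorSpace {k : Type u} [Field k] (_q _Q : k) (n m : ℕ) : Type u :=
  ⨂[k] _ : Fin n, (IndexSet m → k)


theorem swap_braid {α : Type*} [DecidableEq α] (x y z : α) (hxy : x ≠ y) (hxz : x ≠ z)
    (hyz : y ≠ z) :
    Equiv.swap y z * Equiv.swap x y * Equiv.swap y z =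
      Equiv.swap x y * Equiv.swap y z * Equiv.swap x y := by
  rw [Equiv.swap_mul_swap_mul_swap hxy hxz, Equiv.swap_comm x y, Equiv.swap_comm y z,
    Equiv.swap_mul_swap_mul_swap hyz.symm hxz.symm, Equiv.swap_comm]

theorem braid_three_aux {k V D : Type*} [Field k] [AddCommGroup V] [Module k V] (q : k)
    (b : D → V) (A B : V →ₗ[k] V) (s t : D → D) (x y z : D → ℤ)
    (hss : ∀ d, s (s d) = d) (htt : ∀ d, t (t d) = d) (hst : ∀ d, t (s (t d)) = s (t (s d)))
    (xs : ∀ d, x (s d) = y d) (ys : ∀ d, y (s d) = x d) (zs : ∀ d, z (s d) = z d)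
    (xt : ∀ d, x (t d) = x d) (yt : ∀ d, y (t d) = z d) (zt : ∀ d, z (t d) = y d)
    (hse : ∀ d, x d = y d → s d = d) (hte : ∀ d, y d = z d → t d = d)
    (A1 : ∀ d, x d < y d → A (b d) = b (s d)) (A2 : ∀ d, x d = y d → A (b d) = q • b (s d))
    (A3 : ∀ d, y d < x d → A (b d) = q • b (s d) + (q - 1) • b d)
    (B1 : ∀ d, y d < z d → B (b d) = b (t d)) (B2 : ∀ d, y d = z d → B (b d) = q • b (t d))
    (B3 : ∀ d, z d < y d → B (b d) = q • b (t d) + (q - 1) • b d) (d : D) :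
    A (B (A (b d))) = B (A (B (b d))) := by
  rcases lt_trichotomy (x d) (y d) with h | h | h <;>
  rcases lt_trichotomy (y d) (z d) with h' | h' | h' <;>
  rcases lt_trichotomy (x d) (z d) with h'' | h'' | h'' <;>
  first
  | (exfalso; omega)
  | (simp (disch := ((try simp only [xs, ys, zs, xt, yt, zt]); omega)) only
      [A1, A2, A3, B1, B2, B3, map_add, map_smul, hss, htt, hst, hse, hte, smul_add]; try module)

theorem braid_four_aux {k V D : Type*} [Field k] [AddCommGroup V] [Module k V] (q Q : k)
    (b : D → V) (A B : V →ₗ[k] V) (s t : D → D) (y z : D → ℤ)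
    (hss : ∀ d, s (s d) = d) (htt : ∀ d, t (t d) = d)
    (hst : ∀ d, t (s (t (s d))) = s (t (s (t d))))
    (ys : ∀ d, y (s d) = - y d) (zs : ∀ d, z (s d) = z d)
    (yt : ∀ d, y (t d) = z d) (zt : ∀ d, z (t d) = y d)
    (hse : ∀ d, 0 = y d → s d = d) (hte : ∀ d, y d = z d → t d = d)
    (A1 : ∀ d, 0 < y d → A (b d) = b (s d)) (A2 : ∀ d, 0 = y d → A (b d) = Q • b (s d))
    (A3 : ∀ d, y d < 0 → A (b d) = Q • b (s d) + (Q - 1) • b d)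
    (B1 : ∀ d, y d < z d → B (b d) = b (t d)) (B2 : ∀ d, y d = z d → B (b d) = q • b (t d))
    (B3 : ∀ d, z d < y d → B (b d) = q • b (t d) + (q - 1) • b d) (d : D) :
    A (B (A (B (b d)))) = B (A (B (A (b d)))) := by
  rcases lt_trichotomy 0 (y d) with h | h | h <;>
  rcases lt_trichotomy 0 (z d) with h1 | h1 | h1 <;>
  rcases lt_trichotomy (y d) (z d) with h2 | h2 | h2 <;>
  rcases lt_trichotomy (y d) (- z d) with h3 | h3 | h3 <;>
  first
  | (exfalso; omega)
  | (simp (disch := ((try simp only [ys, zs, yt, zt]); omega)) only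
      [A1, A2, A3, B1, B2, B3, map_add, map_smul, hss, htt, hst, hse, hte, smul_add]; try module)

section
variable {k : Type u} [Field k] (q Q : k) (n m : ℕ)

noncomputable instance : AddCommGroup (TensorSpace q Q n m) :=
  inferInstanceAs (AddCommGroup (⨂[k] _ : Fin n, (IndexSet m → k)))

noncomputable instance : Module k (TensorSpace q Q n m) :=
  inferInstanceAs (Module k (⨂[k] _ : Fin n, (IndexSet m → k)))

/-- The basis `v_d = v_{d_1} ⊗ ⋯ ⊗ v_{d_n}`, `d ∈ I(m)^n`. -/
noncomputable def tensorBasis : Module.Basis (Fin n → IndexSet m) k (TensorSpace q Q n m) :=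
  Basis.piTensorProduct fun _ => Pi.basisFun k (IndexSet m)

variable {n m}

/-- `d · s_t`: negate the first entry (`t = 0`), or swap the `t`-th and `(t+1)`-st entries
(positions `t-1` and `t` when counted from zero). -/
def act (d : Fin n → IndexSet m) (t : Fin n) : Fin n → IndexSet m :=
  if t.1 = 0 then Function.update d t (-d t)
  else d ∘ Equiv.swap ⟨t.1 - 1, by omega⟩ t


/-- The value `d_{t+1}` (the entry `d t`) is compared with: `0` if `t = 0`, else its left neighbour. -/
def leftValue (d : Fin n → IndexSet m) (t : Fin n) : ℤ :=
  if t.1 = 0 then 0 else (d ⟨t.1 - 1, by omega⟩).1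

/-- The vector `v_d T_t`. -/
noncomputable def heckeOpBasis (t : Fin n) (d : Fin n → IndexSet m) : TensorSpace q Q n m :=
  if leftValue d t < (d t).1 then tensorBasis q Q n m (act d t)
  else if leftValue d t = (d t).1 then heckeParam q Q t.1 • tensorBasis q Q n m (act d t)
  else heckeParam q Q t.1 • tensorBasis q Q n m (act d t) +
    (heckeParam q Q t.1 - 1) • tensorBasis q Q n m d

/-- Right multiplication by `T_t` on `V^{⊗n}`. -/
noncomputable def heckeOp (t : Fin n) : Module.End k (TensorSpace q Q n m) :=
  (tensorBasis q Q n m).constr k (heckeOpBasis q Q t)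

theorem heckeOp_basis (t : Fin n) (d : Fin n → IndexSet m) :
    heckeOp q Q t (tensorBasis q Q n m d) = heckeOpBasis q Q t d :=
  Module.Basis.constr_basis _ _ _ _

theorem act_zero_apply (d : Fin n → IndexSet m) (t j : Fin n) (ht : t.1 = 0) :
    act d t j = if j = t then -d t else d j := by
  simp [act, ht, Function.update_apply]

theorem act_pos_apply (d : Fin n → IndexSet m) (t j : Fin n) (ht : t.1 ≠ 0) :
    act d t j = if j = t then d ⟨t.1 - 1, by omega⟩
      else if j.1 = t.1 - 1 then d t else d j := by
  simp only [act, ht, if_false, Function.comp_apply, Equiv.swap_apply_def, Fin.ext_iff]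
  split_ifs <;> first | rfl | omega

theorem neg_val (i : IndexSet m) : (-i).1 = -i.1 := rfl


theorem act_act (d : Fin n → IndexSet m) (t : Fin n) : act (act d t) t = d := by
  funext j
  by_cases ht : t.1 = 0
  · simp only [act_zero_apply _ _ _ ht]
    split_ifs with h
    · rw [h]; exact Subtype.ext (neg_neg _)
    · rfl
  · simp [act, ht]

theorem act_of_eq (d : Fin n → IndexSet m) (t : Fin n) (h : leftValue d t = (d t).1) :
    act d t = d := by
  funext j
  by_cases ht : t.1 = 0
  · simp only [act_zero_apply _ _ _ ht]
    simp only [leftValue, ht, if_true] at h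
    split_ifs with hj
    · subst hj; apply Subtype.ext; rw [neg_val]; omega
    · rfl
  · simp only [leftValue, ht, if_false] at h
    have h := Subtype.ext h
    simp only [act_pos_apply _ _ _ ht]
    split_ifs with hj hj'
    · rw [hj, h]
    · rw [← h]; congr 1; ext; simp [hj']
    · rfl

theorem heckeOp_lt (t : Fin n) (d : Fin n → IndexSet m) (h : leftValue d t < (d t).1) :
    heckeOp q Q t (tensorBasis q Q n m d) = tensorBasis q Q n m (act d t) := by
  rw [heckeOp_basis, heckeOpBasis, if_pos h]

theorem heckeOp_eq (t : Fin n) (d : Fin n → IndexSet m) (h : leftValue d t = (d t).1) :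
    heckeOp q Q t (tensorBasis q Q n m d) =
      heckeParam q Q t.1 • tensorBasis q Q n m (act d t) := by
  rw [heckeOp_basis, heckeOpBasis, if_neg h.not_lt, if_pos h]

theorem heckeOp_gt (t : Fin n) (d : Fin n → IndexSet m) (h : (d t).1 < leftValue d t) :
    heckeOp q Q t (tensorBasis q Q n m d) =
      heckeParam q Q t.1 • tensorBasis q Q n m (act d t) +
        (heckeParam q Q t.1 - 1) • tensorBasis q Q n m d := by
  rw [heckeOp_basis, heckeOpBasis, if_neg h.not_gt, if_neg h.ne']

theorem heckeOp_quadratic (t : Fin n) :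
    (heckeOp q Q (m := m) t + 1) * (heckeOp q Q t - algebraMap k _ (heckeParam q Q t.1)) = 0 := by
  refine (tensorBasis q Q n m).ext fun d => ?_
  have h3 : leftValue (act d t) t - (act d t t).1 = (d t).1 - leftValue d t := by
    by_cases ht : t.1 = 0
    · simp [leftValue, act_zero_apply _ _ _ ht, ht, neg_val]
    · have h4 : t.1 - 1 ≠ t.1 := by omega
      simp [leftValue, act_pos_apply _ _ _ ht, ht, Fin.ext_iff, h4]
  simp only [Module.End.mul_apply, LinearMap.add_apply, LinearMap.sub_apply, Module.End.one_apply,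
    Module.algebraMap_end_apply, map_sub, map_smul, LinearMap.zero_apply]
  rcases lt_trichotomy (leftValue d t) (d t).1 with h | h | h
  · rw [heckeOp_lt _ _ _ _ h, heckeOp_gt _ _ _ _ (by omega), act_act]; module
  · rw [heckeOp_eq _ _ _ _ h, act_of_eq _ _ h, map_smul, heckeOp_eq _ _ _ _ h, act_of_eq _ _ h]
    module
  · rw [heckeOp_gt _ _ _ _ h, map_add, map_smul, map_smul, heckeOp_gt _ _ _ _ h,
      heckeOp_lt _ _ _ _ (by omega), act_act]; module

theorem heckeOp_braid_three (i : ℕ) (hi : 0 < i) (h : i + 1 < n) :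
    heckeOp q Q (m := m) ⟨i, by omega⟩ * heckeOp q Q ⟨i + 1, h⟩ * heckeOp q Q ⟨i, by omega⟩ =
      heckeOp q Q ⟨i + 1, h⟩ * heckeOp q Q ⟨i, by omega⟩ * heckeOp q Q ⟨i + 1, h⟩ := by
  refine (tensorBasis q Q n m).ext fun d => ?_
  have hp : heckeParam q Q i = q := if_neg (by omega)
  have hp' : heckeParam q Q (i + 1) = q := if_neg (by omega)
  have hi0 : i ≠ 0 := by omega
  have e1 := heckeOp_lt (n := n) (m := m) q Q ⟨i, by omega⟩
  have e2 := heckeOp_eq (n := n) (m := m) q Q ⟨i, by omega⟩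
  have e3 := heckeOp_gt (n := n) (m := m) q Q ⟨i, by omega⟩
  have f1 := heckeOp_lt (n := n) (m := m) q Q ⟨i + 1, h⟩
  have f2 := heckeOp_eq (n := n) (m := m) q Q ⟨i + 1, h⟩
  have f3 := heckeOp_gt (n := n) (m := m) q Q ⟨i + 1, h⟩
  simp only [hp, hp'] at e1 e2 e3 f1 f2 f3
  have hl : ∀ d : Fin n → IndexSet m, leftValue d ⟨i + 1, h⟩ = (d ⟨i, by omega⟩).1 := by
    intro d; simp [leftValue]
  have hl' : ∀ d : Fin n → IndexSet m, leftValue d ⟨i, by omega⟩ = (d ⟨i - 1, by omega⟩).1 := by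
    intro d; simp [leftValue, hi0]
  have g1 := act_pos_apply (m := m) (n := n) (t := ⟨i, by omega⟩) (ht := hi0)
  have g2 := act_pos_apply (m := m) (n := n) (t := ⟨i + 1, h⟩) (ht := Nat.succ_ne_zero i)
  refine braid_three_aux q (tensorBasis q Q n m) _ _ (fun d => act d ⟨i, by omega⟩)
    (fun d => act d ⟨i + 1, h⟩) (fun d => leftValue d ⟨i, by omega⟩) (fun d => (d ⟨i, by omega⟩).1)
    (fun d => (d ⟨i + 1, h⟩).1) (fun d => act_act _ _) (fun d => act_act _ _) ?_ ?_ ?_ ?_ ?_ ?_ ?_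
    (fun d hd => act_of_eq _ _ hd) (fun d hd => act_of_eq _ _ ((hl d).trans hd)) e1 e2 e3
    (fun d hd => f1 d ((hl d).trans_lt hd)) (fun d hd => f2 d ((hl d).trans hd))
    (fun d hd => f3 d (hd.trans_eq (hl d).symm)) d
  · intro d
    have s1 : ∀ d : Fin n → IndexSet m, act d ⟨i, by omega⟩ =
        d ∘ Equiv.swap ⟨i - 1, by omega⟩ ⟨i, by omega⟩ := fun d => if_neg hi0
    have s2 : ∀ d : Fin n → IndexSet m, act d ⟨i + 1, h⟩ =
        d ∘ Equiv.swap ⟨i, by omega⟩ ⟨i + 1, h⟩ := fun d => if_neg (Nat.succ_ne_zero i)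
    simp only [s1, s2, Function.comp_assoc, ← Equiv.Perm.coe_mul]
    rw [swap_braid _ _ _ (by simp [Fin.ext_iff]; omega) (by simp [Fin.ext_iff]) (by simp)]
  all_goals
    intro d
    simp only [g1, g2, hl', Fin.ext_iff]
    split_ifs <;> first | omega | rfl

theorem heckeOp_braid_four (h : 1 < n) :
    heckeOp q Q (m := m) ⟨0, by omega⟩ * heckeOp q Q ⟨1, h⟩ * heckeOp q Q ⟨0, by omega⟩ *
        heckeOp q Q ⟨1, h⟩ =
      heckeOp q Q ⟨1, h⟩ * heckeOp q Q ⟨0, by omega⟩ * heckeOp q Q ⟨1, h⟩ *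
        heckeOp q Q ⟨0, by omega⟩ := by
  refine (tensorBasis q Q n m).ext fun d => ?_
  have e1 := heckeOp_lt (n := n) (m := m) q Q ⟨0, by omega⟩
  have e2 := heckeOp_eq (n := n) (m := m) q Q ⟨0, by omega⟩
  have e3 := heckeOp_gt (n := n) (m := m) q Q ⟨0, by omega⟩
  have f1 := heckeOp_lt (n := n) (m := m) q Q ⟨1, h⟩
  have f2 := heckeOp_eq (n := n) (m := m) q Q ⟨1, h⟩
  have f3 := heckeOp_gt (n := n) (m := m) q Q ⟨1, h⟩
  have hp : heckeParam q Q 0 = Q := if_pos rfl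
  have hp' : heckeParam q Q 1 = q := if_neg Nat.one_ne_zero
  simp only [hp, hp'] at e1 e2 e3 f1 f2 f3
  have hl : ∀ d : Fin n → IndexSet m, leftValue d ⟨1, h⟩ = (d ⟨0, by omega⟩).1 := by
    intro d; simp [leftValue]
  have hl' : ∀ d : Fin n → IndexSet m, leftValue d ⟨0, by omega⟩ = 0 := by
    intro d; simp [leftValue]
  have g1 := act_zero_apply (m := m) (n := n) (t := ⟨0, by omega⟩) (ht := rfl)
  have g2 := act_pos_apply (m := m) (n := n) (t := ⟨1, h⟩) (ht := Nat.one_ne_zero)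
  refine braid_four_aux q Q (tensorBasis q Q n m) _ _ (fun d => act d ⟨0, by omega⟩)
    (fun d => act d ⟨1, h⟩) (fun d => (d ⟨0, by omega⟩).1)
    (fun d => (d ⟨1, h⟩).1) (fun d => act_act _ _) (fun d => act_act _ _) ?_ ?_ ?_ ?_ ?_
    (fun d hd => act_of_eq _ _ ((hl' d).trans hd)) (fun d hd => act_of_eq _ _ ((hl d).trans hd))
    (fun d hd => e1 d ((hl' d).trans_lt hd)) (fun d hd => e2 d ((hl' d).trans hd))
    (fun d hd => e3 d (hd.trans_eq (hl' d).symm))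
    (fun d hd => f1 d ((hl d).trans_lt hd)) (fun d hd => f2 d ((hl d).trans hd))
    (fun d hd => f3 d (hd.trans_eq (hl d).symm)) d
  · intro d
    funext j
    simp only [g1, g2, Fin.ext_iff]
    split_ifs <;> first | omega | contradiction | rfl
  all_goals
    intro d
    simp only [g1, g2, Fin.ext_iff]
    rfl

theorem heckeOp_comm (i j : Fin n) (h : i.1 + 1 < j.1) :
    heckeOp q Q (m := m) i * heckeOp q Q j = heckeOp q Q j * heckeOp q Q i := by
  refine (tensorBasis q Q n m).ext fun d => ?_
  have hj : j.1 ≠ 0 := by omega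
  have h1 : ∀ d : Fin n → IndexSet m, leftValue (act d j) i = leftValue d i := by
    intro d
    by_cases hi : i.1 = 0
    · simp [leftValue, hi]
    · simp only [leftValue, hi, if_false, act_pos_apply _ _ _ hj, Fin.ext_iff]
      split_ifs <;> omega
  have h2 : ∀ d : Fin n → IndexSet m, act d j i = d i := by
    intro d
    simp only [act_pos_apply _ _ _ hj, Fin.ext_iff]
    split_ifs <;> first | omega | rfl
  have h3 : ∀ (d : Fin n → IndexSet m) (l : Fin n), i.1 < l.1 → act d i l = d l := by
    intro d l hl
    by_cases hi : i.1 = 0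
    · simp only [act_zero_apply _ _ _ hi, Fin.ext_iff]
      split_ifs <;> first | omega | rfl
    · simp only [act_pos_apply _ _ _ hi, Fin.ext_iff]
      split_ifs <;> first | omega | rfl
  have h4 : ∀ d : Fin n → IndexSet m, leftValue (act d i) j = leftValue d j := by
    intro d
    simp only [leftValue, hj, if_false]
    rw [h3 _ _ (by simp; omega)]
  have h5 : act (act d i) j = act (act d j) i := by
    funext l
    by_cases hi : i.1 = 0
    · simp only [act_zero_apply _ _ _ hi, act_pos_apply _ _ _ hj, Fin.ext_iff]
      split_ifs <;> first | omega | rfl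
    · simp only [act_pos_apply _ _ _ hi, act_pos_apply _ _ _ hj, Fin.ext_iff]
      split_ifs <;> first | omega | rfl
  have h6 := h3 d j (by omega)
  simp only [Module.End.mul_apply]
  rcases lt_trichotomy (leftValue d i) (d i).1 with h | h | h <;>
  rcases lt_trichotomy (leftValue d j) (d j).1 with h' | h' | h' <;>
  · simp (disch := ((try simp only [h1, h2, h4, h6]); assumption)) only [heckeOp_lt, heckeOp_eq,
      heckeOp_gt, map_add, map_smul, h5, smul_add]
    try module

/-- The right action of the Hecke algebra on `V^{⊗n}`. -/
noncomputable def heckeActionHom : Hecke q Q n →ₐ[k] (Module.End k (TensorSpace q Q n m))ᵐᵒᵖ :=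
  Hecke.lift q Q n (FreeAlgebra.lift k fun t => op (heckeOp q Q t)) <| by
    intro x y hxy
    induction hxy with
    | quadratic i =>
      apply unop_injective
      simpa using! heckeOp_quadratic (m := m) q Q i
    | braid_four h =>
      apply unop_injective
      simpa [mul_assoc] using! (heckeOp_braid_four (m := m) q Q h).symm
    | braid_three i hi h =>
      apply unop_injective
      simpa [mul_assoc] using! heckeOp_braid_three (m := m) q Q i hi h
    | comm i j h =>
      apply unop_injective
      simpa using! (heckeOp_comm (m := m) q Q i j h).symm

noncomputable instance : Module (Hecke q Q n)ᵐᵒᵖ (TensorSpace q Q n m) :=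
  Module.compHom _ (AlgHom.opComm (heckeActionHom q Q (m := m))).toRingHom

instance : SMulCommClass (Hecke q Q n)ᵐᵒᵖ k (TensorSpace q Q n m) :=
  ⟨fun h c v => map_smul (AlgHom.opComm (heckeActionHom q Q (m := m)) h) c v⟩

instance : IsScalarTower k (Hecke q Q n)ᵐᵒᵖ (TensorSpace q Q n m) :=
  ⟨fun c h v => by
    change (AlgHom.opComm (heckeActionHom q Q (m := m)) (c • h)) v =
      c • (AlgHom.opComm (heckeActionHom q Q (m := m)) h) v
    rw [map_smul, LinearMap.smul_apply]⟩

/-- The generator `T_i`. -/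
noncomputable def Hecke.T (i : Fin n) : Hecke q Q n :=
  Hecke.mk q Q n (FreeAlgebra.ι k i)

theorem tensorSpace_smul_T (t : Fin n) (v : TensorSpace q Q n m) :
    op (Hecke.T q Q t) • v = heckeOp q Q t v := by
  change (AlgHom.opComm (heckeActionHom q Q (m := m)) (op (Hecke.T q Q t))) v = _
  simp [heckeActionHom, Hecke.T, Hecke.lift_mk]


variable (n m)

/-- The type B Schur algebra `L^n(m) = End_{H_n}(V^{⊗n})` (right `H_n`-modules). -/
abbrev TypeBSchurAlgebra : Type u := Module.End (Hecke q Q n)ᵐᵒᵖ (TensorSpace q Q n m)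

variable {n}

/-- The Jucys-Murphy element `L_{i+1}`: `L_1 = T_0`, `L_{i+1} = q⁻¹ T_i L_i T_i`. -/
noncomputable def jucysMurphy : (i : ℕ) → i < n → Hecke q Q n
  | 0, h => Hecke.T q Q ⟨0, h⟩
  | i + 1, h =>
    q⁻¹ • (Hecke.T q Q ⟨i + 1, h⟩ * jucysMurphy i (by omega) * Hecke.T q Q ⟨i + 1, h⟩)

end

section Words

variable {n : ℕ}

/-- The simple transposition `s_i`, `1 ≤ i ≤ n-1`. -/
def adjSwap (i : {i : Fin n // 0 < i.1}) : Equiv.Perm (Fin n) :=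
  Equiv.swap ⟨i.1.1 - 1, by omega⟩ i.1

/-- `l` is a reduced expression of `w`. -/
def IsReducedWord (l : List {i : Fin n // 0 < i.1}) (w : Equiv.Perm (Fin n)) : Prop :=
  (l.map adjSwap).prod = w ∧
    ∀ l' : List {i : Fin n // 0 < i.1}, (l'.map adjSwap).prod = w → l.length ≤ l'.length

theorem exists_word (w : Equiv.Perm (Fin n)) :
    ∃ l : List {i : Fin n // 0 < i.1}, (l.map adjSwap).prod = w := by
  rcases n with _ | n
  · exact ⟨[], Subsingleton.elim _ _⟩
  · have hw : w ∈ Submonoid.closure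
        (Set.range fun i : Fin n => Equiv.swap i.castSucc i.succ) := by
      rw [Equiv.Perm.mclosure_swap_castSucc_succ]; trivial
    induction hw using Submonoid.closure_induction with
    | mem x hx =>
      obtain ⟨i, rfl⟩ := hx
      exact ⟨[⟨i.succ, Nat.succ_pos _⟩], by simp [adjSwap]; rfl⟩
    | one => exact ⟨[], rfl⟩
    | mul x y _ _ hx hy =>
      obtain ⟨l, rfl⟩ := hx
      obtain ⟨l', rfl⟩ := hy
      exact ⟨l ++ l', by simp⟩

theorem exists_reducedWord (w : Equiv.Perm (Fin n)) :
    ∃ l : List {i : Fin n // 0 < i.1}, IsReducedWord l w := by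
  classical
  have h : ∃ N, ∃ l : List {i : Fin n // 0 < i.1}, (l.map adjSwap).prod = w ∧ l.length = N :=
    (exists_word w).elim fun l hl => ⟨_, l, hl, rfl⟩
  obtain ⟨l, hl, hN⟩ := Nat.find_spec h
  exact ⟨l, hl, fun l' hl' => hN ▸ Nat.find_min' h ⟨l', hl', rfl⟩⟩

/-- A reduced expression of `w`. -/
noncomputable def reducedWord (w : Equiv.Perm (Fin n)) : List {i : Fin n // 0 < i.1} :=
  (exists_reducedWord w).choose

end Words

/-- Bicompositions of `n` whose first component has `n` parts and whose second one has `r`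
parts (parts may be zero). For `r = m / 2` this is the set `Λ_{n,m}`. -/
def Bicomposition (n r : ℕ) : Type := {l : Fin n ⊕ Fin r → ℕ // ∑ p, l p = n}

namespace Bicomposition

variable {n r : ℕ}

instance : DecidableEq (Bicomposition n r) :=
  inferInstanceAs (DecidableEq {l : Fin n ⊕ Fin r → ℕ // ∑ p, l p = n})

instance : Fintype (Bicomposition n r) :=
  Fintype.subtype (Finset.piAntidiag (Finset.univ : Finset (Fin n ⊕ Fin r)) n) fun l => by simp

/-- The size of the first component. -/
def fstSize (l : Bicomposition n r) : ℕ := ∑ i : Fin n, l.1 (Sum.inl i)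

/-- The sum of all parts before a given part. -/
def partStart (l : Bicomposition n r) : Fin n ⊕ Fin r → ℕ
  | Sum.inl j => ∑ i ∈ Finset.Iio j, l.1 (Sum.inl i)
  | Sum.inr j => l.fstSize + ∑ i ∈ Finset.Iio j, l.1 (Sum.inr i)

/-- The block of consecutive positions belonging to a part. -/
def block (l : Bicomposition n r) (p : Fin n ⊕ Fin r) : Set (Fin n) :=
  {i | l.partStart p ≤ i.1 ∧ i.1 < l.partStart p + l.1 p}

/-- The Young subgroup of a bicomposition. -/
def youngSubgroup (l : Bicomposition n r) : Subgroup (Equiv.Perm (Fin n)) where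
  carrier := {w | ∀ p i, w i ∈ l.block p ↔ i ∈ l.block p}
  one_mem' := fun _ _ => Iff.rfl
  mul_mem' := fun {a b} ha hb p i => (ha p (b i)).trans (hb p i)
  inv_mem' := fun {a} ha p i => by
    have h := ha p (a⁻¹ i)
    rw [show a (a⁻¹ i) = i from a.apply_symm_apply i] at h
    exact h.symm

/-- The subset `Λ^B_{n,m}`: the first component is `(a, 0, …, 0)` for `m` odd, and zero for `m`
even. -/
def IsTypeB (m : ℕ) (l : Bicomposition n r) : Prop :=
  ∀ i : Fin n, l.1 (Sum.inl i) ≠ 0 → Odd m ∧ i.1 = 0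

/-- The bicomposition `(∅, (1^n))` (padded by zero parts), for `m ≥ 2n`. -/
def column {n m : ℕ} (h : 2 * n ≤ m) : Bicomposition n (m / 2) :=
  ⟨Sum.elim (fun _ => 0) (fun j => if j.1 < n then 1 else 0), by
    have h2 : n ≤ m / 2 := by omega
    simp [Fin.card_filter_val_lt, h2]⟩

end Bicomposition

section
variable {k : Type u} [Field k] (q Q : k) {n r : ℕ}

/-- `T_w` for `w` in the symmetric group (independent of the reduced expression, by Matsumoto). -/
noncomputable def heckeT (w : Equiv.Perm (Fin n)) : Hecke q Q n :=
  ((reducedWord w).map fun i => Hecke.T q Q i.1).prod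

/-- `u_λ = ∏_{i ≤ |λ^(1)|} (L_i + 1)`. -/
noncomputable def uElem (l : Bicomposition n r) : Hecke q Q n :=
  (((List.finRange n).take l.fstSize).map fun i => jucysMurphy q Q i.1 i.2 + 1).prod

open Classical in
/-- `x_λ = ∑_{w ∈ S_λ} T_w`. -/
noncomputable def xElem (l : Bicomposition n r) : Hecke q Q n :=
  ∑ w : Equiv.Perm (Fin n) with w ∈ l.youngSubgroup, heckeT q Q w

/-- `m_λ = u_λ x_λ`. -/
noncomputable def mElem (l : Bicomposition n r) : Hecke q Q n := uElem q Q l * xElem q Q l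

/-- The right ideal `M^λ = m_λ H_n`. -/
noncomputable def permModule (l : Bicomposition n r) : Submodule (Hecke q Q n)ᵐᵒᵖ (Hecke q Q n) :=
  Submodule.span _ {mElem q Q l}

variable (n) (m : ℕ)

/-- `M^Λ = ⨁_{λ ∈ Λ_{n,m}} M^λ`. -/
def TotalModule : Type u := ⨁ l : Bicomposition n (m / 2), permModule q Q l

noncomputable instance : AddCommGroup (TotalModule q Q n m) :=
  inferInstanceAs (AddCommGroup (⨁ l : Bicomposition n (m / 2), permModule q Q l))

noncomputable instance : Module (Hecke q Q n)ᵐᵒᵖ (TotalModule q Q n m) :=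
  inferInstanceAs
    (Module (Hecke q Q n)ᵐᵒᵖ (⨁ l : Bicomposition n (m / 2), permModule q Q l))

noncomputable instance : Module k (TotalModule q Q n m) :=
  inferInstanceAs (Module k (⨁ l : Bicomposition n (m / 2), permModule q Q l))

instance : SMulCommClass (Hecke q Q n)ᵐᵒᵖ k (TotalModule q Q n m) :=
  inferInstanceAs
    (SMulCommClass (Hecke q Q n)ᵐᵒᵖ k (⨁ l : Bicomposition n (m / 2), permModule q Q l))

instance : IsScalarTower k (Hecke q Q n)ᵐᵒᵖ (TotalModule q Q n m) :=
  inferInstanceAs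
    (IsScalarTower k (Hecke q Q n)ᵐᵒᵖ (⨁ l : Bicomposition n (m / 2), permModule q Q l))

/-- The Dipper-James-Mathas cyclotomic `q`-Schur algebra `S^n(Λ_{n,m}) = End_{H_n}(M^Λ)`. -/
abbrev CyclotomicSchurAlgebra : Type u := Module.End (Hecke q Q n)ᵐᵒᵖ (TotalModule q Q n m)

variable {n m}

/-- Inclusion of a summand. -/
noncomputable def incl (l : Bicomposition n (m / 2)) :
    permModule q Q l →ₗ[(Hecke q Q n)ᵐᵒᵖ] TotalModule q Q n m :=
  DirectSum.lof (Hecke q Q n)ᵐᵒᵖ _ (fun l => permModule q Q l) l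

/-- Projection to a summand. -/
noncomputable def proj (l : Bicomposition n (m / 2)) :
    TotalModule q Q n m →ₗ[(Hecke q Q n)ᵐᵒᵖ] permModule q Q l :=
  DirectSum.component (Hecke q Q n)ᵐᵒᵖ _ (fun l => permModule q Q l) l

theorem proj_incl_same (l : Bicomposition n (m / 2)) (x : permModule q Q l) :
    proj q Q l (incl q Q l x) = x :=
  DirectSum.component.lof_self _ _ _

theorem proj_incl_ne (l l' : Bicomposition n (m / 2)) (h : l' ≠ l) (x : permModule q Q l') :
    proj q Q l (incl q Q l' x) = 0 := by
  refine (DirectSum.component.of _ _ _ _).trans ?_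
  rw [dif_neg h]

/-- `φ_λ`: the identity on `M^λ`, zero on the other summands. -/
noncomputable def phi (l : Bicomposition n (m / 2)) : CyclotomicSchurAlgebra q Q n m :=
  (incl q Q l).comp (proj q Q l)

theorem phi_mul (l l' : Bicomposition n (m / 2)) :
    phi q Q l * phi q Q l' = if l = l' then phi q Q l else 0 := by
  refine LinearMap.ext fun x => ?_
  by_cases h : l = l'
  · subst h
    rw [if_pos rfl]
    exact congrArg (incl q Q l) (proj_incl_same q Q l _)
  · rw [if_neg h]
    exact (congrArg (incl q Q l) (proj_incl_ne q Q l l' (Ne.symm h) _)).trans (map_zero _)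

theorem phi_idem (l : Bicomposition n (m / 2)) : IsIdempotentElem (phi q Q l) := by
  rw [IsIdempotentElem, phi_mul, if_pos rfl]

variable (n m)

open Classical in
/-- `e_n = ∑_{λ ∈ Λ^B_{n,m}} φ_λ`. -/
noncomputable def typeBIdem : CyclotomicSchurAlgebra q Q n m :=
  ∑ l : Bicomposition n (m / 2) with l.IsTypeB m, phi q Q l

theorem typeBIdem_idem : IsIdempotentElem (typeBIdem q Q n m) := by
  classical
  simp only [IsIdempotentElem, typeBIdem, Finset.sum_mul_sum, phi_mul]
  refine Finset.sum_congr rfl fun l hl => ?_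
  rw [Finset.sum_ite_eq, if_pos hl]

end

section Corner

variable {k A : Type*} [Field k] [Ring A] [Algebra k A] {e : A} (he : IsIdempotentElem e)

instance : SMul k he.Corner :=
  ⟨fun c a => ⟨c • a.1, a.2.elim fun x hx => ⟨c • x, by simp [← hx]⟩⟩⟩

instance : Module k he.Corner :=
  Function.Injective.module k (⟨⟨fun a => a.1, rfl⟩, fun _ _ => rfl⟩ : he.Corner →+ A)
    Subtype.val_injective fun _ _ => rfl

instance : Algebra k he.Corner :=
  Algebra.ofModule (fun c a b => Subtype.ext (smul_mul_assoc c a.1 b.1))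
    (fun c a b => Subtype.ext (mul_smul_comm c a.1 b.1))

end Corner

section RightTruncation

variable {A : Type u} [Ring A] {e : A} (he : IsIdempotentElem e)

/-- `M e`, for a right `A`-module `M`. -/
def rightTrunc (e : A) (M : Type*) [AddCommGroup M] [Module Aᵐᵒᵖ M] : AddSubgroup M :=
  (DistribSMul.toAddMonoidHom M (op e)).range

theorem corner_smul_mem {M : Type*} [AddCommGroup M] [Module Aᵐᵒᵖ M] (a : he.Corner)
    (x : M) : op a.1 • x ∈ rightTrunc e M :=
  ⟨op a.1 • x, by
    have h := ((Subsemigroup.mem_corner_iff he).1 a.2).2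
    simp [smul_smul, ← op_mul, h]⟩

instance (M : Type*) [AddCommGroup M] [Module Aᵐᵒᵖ M] :
    Module he.Cornerᵐᵒᵖ (rightTrunc e M) where
  smul a x := ⟨op a.unop.1 • x.1, corner_smul_mem he a.unop x.1⟩
  one_smul x := by
    obtain ⟨_, y, rfl⟩ := x
    apply Subtype.ext
    change op e • op e • y = op e • y
    rw [smul_smul, ← op_mul, he.eq]
  mul_smul a b x := Subtype.ext (by
    change op (b.unop.1 * a.unop.1) • x.1 = op a.unop.1 • op b.unop.1 • x.1
    rw [op_mul, mul_smul])
  smul_zero a := Subtype.ext (smul_zero _)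
  smul_add a x y := Subtype.ext (smul_add _ _ _)
  add_smul a b x := Subtype.ext (by
    exact add_smul (op a.unop.1) (op b.unop.1) x.1)
  zero_smul x := Subtype.ext (by
    change op (0 : A) • x.1 = 0
    rw [op_zero, zero_smul])

/-- The map `M e → N e` induced by a homomorphism. -/
def rightTruncMap {M N : Type*} [AddCommGroup M] [Module Aᵐᵒᵖ M] [AddCommGroup N] [Module Aᵐᵒᵖ N]
    (f : M →ₗ[Aᵐᵒᵖ] N) : rightTrunc e M →ₗ[he.Cornerᵐᵒᵖ] rightTrunc e N where
  toFun x := ⟨f x.1, by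
    obtain ⟨_, y, rfl⟩ := x
    exact ⟨f y, (f.map_smul _ _).symm⟩⟩
  map_add' x y := Subtype.ext (f.map_add _ _)
  map_smul' a x := Subtype.ext (f.map_smul _ _)

/-- The functor `M ↦ M e` from right `A`-modules to right `eAe`-modules. -/
def truncFunctor : ModuleCat.{u} Aᵐᵒᵖ ⥤ ModuleCat.{u} he.Cornerᵐᵒᵖ where
  obj M := ModuleCat.of _ (rightTrunc e M)
  map f := ModuleCat.ofHom (rightTruncMap he f.hom)

/-- The functor `M ↦ M e`, with values viewed as right `B`-modules through `ψ : B ≅ eAe`. -/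
noncomputable def cornerFunctor {B : Type u} [Ring B] (ψ : B ≃+* he.Corner) :
    ModuleCat.{u} Aᵐᵒᵖ ⥤ ModuleCat.{u} Bᵐᵒᵖ :=
  truncFunctor he ⋙ ModuleCat.restrictScalars (RingEquiv.op ψ).toRingHom

end RightTruncation

/-- `F` is a quotient functor of abelian categories: it is exact and induces an equivalence from
the Serre quotient of its source by its kernel, i.e. it is the localization at the morphisms whose
kernel and cokernel are killed by `F`. -/
structure IsQuotientFunctor {C D : Type*} [Category C] [Category D] [Abelian C] [Abelian D]
    (F : C ⥤ D) : Prop where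
  additive : F.Additive
  preservesFiniteLimits : Limits.PreservesFiniteLimits F
  preservesFiniteColimits : Limits.PreservesFiniteColimits F
  isLocalization : F.IsLocalization (F.kernel.isoModSerre)


/-- The restriction of a functor to finitely generated right modules. -/
noncomputable def fgRestrict {A B : Type u} [Ring A] [Ring B]
    (F : ModuleCat.{u} Aᵐᵒᵖ ⥤ ModuleCat.{u} Bᵐᵒᵖ)
    (hF : ∀ M, ModuleCat.isFG Aᵐᵒᵖ M → ModuleCat.isFG Bᵐᵒᵖ (F.obj M)) :
    FGModuleCat.{u} Aᵐᵒᵖ ⥤ FGModuleCat.{u} Bᵐᵒᵖ :=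
  (ModuleCat.isFG Bᵐᵒᵖ).lift ((ModuleCat.isFG Aᵐᵒᵖ).ι ⋙ F) fun M => hF M.obj M.property

/-- `F` is a quotient functor, both on all right modules and on finitely generated ones (these
form abelian categories as the rings are right Noetherian). -/
def IsModuleQuotientFunctor {A B : Type u} [Ring A] [Ring B]
    (F : ModuleCat.{u} Aᵐᵒᵖ ⥤ ModuleCat.{u} Bᵐᵒᵖ) : Prop :=
  IsQuotientFunctor F ∧
    ∃ (_ : IsNoetherianRing Aᵐᵒᵖ) (_ : IsNoetherianRing Bᵐᵒᵖ)
      (hF : ∀ M, ModuleCat.isFG Aᵐᵒᵖ M → ModuleCat.isFG Bᵐᵒᵖ (F.obj M)),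
      IsQuotientFunctor (fgRestrict F hF)

end TypeBSchur

open TypeBSchur

/-! The key fact is a presentation of tensor space. Call a tuple dominant if 0 ≤ d_1 ≤ … ≤ d_n. As
an H_n-module, V^{⊗n} is generated by the dominant v_d, subject only to v_d T_t = q_t v_d at the
positions t that fix d (`tensorLift`, `tensorHom_ext`). Indeed v_d = v_{d·s_t} T_t at a descent t,
so a homomorphism is computed by removing descents. The result does not depend on the order of
removal, because the braid relations are exactly the local confluence of this rewriting.

Dominant tuples correspond to Λ^B_{n,m} by weight: count the zeros and the entries of each absolute
value. Each m_λ satisfies the relations of its v_d, so v_d ↦ m_λ extends to `tensorEmbed` from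
V^{⊗n} to M^Λ, with image e_n M^Λ. For injectivity, take the regular vector v_1 ⊗ ⋯ ⊗ v_n in the
tensor space with m = 2n. No position fixes its tuple, so the presentation yields a homomorphism to
H_n sending it to 1; it therefore generates a free module, and identities in H_n can be checked on
it. Applied to it, m_λ gives the sum of v_e over the signed permutations e that stretch to d
(`mElem_smul_regularVec`). Hence `tensorEmbed`, followed by the projection to M^λ and the orbit map
of the regular vector, is the stretching map `stretchHom`. Every coefficient of a tensor is visible
in some stretching map, so no nonzero tensor is killed. Neither a basis theorem for H_n nor a
dimension count is needed.

Statement (1) follows since the endomorphism ring of the summand cut out by e_n is the corner at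
e_n. For (2), M ↦ Me is exact and has the right adjoint Hom_B(Ae, -), where B is the corner ring
eAe. The counit is invertible, so the adjoint is fully faithful and M ↦ Me is a Serre quotient. All
algebras are finite-dimensional, so the adjunction restricts to finitely generated modules. For (3),
m_ω = 1 gives M^ω = H_n, and φ_ω lies below e_n, so truncating by e_n and then by f is truncating by
φ_ω. -/

namespace TypeBSchur

/-! ### Idempotent truncation and its right adjoint -/

section CornerFunctor

variable {A B : Type u} [Ring A] [Ring B] {e : A} (he : IsIdempotentElem e)

theorem idem_smul_of_mem_rightTrunc {M : Type*} [AddCommGroup M] [Module Aᵐᵒᵖ M] 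
    (he : IsIdempotentElem e) {x : M} (hx : x ∈ rightTrunc e M) : op e • x = x := by
  obtain ⟨y, rfl⟩ := hx
  change op e • op e • y = op e • y
  rw [smul_smul, ← op_mul, he.eq]

theorem corner_mul_left (a : he.Corner) : e * a.1 = a.1 :=
  ((Subsemigroup.mem_corner_iff he).1 a.2).1

theorem corner_mul_right (a : he.Corner) : a.1 * e = a.1 :=
  ((Subsemigroup.mem_corner_iff he).1 a.2).2

variable (ψ : B ≃+* he.Corner)

/-- The inclusion of `M e` into `M`. -/
def cornerIncl (M : ModuleCat.{u} Aᵐᵒᵖ) : (cornerFunctor he ψ).obj M →+ M :=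
  (rightTrunc e M).subtype

/-- An element of `M` fixed by `e`, as an element of `M e`. -/
def cornerMk (M : ModuleCat.{u} Aᵐᵒᵖ) (x : M) (hx : op e • x = x) : (cornerFunctor he ψ).obj M :=
  (⟨x, x, hx⟩ : rightTrunc e M)

theorem cornerIncl_mk (M : ModuleCat.{u} Aᵐᵒᵖ) (x : M) (hx : op e • x = x) :
    cornerIncl he ψ M (cornerMk he ψ M x hx) = x := rfl

theorem cornerIncl_injective (M : ModuleCat.{u} Aᵐᵒᵖ) :
    Function.Injective (cornerIncl he ψ M) := Subtype.val_injective

theorem idem_smul_cornerIncl (M : ModuleCat.{u} Aᵐᵒᵖ) (x : (cornerFunctor he ψ).obj M) :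
    op e • cornerIncl he ψ M x = cornerIncl he ψ M x :=
  idem_smul_of_mem_rightTrunc he (Subtype.property (p := (· ∈ rightTrunc e M)) x)

theorem cornerIncl_smul (M : ModuleCat.{u} Aᵐᵒᵖ) (b : Bᵐᵒᵖ) (x : (cornerFunctor he ψ).obj M) :
    cornerIncl he ψ M (b • x) = op (ψ b.unop).1 • cornerIncl he ψ M x := rfl

instance cornerFunctor_additive : (cornerFunctor he ψ).Additive where
  map_add := by
    intro M N f g
    ext x
    exact cornerIncl_injective he ψ N rfl

/-- Since e fixes M e pointwise, a preimage y of an element of M e can be replaced by y e. -/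
theorem cornerFunctor_exact (S : ShortComplex (ModuleCat.{u} Aᵐᵒᵖ)) (hS : S.Exact) :
    (S.map (cornerFunctor he ψ)).Exact := by
  rw [ShortComplex.moduleCat_exact_iff] at hS ⊢
  intro x hx
  have hx' : S.g (cornerIncl he ψ _ x) = 0 := congrArg (cornerIncl he ψ _) hx
  obtain ⟨y, hy⟩ := hS _ hx'
  refine ⟨cornerMk he ψ _ (op e • y) ?_, cornerIncl_injective he ψ _ ?_⟩
  · rw [smul_smul, ← op_mul, he.eq]
  · change S.f (op e • y) = _
    rw [map_smul, hy]
    exact idem_smul_cornerIncl he ψ _ x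

theorem cornerFunctor_preservesFinite :
    Limits.PreservesFiniteLimits (cornerFunctor he ψ) ∧
      Limits.PreservesFiniteColimits (cornerFunctor he ψ) :=
  ((Functor.exact_tfae (cornerFunctor he ψ)).out 1 3).1 (cornerFunctor_exact he ψ)

/-- The right `B`-module `A e`. -/
noncomputable abbrev idealModule : ModuleCat.{u} Bᵐᵒᵖ :=
  (cornerFunctor he ψ).obj (ModuleCat.of Aᵐᵒᵖ A)

/-- The inclusion of `A e` into `A`. -/
def idealIncl : idealModule he ψ →+ A := (rightTrunc e A).subtype

theorem idealIncl_injective : Function.Injective (idealIncl he ψ) := Subtype.val_injective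

theorem idealIncl_mul_idem (x : idealModule he ψ) : idealIncl he ψ x * e = idealIncl he ψ x :=
  idem_smul_of_mem_rightTrunc he (Subtype.property (p := (· ∈ rightTrunc e A)) x)

theorem idealIncl_smul (b : Bᵐᵒᵖ) (x : idealModule he ψ) :
    idealIncl he ψ (b • x) = idealIncl he ψ x * (ψ b.unop).1 := rfl

/-- Left multiplication by `a` on `A e`. -/
noncomputable def idealMul (a : A) : idealModule he ψ →ₗ[Bᵐᵒᵖ] idealModule he ψ :=
  ((cornerFunctor he ψ).map (ModuleCat.ofHom (Module.toModuleEnd Aᵐᵒᵖ A a))).hom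

theorem idealIncl_mul (a : A) (x : idealModule he ψ) :
    idealIncl he ψ (idealMul he ψ a x) = a * idealIncl he ψ x := rfl

/-- The element `e` of `A e`. -/
noncomputable def idealIdem : idealModule he ψ :=
  cornerMk he ψ (ModuleCat.of Aᵐᵒᵖ A) e he.eq

theorem idealIncl_idem : idealIncl he ψ (idealIdem he ψ) = e := rfl

/-- `Hom_B(A e, N)`. -/
def Coind (N : Type u) [AddCommGroup N] [Module Bᵐᵒᵖ N] : Type u :=
  idealModule he ψ →ₗ[Bᵐᵒᵖ] N

section
variable (N : Type u) [AddCommGroup N] [Module Bᵐᵒᵖ N]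

noncomputable instance : AddCommGroup (Coind he ψ N) :=
  inferInstanceAs (AddCommGroup (idealModule he ψ →ₗ[Bᵐᵒᵖ] N))

/-- An element of `Hom_B(A e, N)`, as a homomorphism. -/
noncomputable def coindEval : Coind he ψ N →+ (idealModule he ψ →ₗ[Bᵐᵒᵖ] N) := AddMonoidHom.id _

noncomputable instance : Module Aᵐᵒᵖ (Coind he ψ N) where
  smul a g := LinearMap.comp g (idealMul he ψ a.unop)
  one_smul g := LinearMap.ext fun _ =>
    congrArg (coindEval he ψ N g) (idealIncl_injective he ψ (one_mul _))
  mul_smul a b g := LinearMap.ext fun x =>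
    congrArg (coindEval he ψ N g)
      (idealIncl_injective he ψ (mul_assoc b.unop a.unop (idealIncl he ψ x)))
  smul_zero _ := rfl
  smul_add _ _ _ := rfl
  add_smul a b g := LinearMap.ext fun x =>
    (congrArg (coindEval he ψ N g) (idealIncl_injective he ψ
      (add_mul a.unop b.unop (idealIncl he ψ x)))).trans (LinearMap.map_add g _ _)
  zero_smul g := LinearMap.ext fun x =>
    (congrArg (coindEval he ψ N g) (idealIncl_injective he ψ
      ((zero_mul (idealIncl he ψ x)).trans (map_zero (idealIncl he ψ)).symm))).trans
      (LinearMap.map_zero g)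

end

/-- The functor `N ↦ Hom_B(A e, N)`. -/
noncomputable def coindFunctor : ModuleCat.{u} Bᵐᵒᵖ ⥤ ModuleCat.{u} Aᵐᵒᵖ where
  obj N := ModuleCat.of _ (Coind he ψ N)
  map {N N'} f := ModuleCat.ofHom (Y := Coind he ψ N')
    { toFun := fun g => LinearMap.comp f.hom g
      map_add' := fun g h => LinearMap.comp_add _ _ _
      map_smul' := fun a g => rfl }

/-- An element of the coinduced module, as a homomorphism. -/
noncomputable def coindHom (N : ModuleCat.{u} Bᵐᵒᵖ) :
    (coindFunctor he ψ).obj N →+ (idealModule he ψ →ₗ[Bᵐᵒᵖ] N) := AddMonoidHom.id _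

theorem coindHom_ext (N : ModuleCat.{u} Bᵐᵒᵖ) {g h : (coindFunctor he ψ).obj N}
    (H : ∀ x, coindHom he ψ N g x = coindHom he ψ N h x) : g = h := LinearMap.ext H

theorem coindHom_smul (N : ModuleCat.{u} Bᵐᵒᵖ) (a : Aᵐᵒᵖ) (g : (coindFunctor he ψ).obj N)
    (x : idealModule he ψ) :
    coindHom he ψ N (a • g) x = coindHom he ψ N g (idealMul he ψ a.unop x) := rfl

/-- The element `x a` of `M e`, for `a ∈ A e`. -/
noncomputable def orbitMap (M : ModuleCat.{u} Aᵐᵒᵖ) (x : M) :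
    idealModule he ψ →ₗ[Bᵐᵒᵖ] (cornerFunctor he ψ).obj M where
  toFun a := cornerMk he ψ M (op (idealIncl he ψ a) • x) (by
    rw [smul_smul, ← op_mul, idealIncl_mul_idem])
  map_add' a b := cornerIncl_injective he ψ _ (by
    refine (congrArg (fun t : A => op t • x) (map_add (idealIncl he ψ) a b)).trans ?_
    exact add_smul _ _ _)
  map_smul' b a := cornerIncl_injective he ψ _ (by
    simp only [cornerIncl_mk, cornerIncl_smul, RingHom.id_apply, smul_smul, idealIncl_smul,
      op_mul])

theorem cornerIncl_orbitMap (M : ModuleCat.{u} Aᵐᵒᵖ) (x : M) (a : idealModule he ψ) :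
    cornerIncl he ψ M (orbitMap he ψ M x a) = op (idealIncl he ψ a) • x := rfl

/-- The unit `M → Hom_B(A e, M e)`. -/
noncomputable def coindUnit (M : ModuleCat.{u} Aᵐᵒᵖ) :
    M ⟶ (coindFunctor he ψ).obj ((cornerFunctor he ψ).obj M) :=
  ModuleCat.ofHom (Y := Coind he ψ ((cornerFunctor he ψ).obj M))
  { toFun := fun x => orbitMap he ψ M x
    map_add' := fun x y => LinearMap.ext fun a => cornerIncl_injective he ψ _ (smul_add _ x y)
    map_smul' := fun a x => LinearMap.ext fun b => cornerIncl_injective he ψ _ (by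
      refine (smul_smul (op (idealIncl he ψ b)) a x).trans ?_
      exact (cornerIncl_orbitMap he ψ M x (idealMul he ψ a.unop b)).symm) }

/-- The counit `Hom_B(A e, N) e → N`, evaluation at `e`. -/
noncomputable def coindCounit (N : ModuleCat.{u} Bᵐᵒᵖ) :
    (cornerFunctor he ψ).obj ((coindFunctor he ψ).obj N) ⟶ N :=
  ModuleCat.ofHom (X := (cornerFunctor he ψ).obj ((coindFunctor he ψ).obj N))
  { toFun := fun g => coindHom he ψ N (cornerIncl he ψ _ g) (idealIdem he ψ)
    map_add' := fun g h => rfl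
    map_smul' := fun b g => by
      change coindHom he ψ N (cornerIncl he ψ _ g) (idealMul he ψ (ψ b.unop).1 (idealIdem he ψ)) = _
      refine Eq.trans (congrArg _ (idealIncl_injective he ψ ?_))
        (LinearMap.map_smul (coindHom he ψ N (cornerIncl he ψ _ g)) b (idealIdem he ψ))
      exact (corner_mul_right he _).trans (corner_mul_left he _).symm }

theorem coindCounit_apply (N : ModuleCat.{u} Bᵐᵒᵖ)
    (g : (cornerFunctor he ψ).obj ((coindFunctor he ψ).obj N)) :
    coindCounit he ψ N g = coindHom he ψ N (cornerIncl he ψ _ g) (idealIdem he ψ) := rfl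

/-- The adjunction between `M ↦ M e` and `N ↦ Hom_B(A e, N)`. -/
noncomputable def coindAdjunction : cornerFunctor he ψ ⊣ coindFunctor he ψ where
  unit := { app := coindUnit he ψ
            naturality := fun M N f => by
              ext x
              refine coindHom_ext he ψ _ fun a => cornerIncl_injective he ψ _ ?_
              exact (f.hom.map_smul _ _).symm }
  counit := { app := coindCounit he ψ
              naturality := fun M N f => by
                apply ModuleCat.hom_ext
                apply LinearMap.ext
                intro g
                rfl }
  left_triangle_components M := by
    ext x
    exact cornerIncl_injective he ψ _ (idem_smul_cornerIncl he ψ M x)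
  right_triangle_components N := by
    ext g
    refine coindHom_ext he ψ _ fun a => ?_
    change coindHom he ψ N g (idealMul he ψ _ _) = coindHom he ψ N g a
    exact congrArg _ (idealIncl_injective he ψ (idealIncl_mul_idem he ψ a))

theorem idem_mul_mem_corner (a : idealModule he ψ) :
    e * idealIncl he ψ a ∈ Subsemigroup.corner e := by
  rw [Subsemigroup.mem_corner_iff he, ← mul_assoc, he.eq, mul_assoc, idealIncl_mul_idem]
  exact ⟨rfl, rfl⟩

/-- The projection `A e → e A e ≅ B`. -/
noncomputable def idealProj (a : idealModule he ψ) : B :=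
  ψ.symm ⟨e * idealIncl he ψ a, idem_mul_mem_corner he ψ a⟩

theorem apply_idealProj (a : idealModule he ψ) :
    (ψ (idealProj he ψ a)).1 = e * idealIncl he ψ a := by
  exact congrArg Subtype.val (ψ.apply_symm_apply _)

theorem idealProj_eq_iff (a : idealModule he ψ) (b : B) :
    idealProj he ψ a = b ↔ e * idealIncl he ψ a = (ψ b).1 := by
  rw [← ψ.injective.eq_iff, ← apply_idealProj]
  exact Subtype.ext_iff

theorem idealMul_idem (a : idealModule he ψ) :
    idealMul he ψ e a = op (idealProj he ψ a) • idealIdem he ψ := by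
  apply idealIncl_injective he ψ
  rw [idealIncl_smul, unop_op, apply_idealProj, idealIncl_idem, idealIncl_mul, ← mul_assoc, he.eq]

/-- The homomorphism `A e → N` with a given value at `e`, killing `(1 - e) A e`. -/
noncomputable def idealLift (N : ModuleCat.{u} Bᵐᵒᵖ) (y : N) : idealModule he ψ →ₗ[Bᵐᵒᵖ] N where
  toFun a := op (idealProj he ψ a) • y
  map_add' a b := by
    rw [← add_smul, ← MulOpposite.op_add]
    congr 2
    rw [idealProj_eq_iff, map_add]
    rw [map_add, mul_add, ← apply_idealProj, ← apply_idealProj]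
    rfl
  map_smul' b a := by
    rw [RingHom.id_apply, smul_smul]
    congr 1
    apply unop_injective
    rw [unop_mul, unop_op, unop_op, idealProj_eq_iff, map_mul, idealIncl_smul, ← mul_assoc,
      ← apply_idealProj]
    rfl

/-- The elements fixed by e are the g with g(ea) = g(a). They factor through the projection A e → e
A e ≅ B, and a homomorphism out of B is given freely by its value at the unit, here g(e). -/
theorem coindCounit_bijective (N : ModuleCat.{u} Bᵐᵒᵖ) :
    Function.Bijective (coindCounit he ψ N) := by
  constructor
  · rw [injective_iff_map_eq_zero]
    intro g hg
    rw [coindCounit_apply] at hg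
    apply cornerIncl_injective he ψ
    refine coindHom_ext he ψ N fun a => ?_
    have h1 := congrArg (fun t => coindHom he ψ N t a) (idem_smul_cornerIncl he ψ _ g)
    simp only [coindHom_smul, unop_op, idealMul_idem, map_smul, hg, smul_zero] at h1
    rw [← h1]
    rfl
  · intro y
    refine ⟨cornerMk he ψ _ (idealLift he ψ N y) (coindHom_ext he ψ N fun a => ?_), ?_⟩
    · change op (idealProj he ψ (idealMul he ψ e a)) • y = op (idealProj he ψ a) • y
      congr 2
      rw [idealProj_eq_iff, apply_idealProj, idealIncl_mul, ← mul_assoc, he.eq]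
    · rw [coindCounit_apply]
      change op (idealProj he ψ _) • y = y
      have : idealProj he ψ (idealIdem he ψ) = 1 := by
        rw [idealProj_eq_iff, map_one]
        exact he.eq
      rw [this, op_one, one_smul]

instance : IsIso (coindAdjunction he ψ).counit := by
  have : ∀ N, IsIso ((coindAdjunction he ψ).counit.app N) := fun N =>
    (ConcreteCategory.isIso_iff_bijective _).2 (coindCounit_bijective he ψ N)
  exact NatIso.isIso_of_isIso_app _

theorem coindFunctor_full : (coindFunctor he ψ).Full :=
  (coindAdjunction he ψ).fullyFaithfulROfIsIsoCounit.full

theorem coindFunctor_faithful : (coindFunctor he ψ).Faithful :=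
  (coindAdjunction he ψ).fullyFaithfulROfIsIsoCounit.faithful

/-- An exact functor with a fully faithful right adjoint is the localization at the morphisms whose
kernel and cokernel it kills. -/
theorem cornerFunctor_isQuotientFunctor : IsQuotientFunctor (cornerFunctor he ψ) := by
  have := coindFunctor_full he ψ
  have := coindFunctor_faithful he ψ
  obtain ⟨h1, h2⟩ := cornerFunctor_preservesFinite he ψ
  exact ⟨inferInstance, h1, h2,
    Abelian.isLocalization_isoModSerre_kernel_of_leftAdjoint (coindAdjunction he ψ)⟩

end CornerFunctor

/-! ### Finitely generated modules over finite-dimensional algebras -/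

section FiniteDimensional

variable (k : Type u) [Field k]

/-- The underlying vector space of a right module over an algebra. -/
abbrev opModule (A : Type u) [Ring A] [Algebra k A] (M : Type u) [AddCommGroup M] [Module Aᵐᵒᵖ M] :
    Module k M := Module.compHom M (algebraMap k Aᵐᵒᵖ)

/-- Replaces finite generation by finite dimension over k, a condition that can be compared along
functors changing the ring. -/
theorem finite_opModule_iff (A : Type u) [Ring A] [Algebra k A] [Module.Finite k A]
    (M : Type u) [AddCommGroup M] [Module Aᵐᵒᵖ M] :
    Module.Finite Aᵐᵒᵖ M ↔ @Module.Finite k M _ _ (opModule k A M) := by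
  let := opModule k A M
  have : IsScalarTower k Aᵐᵒᵖ M := ⟨fun c a x => by
    rw [Algebra.smul_def, mul_smul]; rfl⟩
  have : Module.Finite k Aᵐᵒᵖ := Module.Finite.equiv (opLinearEquiv k)
  exact ⟨fun _ => Module.Finite.trans Aᵐᵒᵖ M, fun _ => Module.Finite.of_restrictScalars_finite k _ _⟩

theorem isNoetherianRing_op (A : Type u) [Ring A] [Algebra k A] [Module.Finite k A] :
    IsNoetherianRing Aᵐᵒᵖ := by
  have : Module.Finite k Aᵐᵒᵖ := Module.Finite.equiv (opLinearEquiv k)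
  exact isNoetherian_of_tower k inferInstance

variable {k} {A B : Type u} [Ring A] [Ring B] [Algebra k A] [Algebra k B] {e : A}
  (he : IsIdempotentElem e) (ψ : B ≃ₐ[k] he.Corner)

instance [Module.Finite k A] : Module.Finite k he.Corner :=
  Module.Finite.of_injective
    ({ toFun := fun a => a.1
       map_add' := fun _ _ => rfl
       map_smul' := fun _ _ => rfl } : he.Corner →ₗ[k] A) Subtype.val_injective

theorem finite_of_corner_equiv {k A B : Type u} [Field k] [Ring A] [Ring B] [Algebra k A]
    [Algebra k B] {e : A} (he : IsIdempotentElem e) (ψ : B ≃ₐ[k] he.Corner) [Module.Finite k A] : Module.Finite k B :=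
  Module.Finite.equiv ψ.symm.toLinearEquiv

theorem cornerFunctor_finite [Module.Finite k A] (M : ModuleCat.{u} Aᵐᵒᵖ)
    (hM : ModuleCat.isFG Aᵐᵒᵖ M) :
    ModuleCat.isFG Bᵐᵒᵖ ((cornerFunctor he ψ.toRingEquiv).obj M) := by
  have := finite_of_corner_equiv he ψ
  rw [ModuleCat.isFG_iff] at hM ⊢
  rw [finite_opModule_iff k] at hM ⊢
  let := opModule k A M
  let := opModule k B ((cornerFunctor he ψ.toRingEquiv).obj M)
  refine Module.Finite.of_injective
    ({ toFun := cornerIncl he ψ.toRingEquiv M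
       map_add' := map_add _
       map_smul' := fun c x => ?_ } : ((cornerFunctor he ψ.toRingEquiv).obj M) →ₗ[k] M)
    (cornerIncl_injective he _ M)
  change op (ψ (algebraMap k B c)).1 • cornerIncl he ψ.toRingEquiv M x =
    op (algebraMap k A c) • cornerIncl he ψ.toRingEquiv M x
  -- The unit of the corner is e, so the scalar c of B acts as e c, which agrees with c on M e.
  have h : (ψ (algebraMap k B c)).1 = e * algebraMap k A c := by
    rw [AlgEquiv.commutes, Algebra.algebraMap_eq_smul_one, ← Algebra.commutes, ← Algebra.smul_def]
    rfl
  rw [h, op_mul, mul_smul, idem_smul_cornerIncl]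

/-- Hom_B(A e, N) lies in Hom_k(A e, N), and A e is finite-dimensional as the truncation of the
regular module. -/
theorem coindFunctor_finite [Module.Finite k A] (N : ModuleCat.{u} Bᵐᵒᵖ)
    (hN : ModuleCat.isFG Bᵐᵒᵖ N) :
    ModuleCat.isFG Aᵐᵒᵖ ((coindFunctor he ψ.toRingEquiv).obj N) := by
  have := finite_of_corner_equiv he ψ
  have hI := cornerFunctor_finite he ψ (ModuleCat.of Aᵐᵒᵖ A)
    ⟨⟨{(1 : A)}, by
      refine Submodule.eq_top_iff'.2 fun (x : A) => ?_
      rw [Finset.coe_singleton]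
      exact Submodule.mem_span_singleton.2 ⟨op x, one_mul x⟩⟩⟩
  rw [ModuleCat.isFG_iff] at hN hI ⊢
  rw [finite_opModule_iff k] at hN hI ⊢
  let := opModule k A ((coindFunctor he ψ.toRingEquiv).obj N)
  let := opModule k B N
  let := opModule k B (idealModule he ψ.toRingEquiv)
  have := hN
  have := hI
  refine Module.Finite.of_injective (N := idealModule he ψ.toRingEquiv →ₗ[k] N)
    ({ toFun := fun g => 
        { toFun := fun x => coindHom he ψ.toRingEquiv N g x
          map_add' := map_add _
          map_smul' := fun c x => map_smul _ (algebraMap k Bᵐᵒᵖ c) x }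
       map_add' := fun _ _ => rfl
       map_smul' := fun c g => ?_ } : ((coindFunctor he ψ.toRingEquiv).obj N) →ₗ[k] _) ?_
  · refine LinearMap.ext fun x => ?_
    change coindHom he ψ.toRingEquiv N g (idealMul he ψ.toRingEquiv (algebraMap k A c) x) =
      algebraMap k Bᵐᵒᵖ c • coindHom he ψ.toRingEquiv N g x
    rw [← map_smul]
    congr 1
    apply idealIncl_injective
    have h : (ψ (algebraMap k B c)).1 = e * algebraMap k A c := by
      rw [AlgEquiv.commutes, Algebra.algebraMap_eq_smul_one, ← Algebra.commutes, ← Algebra.smul_def]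
      rfl
    change _ = idealIncl he ψ.toRingEquiv x * (ψ (algebraMap k B c)).1
    rw [idealIncl_mul, h, ← mul_assoc, idealIncl_mul_idem, Algebra.commutes]
  · intro g h H
    exact coindHom_ext he _ N fun x => congrArg (fun t => t x) H

theorem cornerFunctor_isModuleQuotientFunctor [Module.Finite k A] :
    IsModuleQuotientFunctor (cornerFunctor he ψ.toRingEquiv) := by
  have := finite_of_corner_equiv he ψ
  refine ⟨cornerFunctor_isQuotientFunctor he _, isNoetherianRing_op k A, isNoetherianRing_op k B,
    cornerFunctor_finite he ψ, ?_⟩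
  have := isNoetherianRing_op k A
  have := isNoetherianRing_op k B
  let F := cornerFunctor he ψ.toRingEquiv
  let G := coindFunctor he ψ.toRingEquiv
  let F' := fgRestrict F (cornerFunctor_finite he ψ)
  let G' := fgRestrict G (coindFunctor_finite he ψ)
  -- Both functors preserve finite generation, so the adjunction restricts to the full
  -- subcategories.
  let adj : F' ⊣ G' := (coindAdjunction he ψ.toRingEquiv).restrictFullyFaithful
    (ModuleCat.isFG Aᵐᵒᵖ).fullyFaithfulι (ModuleCat.isFG Bᵐᵒᵖ).fullyFaithfulι (Iso.refl _)
    (Iso.refl _)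
  obtain ⟨h1, h2⟩ := cornerFunctor_preservesFinite he ψ.toRingEquiv
  have hfull := coindFunctor_full he ψ.toRingEquiv
  have hfaith := coindFunctor_faithful he ψ.toRingEquiv
  have : (((ModuleCat.isFG Bᵐᵒᵖ).ι ⋙ G)).Full := inferInstance
  have : (((ModuleCat.isFG Bᵐᵒᵖ).ι ⋙ G)).Faithful := inferInstance
  have : G'.Full := inferInstanceAs ((ModuleCat.isFG Aᵐᵒᵖ).lift _ _).Full
  have : G'.Faithful := inferInstanceAs ((ModuleCat.isFG Aᵐᵒᵖ).lift _ _).Faithful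
  have : F'.Additive := ⟨by
    intro M N f g
    exact FGModuleCat.hom_ext (congrArg ModuleCat.Hom.hom (F.map_add (f := f.hom) (g := g.hom)))⟩
  have : Limits.PreservesFiniteLimits (forget₂ (FGModuleCat Aᵐᵒᵖ) (ModuleCat.{u} Aᵐᵒᵖ)) :=
    inferInstance
  -- Exactness is inherited: the inclusions into all modules preserve finite limits and colimits and
  -- also reflect them.
  have l1 : Limits.PreservesFiniteLimits F' := ⟨fun J _ _ => by
    have : Limits.PreservesLimitsOfShape J 
        (F' ⋙ forget₂ (FGModuleCat Bᵐᵒᵖ) (ModuleCat.{u} Bᵐᵒᵖ)) :=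
      inferInstanceAs (Limits.PreservesLimitsOfShape J
        (forget₂ (FGModuleCat Aᵐᵒᵖ) (ModuleCat.{u} Aᵐᵒᵖ) ⋙ F))
    exact Limits.preservesLimitsOfShape_of_reflects_of_preserves F'
      (forget₂ (FGModuleCat Bᵐᵒᵖ) (ModuleCat.{u} Bᵐᵒᵖ))⟩
  have l2 : Limits.PreservesFiniteColimits F' := ⟨fun J _ _ => by
    have : Limits.PreservesColimitsOfShape J 
        (F' ⋙ forget₂ (FGModuleCat Bᵐᵒᵖ) (ModuleCat.{u} Bᵐᵒᵖ)) :=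
      inferInstanceAs (Limits.PreservesColimitsOfShape J
        (forget₂ (FGModuleCat Aᵐᵒᵖ) (ModuleCat.{u} Aᵐᵒᵖ) ⋙ F))
    exact Limits.preservesColimitsOfShape_of_reflects_of_preserves F'
      (forget₂ (FGModuleCat Bᵐᵒᵖ) (ModuleCat.{u} Bᵐᵒᵖ))⟩
  exact ⟨inferInstance, l1, l2, Abelian.isLocalization_isoModSerre_kernel_of_leftAdjoint adj⟩

end FiniteDimensional

/-! ### Local confluence from the braid relations -/

section Confluence

variable {k N D : Type*} [Field k] [AddCommGroup N] [Module k N]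

/-- The diamond of type A_2, in terms of the three values (x, y, z) that s and t swap. If z < y < x,
both descents lead in three steps to the sorted triple, and the two expressions obtained are the two
sides of the braid relation. If y = z < x, then t (s d) is a fixed point of s, and the braid
relation carries the eigenvalue of A there to B at d. -/
theorem confluence_three (q : k) (X : D → N) (A B : N →ₗ[k] N) (s t : D → D) (x y z : D → ℤ)
    (μ : D → ℕ) (hst : ∀ d, t (s (t d)) = s (t (s d)))
    (xs : ∀ d, x (s d) = y d) (ys : ∀ d, y (s d) = x d) (zs : ∀ d, z (s d) = z d)
    (xt : ∀ d, x (t d) = x d) (yt : ∀ d, y (t d) = z d) (zt : ∀ d, z (t d) = y d)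
    (hAB : ∀ v, A (B (A v)) = B (A (B v)))
    (μs : ∀ d, y d < x d → μ (s d) < μ d) (μt : ∀ d, z d < y d → μ (t d) < μ d) (d : D)
    (hA : ∀ e, μ e < μ d → (y e < x e → X e = A (X (s e))) ∧ (x e = y e → A (X e) = q • X e))
    (hB : ∀ e, μ e < μ d → (z e < y e → X e = B (X (t e))) ∧ (y e = z e → B (X e) = q • X e))
    (hd : y d < x d) (hX : X d = A (X (s d))) :
    (z d < y d → X d = B (X (t d))) ∧ (y d = z d → B (X d) = q • X d) := by
  have m1 := μs d hd
  constructor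
  · intro h
    have e1 := (hB (s d) m1).1 (by rw [zs, ys]; omega)
    have m2 := μt (s d) (by rw [zs, ys]; omega)
    have e2 := (hA (t (s d)) (m2.trans m1)).1 (by rw [yt, zs, xt, xs]; omega)
    have n1 := μt d h
    have f1 := (hA (t d) n1).1 (by rw [yt, xt]; omega)
    have n2 := μs (t d) (by rw [yt, xt]; omega)
    have f2 := (hB (s (t d)) (n2.trans n1)).1 (by rw [ys, zs, xt, zt]; omega)
    rw [hX, e1, e2, f1, f2, hst, hAB]
  · intro h
    have e1 := (hB (s d) m1).1 (by rw [zs, ys]; omega)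
    have m2 := μt (s d) (by rw [zs, ys]; omega)
    have e2 := (hA (t (s d)) (m2.trans m1)).2 (by rw [yt, zs, xt, xs]; omega)
    rw [hX, e1, ← hAB, e2, map_smul, map_smul]

/-- The symmetry (x, y, z) ↦ (-z, -y, -x) exchanges s and t and reduces this to the preceding case.
-/
theorem confluence_three' (q : k) (X : D → N) (A B : N →ₗ[k] N) (s t : D → D) (x y z : D → ℤ)
    (μ : D → ℕ) (hst : ∀ d, t (s (t d)) = s (t (s d)))
    (xs : ∀ d, x (s d) = y d) (ys : ∀ d, y (s d) = x d) (zs : ∀ d, z (s d) = z d)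
    (xt : ∀ d, x (t d) = x d) (yt : ∀ d, y (t d) = z d) (zt : ∀ d, z (t d) = y d)
    (hAB : ∀ v, A (B (A v)) = B (A (B v)))
    (μs : ∀ d, y d < x d → μ (s d) < μ d) (μt : ∀ d, z d < y d → μ (t d) < μ d) (d : D)
    (hA : ∀ e, μ e < μ d → (y e < x e → X e = A (X (s e))) ∧ (x e = y e → A (X e) = q • X e))
    (hB : ∀ e, μ e < μ d → (z e < y e → X e = B (X (t e))) ∧ (y e = z e → B (X e) = q • X e))
    (hd : z d < y d) (hX : X d = B (X (t d))) :
    (y d < x d → X d = A (X (s d))) ∧ (x d = y d → A (X d) = q • X d) := by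
  have h := confluence_three q X B A t s (fun d => - z d) (fun d => - y d) (fun d => - x d) μ
    (fun d => (hst d).symm) (fun d => by rw [zt]) (fun d => by rw [yt]) (fun d => by rw [xt])
    (fun d => by rw [zs]) (fun d => by rw [ys]) (fun d => by rw [xs]) (fun v => (hAB v).symm)
    (fun d h => μt d (by omega)) (fun d h => μs d (by omega)) d
    (fun e he => ⟨fun h => (hB e he).1 (by omega), fun h => (hB e he).2 (by omega)⟩)
    (fun e he => ⟨fun h => (hA e he).1 (by omega), fun h => (hA e he).2 (by omega)⟩)
    (by omega) hX
  exact ⟨fun h' => h.1 (by omega), fun h' => h.2 (by omega)⟩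

/-- The diamond of type B_2, where s negates y and t swaps y and z. If z < y < 0, both ways lead in
four steps to (-y, -z). On the walls y = z < 0 and z < y = 0, three steps reach a tuple fixed by the
other generator, whose eigenvalue is moved back through the braid relation. -/
theorem confluence_four (q Q : k) (X : D → N) (A B : N →ₗ[k] N) (s t : D → D) (y z : D → ℤ)
    (μ : D → ℕ) (hst : ∀ d, t (s (t (s d))) = s (t (s (t d))))
    (ys : ∀ d, y (s d) = - y d) (zs : ∀ d, z (s d) = z d)
    (yt : ∀ d, y (t d) = z d) (zt : ∀ d, z (t d) = y d)
    (hAB : ∀ v, A (B (A (B v))) = B (A (B (A v))))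
    (μs : ∀ d, y d < 0 → μ (s d) < μ d) (μt : ∀ d, z d < y d → μ (t d) < μ d) (d : D)
    (hA : ∀ e, μ e < μ d → (y e < 0 → X e = A (X (s e))) ∧ (0 = y e → A (X e) = Q • X e))
    (hB : ∀ e, μ e < μ d → (z e < y e → X e = B (X (t e))) ∧ (y e = z e → B (X e) = q • X e)) :
    (y d < 0 → X d = A (X (s d)) →
      (z d < y d → X d = B (X (t d))) ∧ (y d = z d → B (X d) = q • X d)) ∧
    (z d < y d → X d = B (X (t d)) →
      (y d < 0 → X d = A (X (s d))) ∧ (0 = y d → A (X d) = Q • X d)) := by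
  -- With both descents present, each side unfolds to a product of four operators applied to the
  -- same vector.
  have key : y d < 0 → z d < y d → A (X (s d)) = B (X (t d)) := by
    intro hd h
    have m1 := μs d hd
    have e1 := (hB (s d) m1).1 (by simp only [ys, zs]; omega)
    have m2 := (μt (s d) (by simp only [ys, zs]; omega)).trans m1
    have e2 := (hA (t (s d)) m2).1 (by simp only [yt, zs]; omega)
    have m3 := (μs (t (s d)) (by simp only [yt, zs]; omega)).trans m2
    have e3 := (hB (s (t (s d))) m3).1 (by simp only [ys, zs, yt, zt]; omega)
    have n1 := μt d h
    have f1 := (hA (t d) n1).1 (by simp only [yt]; omega)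
    have n2 := (μs (t d) (by simp only [yt]; omega)).trans n1
    have f2 := (hB (s (t d)) n2).1 (by simp only [ys, yt, zs, zt]; omega)
    have n3 := (μt (s (t d)) (by simp only [ys, yt, zs, zt]; omega)).trans n2
    have f3 := (hA (t (s (t d))) n3).1 (by simp only [ys, yt, zs, zt]; omega)
    rw [e1, e2, e3, f1, f2, f3, hst, hAB]
  constructor
  · intro hd hX
    refine ⟨fun h => hX.trans (key hd h), fun h => ?_⟩
    have m1 := μs d hd
    have e1 := (hB (s d) m1).1 (by simp only [ys, zs]; omega)
    have m2 := (μt (s d) (by simp only [ys, zs]; omega)).trans m1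
    have e2 := (hA (t (s d)) m2).1 (by simp only [yt, zs]; omega)
    have m3 := (μs (t (s d)) (by simp only [yt, zs]; omega)).trans m2
    have e3 := (hB (s (t (s d))) m3).2 (by simp only [ys, zs, yt, zt]; omega)
    rw [hX, e1, e2, ← hAB, e3, map_smul, map_smul, map_smul]
  · intro hd hX
    refine ⟨fun h => hX.trans (key h hd).symm, fun h => ?_⟩
    have m1 := μt d hd
    have e1 := (hA (t d) m1).1 (by simp only [yt]; omega)
    have m2 := (μs (t d) (by simp only [yt]; omega)).trans m1
    have e2 := (hB (s (t d)) m2).1 (by simp only [ys, yt, zs, zt]; omega)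
    have m3 := (μt (s (t d)) (by simp only [ys, yt, zs, zt]; omega)).trans m2
    have e3 := (hA (t (s (t d))) m3).2 (by simp only [ys, yt, zs, zt]; omega)
    rw [hX, e1, e2, hAB, e3, map_smul, map_smul, map_smul]

end Confluence

/-! ### The Hecke relations on an arbitrary right module -/

section Relations

variable {k : Type u} [Field k] (q Q : k) {n : ℕ}

theorem Hecke.mk_eq_of_rel {x y : FreeAlgebra k (Fin n)} (h : HeckeRel q Q n x y) :
    Hecke.mk q Q n x = Hecke.mk q Q n y :=
  RingQuot.mkAlgHom_rel k h

theorem Hecke.mk_surjective : Function.Surjective (Hecke.mk q Q n) :=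
  RingQuot.mkAlgHom_surjective k _

theorem Hecke.T_quadratic (t : Fin n) :
    Hecke.T q Q t * Hecke.T q Q t =
      heckeParam q Q t.1 • 1 + (heckeParam q Q t.1 - 1) • Hecke.T q Q t := by
  have h := Hecke.mk_eq_of_rel q Q (HeckeRel.quadratic (q := q) (Q := Q) t)
  simp only [map_mul, map_sub, map_add, map_one, map_zero, AlgHom.commutes] at h
  change (Hecke.T q Q t - algebraMap k _ _) * (Hecke.T q Q t + 1) = 0 at h
  rw [sub_mul, mul_add, mul_add, mul_one, mul_one, Algebra.algebraMap_eq_smul_one,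
    smul_mul_assoc, one_mul] at h
  rw [sub_smul, one_smul, ← sub_eq_zero, ← h]
  abel

theorem Hecke.T_braid_four (h : 1 < n) :
    Hecke.T q Q ⟨0, by omega⟩ * Hecke.T q Q ⟨1, h⟩ * Hecke.T q Q ⟨0, by omega⟩ *
        Hecke.T q Q ⟨1, h⟩ =
      Hecke.T q Q ⟨1, h⟩ * Hecke.T q Q ⟨0, by omega⟩ * Hecke.T q Q ⟨1, h⟩ *
        Hecke.T q Q ⟨0, by omega⟩ := by
  simpa only [map_mul] using! Hecke.mk_eq_of_rel q Q (HeckeRel.braid_four (q := q) (Q := Q) h)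

theorem Hecke.T_braid_three (i : ℕ) (hi : 0 < i) (h : i + 1 < n) :
    Hecke.T q Q ⟨i, by omega⟩ * Hecke.T q Q ⟨i + 1, h⟩ * Hecke.T q Q ⟨i, by omega⟩ =
      Hecke.T q Q ⟨i + 1, h⟩ * Hecke.T q Q ⟨i, by omega⟩ * Hecke.T q Q ⟨i + 1, h⟩ := by
  simpa only [map_mul] using!
    Hecke.mk_eq_of_rel q Q (HeckeRel.braid_three (q := q) (Q := Q) i hi h)

theorem Hecke.T_comm (i j : Fin n) (h : i.1 + 1 < j.1) :
    Hecke.T q Q i * Hecke.T q Q j = Hecke.T q Q j * Hecke.T q Q i := by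
  simpa only [map_mul] using! Hecke.mk_eq_of_rel q Q (HeckeRel.comm (q := q) (Q := Q) i j h)

theorem Hecke.induction {P : Hecke q Q n → Prop} (halg : ∀ c, P (algebraMap k _ c))
    (hT : ∀ t, P (Hecke.T q Q t)) (hadd : ∀ x y, P x → P y → P (x + y))
    (hmul : ∀ x y, P x → P y → P (x * y)) (x : Hecke q Q n) : P x := by
  obtain ⟨x, rfl⟩ := Hecke.mk_surjective q Q x
  induction x using FreeAlgebra.induction with
  | grade0 c => rw [AlgHom.commutes]; exact halg c
  | grade1 t => exact hT t
  | mul x y hx hy => rw [map_mul]; exact hmul _ _ hx hy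
  | add x y hx hy => rw [map_add]; exact hadd _ _ hx hy

variable {N N' : Type*} [AddCommGroup N] [Module k N] [Module (Hecke q Q n)ᵐᵒᵖ N]
  [IsScalarTower k (Hecke q Q n)ᵐᵒᵖ N] [AddCommGroup N'] [Module k N']
  [Module (Hecke q Q n)ᵐᵒᵖ N'] [IsScalarTower k (Hecke q Q n)ᵐᵒᵖ N']

/-- A linear map commuting with the generators is a homomorphism of Hecke modules. -/
noncomputable def heckeLinear (f : N →ₗ[k] N')
    (hf : ∀ (t : Fin n) x, f (op (Hecke.T q Q t) • x) = op (Hecke.T q Q t) • f x) :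
    N →ₗ[(Hecke q Q n)ᵐᵒᵖ] N' :=
  { f with
    map_smul' := fun h x => by
      change f (h • x) = h • f x
      induction h using MulOpposite.rec' with | _ h
      induction h using Hecke.induction generalizing x with
      | halg c =>
        have h1 : op (algebraMap k (Hecke q Q n) c) = c • (1 : (Hecke q Q n)ᵐᵒᵖ) :=
          Algebra.algebraMap_eq_smul_one (A := (Hecke q Q n)ᵐᵒᵖ) c
        rw [h1, smul_assoc, smul_assoc, one_smul, one_smul, map_smul]
      | hT t => exact hf t x
      | hadd a b ha hb => rw [MulOpposite.op_add, add_smul, add_smul, map_add, ha, hb]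
      | hmul a b ha hb => rw [op_mul, mul_smul, mul_smul, hb, ha] }

/-- The action of a generator on a Hecke module, as a linear map. -/
noncomputable def genAction (t : Fin n) : N →ₗ[k] N where
  toFun x := op (Hecke.T q Q t) • x
  map_add' := smul_add _
  map_smul' c x := by
    have h1 : op (Hecke.T q Q t) * (c • (1 : (Hecke q Q n)ᵐᵒᵖ)) = c • op (Hecke.T q Q t) := by
      rw [mul_smul_comm, mul_one]
    have h2 : c • x = (c • (1 : (Hecke q Q n)ᵐᵒᵖ)) • x := by rw [smul_assoc, one_smul]
    rw [RingHom.id_apply, h2, smul_smul, h1, smul_assoc]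

theorem genAction_apply (t : Fin n) (x : N) : genAction q Q t x = op (Hecke.T q Q t) • x := rfl

theorem genAction_quadratic (t : Fin n) (x : N) : genAction q Q t (genAction q Q t x) =
    heckeParam q Q t.1 • x + (heckeParam q Q t.1 - 1) • genAction q Q t x := by
  simp only [genAction_apply]
  rw [smul_smul, ← op_mul, Hecke.T_quadratic, MulOpposite.op_add, add_smul, op_smul, op_smul,
    smul_assoc, smul_assoc, op_one, one_smul]

theorem genAction_braid_four (h : 1 < n) (x : N) :
    genAction (n := n) q Q ⟨0, by omega⟩ (genAction (n := n) q Q ⟨1, h⟩ (genAction (n := n) q Q ⟨0, by omega⟩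
      (genAction (n := n) q Q ⟨1, h⟩ x))) =
    genAction (n := n) q Q ⟨1, h⟩ (genAction (n := n) q Q ⟨0, by omega⟩ (genAction (n := n) q Q ⟨1, h⟩
      (genAction (n := n) q Q ⟨0, by omega⟩ x))) := by
  simp only [genAction_apply, smul_smul, ← op_mul]
  have h := Hecke.T_braid_four q Q h
  simp only [mul_assoc] at h ⊢
  rw [h]

theorem genAction_braid_three (i : ℕ) (hi : 0 < i) (h : i + 1 < n) (x : N) :
    genAction (n := n) q Q ⟨i, by omega⟩
        (genAction (n := n) q Q ⟨i + 1, h⟩ (genAction (n := n) q Q ⟨i, by omega⟩ x)) =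
      genAction (n := n) q Q ⟨i + 1, h⟩
        (genAction (n := n) q Q ⟨i, by omega⟩ (genAction (n := n) q Q ⟨i + 1, h⟩ x)) := by
  simp only [genAction_apply, smul_smul, ← op_mul]
  have h := Hecke.T_braid_three q Q i hi h
  simp only [mul_assoc] at h ⊢
  rw [h]

theorem genAction_comm (i j : Fin n) (h : i.1 + 1 < j.1) (x : N) :
    genAction q Q i (genAction q Q j x) = genAction q Q j (genAction q Q i x) := by
  simp only [genAction_apply, smul_smul, ← op_mul]
  rw [Hecke.T_comm q Q i j h]

end Relations

/-! ### Signed place permutations of tuples and descents -/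

section Combinatorics

variable {n m : ℕ}

theorem act_of_lt (d : Fin n → IndexSet m) (i j : Fin n) (h : i.1 < j.1) : act d i j = d j := by
  by_cases hi : i.1 = 0
  · rw [act_zero_apply _ _ _ hi, if_neg (by rw [Fin.ext_iff]; omega)]
  · rw [act_pos_apply _ _ _ hi, if_neg (by rw [Fin.ext_iff]; omega), if_neg (by omega)]

theorem act_of_gt (d : Fin n → IndexSet m) (i j : Fin n) (h : i.1 + 1 < j.1) :
    act d j i = d i := by
  rw [act_pos_apply _ _ _ (by omega), if_neg (by rw [Fin.ext_iff]; omega), if_neg (by omega)]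

theorem leftValue_zero (d : Fin n → IndexSet m) (t : Fin n) (ht : t.1 = 0) : leftValue d t = 0 :=
  if_pos ht

theorem leftValue_succ (d : Fin n → IndexSet m) (i : ℕ) (h : i + 1 < n) :
    leftValue d ⟨i + 1, h⟩ = (d ⟨i, by omega⟩).1 := by simp [leftValue]

theorem leftValue_pos (d : Fin n → IndexSet m) (t : Fin n) (ht : t.1 ≠ 0) :
    leftValue d t = (d ⟨t.1 - 1, by omega⟩).1 := if_neg ht

theorem leftValue_act_of_gt (d : Fin n → IndexSet m) (i j : Fin n) (h : i.1 + 1 < j.1) :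
    leftValue (act d j) i = leftValue d i := by
  by_cases hi : i.1 = 0
  · simp only [leftValue, hi, if_true]
  · simp only [leftValue, hi, if_false]
    rw [act_of_gt]
    simp only
    omega

theorem leftValue_act_of_lt (d : Fin n → IndexSet m) (i j : Fin n) (h : i.1 + 1 < j.1) :
    leftValue (act d i) j = leftValue d j := by
  have hj : j.1 ≠ 0 := by omega
  simp only [leftValue, hj, if_false]
  rw [act_of_lt]
  simp only
  omega

theorem act_comm (d : Fin n → IndexSet m) (i j : Fin n) (h : i.1 + 1 < j.1) :
    act (act d i) j = act (act d j) i := by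
  have hj : j.1 ≠ 0 := by omega
  funext l
  by_cases hi : i.1 = 0
  · simp only [act_zero_apply _ _ _ hi, act_pos_apply _ _ _ hj, Fin.ext_iff]
    split_ifs <;> first | omega | rfl
  · simp only [act_pos_apply _ _ _ hi, act_pos_apply _ _ _ hj, Fin.ext_iff]
    split_ifs <;> first | omega | rfl

theorem act_eq_comp_swap (d : Fin n → IndexSet m) (t : Fin n) (ht : t.1 ≠ 0) :
    act d t = d ∘ Equiv.swap ⟨t.1 - 1, by omega⟩ t := if_neg ht

theorem act_braid_three (d : Fin n → IndexSet m) (i : ℕ) (hi : 0 < i) (h : i + 1 < n) :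
    act (act (act d ⟨i + 1, h⟩) ⟨i, by omega⟩) ⟨i + 1, h⟩ =
      act (act (act d ⟨i, by omega⟩) ⟨i + 1, h⟩) ⟨i, by omega⟩ := by
  have hi0 : i ≠ 0 := by omega
  have s1 : ∀ d : Fin n → IndexSet m, act d ⟨i, by omega⟩ =
      d ∘ Equiv.swap ⟨i - 1, by omega⟩ ⟨i, by omega⟩ := fun d => if_neg hi0
  have s2 : ∀ d : Fin n → IndexSet m, act d ⟨i + 1, h⟩ =
      d ∘ Equiv.swap ⟨i, by omega⟩ ⟨i + 1, h⟩ := fun d => if_neg (Nat.succ_ne_zero i)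
  simp only [s1, s2, Function.comp_assoc, ← Equiv.Perm.coe_mul]
  rw [swap_braid _ _ _ (by simp [Fin.ext_iff]; omega) (by simp [Fin.ext_iff]) (by simp)]

theorem act_braid_four (d : Fin n → IndexSet m) (h : 1 < n) :
    act (act (act (act d ⟨0, by omega⟩) ⟨1, h⟩) ⟨0, by omega⟩) ⟨1, h⟩ =
      act (act (act (act d ⟨1, h⟩) ⟨0, by omega⟩) ⟨1, h⟩) ⟨0, by omega⟩ := by
  funext j
  have g1 := act_zero_apply (m := m) (n := n) (t := ⟨0, by omega⟩) (ht := rfl)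
  have g2 := act_pos_apply (m := m) (n := n) (t := ⟨1, h⟩) (ht := Nat.one_ne_zero)
  simp only [g1, g2, Fin.ext_iff]
  split_ifs <;> first | omega | contradiction | rfl

theorem act_self_sub (d : Fin n → IndexSet m) (t : Fin n) :
    leftValue (act d t) t - (act d t t).1 = (d t).1 - leftValue d t := by
  by_cases ht : t.1 = 0
  · simp [leftValue, act_zero_apply _ _ _ ht, ht, neg_val]
  · have h4 : t.1 - 1 ≠ t.1 := by omega
    simp [leftValue, act_pos_apply _ _ _ ht, ht, Fin.ext_iff, h4]

/-- A weight that decreases along descents. -/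
def height (d : Fin n → IndexSet m) : ℕ :=
  (∑ i : Fin n, ((i.1 : ℤ) + 1) * (((m / 2 : ℕ) : ℤ) - (d i).1)).toNat

/-- Entry i contributes its distance below r = m / 2 with factor i + 1. Making a negative first
entry positive, or moving the larger of two neighbours to the right, lowers the total. -/
theorem height_act_lt (d : Fin n → IndexSet m) (t : Fin n) (h : (d t).1 < leftValue d t) :
    height (act d t) < height d := by
  -- Entries are at most r, so the sum is nonnegative and `toNat` loses nothing.
  have hnn : ∀ d : Fin n → IndexSet m,
      0 ≤ ∑ i : Fin n, ((i.1 : ℤ) + 1) * (((m / 2 : ℕ) : ℤ) - (d i).1) := fun d =>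
    Finset.sum_nonneg fun i _ => mul_nonneg (by positivity) (by
      have := (abs_le.1 (d i).2.1).2
      omega)
  suffices H : ∑ i : Fin n, ((i.1 : ℤ) + 1) * (((m / 2 : ℕ) : ℤ) - (act d t i).1) <
      ∑ i : Fin n, ((i.1 : ℤ) + 1) * (((m / 2 : ℕ) : ℤ) - (d i).1) by
    have := hnn (act d t)
    unfold height
    omega
  rw [← sub_pos, ← Finset.sum_sub_distrib]
  by_cases ht : t.1 = 0
  · rw [leftValue_zero _ _ ht] at h
    rw [Finset.sum_eq_single t]
    · rw [act_zero_apply _ _ _ ht, if_pos rfl, neg_val, ht]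
      push_cast
      linarith
    · intro i _ hi
      rw [act_zero_apply _ _ _ ht, if_neg hi, sub_self]
    · simp
  · rw [leftValue_pos _ _ ht] at h
    rw [Fintype.sum_eq_add (⟨t.1 - 1, by omega⟩ : Fin n) t]
    · rw [act_pos_apply _ _ _ ht, act_pos_apply _ _ _ ht, if_pos rfl, if_neg, if_pos rfl]
      · simp only
        rw [Nat.cast_sub (by omega)]
        push_cast
        linarith
      · rw [Fin.ext_iff]; simp only; omega
    · rw [Ne, Fin.ext_iff]; simp only; omega
    · rintro i ⟨h1, h2⟩
      rw [Ne, Fin.ext_iff] at h1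
      rw [act_pos_apply _ _ _ ht, if_neg h2, if_neg h1, sub_self]

/-- A tuple `0 ≤ d_1 ≤ ⋯ ≤ d_n`. -/
def IsDominant (d : Fin n → IndexSet m) : Prop := ∀ t, leftValue d t ≤ (d t).1

theorem descent_induction {P : (Fin n → IndexSet m) → Prop} (hdom : ∀ d, IsDominant d → P d)
    (hstep : ∀ d t, (d t).1 < leftValue d t → P (act d t) → P d) (d : Fin n → IndexSet m) :
    P d := by
  induction hN : height d using Nat.strong_induction_on generalizing d with | _ N ih
  by_cases h : IsDominant d
  · exact hdom d h
  · simp only [IsDominant, not_forall, not_le] at h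
    obtain ⟨t, ht⟩ := h
    exact hstep d t ht (ih _ (hN ▸ height_act_lt d t ht) _ rfl)

end Combinatorics

/-! ### The presentation of tensor space by dominant vectors -/

section UniversalProperty

variable {k : Type u} [Field k] (q Q : k) {n m : ℕ}
  {N : Type*} [AddCommGroup N] [Module k N] [Module (Hecke q Q n)ᵐᵒᵖ N]
  [IsScalarTower k (Hecke q Q n)ᵐᵒᵖ N]

open Classical in
/-- The image of `v_d` under the homomorphism with given values on dominant basis vectors. -/
noncomputable def extendVec (g : (Fin n → IndexSet m) → N) (d : Fin n → IndexSet m) : N :=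
  if h : ∃ t, (d t).1 < leftValue d t then
    genAction q Q h.choose (extendVec g (act d h.choose))
  else g d
termination_by height d
decreasing_by exact height_act_lt _ _ h.choose_spec

theorem extendVec_dominant (g : (Fin n → IndexSet m) → N) (d : Fin n → IndexSet m)
    (hd : IsDominant d) : extendVec q Q g d = g d := by
  rw [extendVec, dif_neg]
  push Not
  exact hd

theorem extendVec_exists (g : (Fin n → IndexSet m) → N) (d : Fin n → IndexSet m)
    (hd : ¬ IsDominant d) : ∃ t, (d t).1 < leftValue d t ∧
      extendVec q Q g d = genAction q Q t (extendVec q Q g (act d t)) := by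
  have h : ∃ t, (d t).1 < leftValue d t := by
    simpa only [IsDominant, not_forall, not_le] using hd
  refine ⟨h.choose, h.choose_spec, ?_⟩
  rw [extendVec, dif_pos h]

/-- The behaviour of `v_d` under `T_t` when `t` is a descent or a fixed position of `d`. -/
def GenCompatible (X : (Fin n → IndexSet m) → N) (d : Fin n → IndexSet m) (t : Fin n) : Prop :=
  ((d t).1 < leftValue d t → X d = genAction q Q t (X (act d t))) ∧
    (leftValue d t = (d t).1 → genAction q Q t (X d) = heckeParam q Q t.1 • X d)

/-- One descent s at which X is computed correctly forces the right behaviour at every t, given it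
at all lower heights. The pair s, t is of type A_2, B_2 or A_1 × A_1, handled by `three`, `four` and
`far`. -/
theorem genCompatible_of_descent (X : (Fin n → IndexSet m) → N) (d : Fin n → IndexSet m)
    (ih : ∀ e, height e < height d → ∀ t, GenCompatible q Q X e t) (s t : Fin n)
    (hs : (d s).1 < leftValue d s) (hX : X d = genAction q Q s (X (act d s))) :
    GenCompatible q Q X d t := by
  have three : ∀ (i : ℕ) (hi : 0 < i) (h : i + 1 < n),
      ((d ⟨i, by omega⟩).1 < leftValue d ⟨i, by omega⟩ →
        X d = genAction (n := n) q Q ⟨i, by omega⟩ (X (act d ⟨i, by omega⟩)) →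
        GenCompatible q Q X d ⟨i + 1, h⟩) ∧ ((d ⟨i + 1, h⟩).1 < leftValue d ⟨i + 1, h⟩ →
        X d = genAction (n := n) q Q ⟨i + 1, h⟩ (X (act d ⟨i + 1, h⟩)) →
        GenCompatible q Q X d ⟨i, by omega⟩) := by
    intro i hi h
    have hi0 : i ≠ 0 := by omega
    have hp : heckeParam q Q i = q := if_neg (by omega)
    have hp' : heckeParam q Q (i + 1) = q := if_neg (by omega)
    have hl := fun d : Fin n → IndexSet m => leftValue_succ d i h
    have hl' := fun d : Fin n → IndexSet m => leftValue_pos d ⟨i, by omega⟩ hi0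
    have g1 := act_pos_apply (m := m) (n := n) (t := ⟨i, by omega⟩) (ht := hi0)
    have g2 := act_pos_apply (m := m) (n := n) (t := ⟨i + 1, h⟩) (ht := Nat.succ_ne_zero i)
    have hA := fun e he => ih e he ⟨i, by omega⟩
    have hB := fun e he => ih e he ⟨i + 1, h⟩
    simp only [GenCompatible, hp, hp', hl] at hA hB ⊢
    have μs := fun d : Fin n → IndexSet m => height_act_lt d ⟨i, by omega⟩
    have μt := fun d : Fin n → IndexSet m => height_act_lt d ⟨i + 1, h⟩
    simp only [hl] at μt
    have xs : ∀ d : Fin n → IndexSet m, leftValue (act d ⟨i, by omega⟩) ⟨i, by omega⟩ =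
        (d ⟨i, by omega⟩).1 := by
      intro d; simp only [g1, hl', Fin.ext_iff]; split_ifs <;> omega
    have ys : ∀ d : Fin n → IndexSet m, (act d ⟨i, by omega⟩ ⟨i, by omega⟩).1 =
        leftValue d ⟨i, by omega⟩ := by
      intro d; simp only [g1, hl']; split_ifs <;> omega
    have zs : ∀ d : Fin n → IndexSet m, (act d ⟨i, by omega⟩ ⟨i + 1, h⟩).1 =
        (d ⟨i + 1, h⟩).1 := by
      intro d; simp only [g1, Fin.ext_iff]; split_ifs <;> omega
    have xt : ∀ d : Fin n → IndexSet m, leftValue (act d ⟨i + 1, h⟩) ⟨i, by omega⟩ =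
        leftValue d ⟨i, by omega⟩ := by
      intro d; simp only [g2, hl', Fin.ext_iff]; split_ifs <;> omega
    have yt : ∀ d : Fin n → IndexSet m, (act d ⟨i + 1, h⟩ ⟨i, by omega⟩).1 =
        (d ⟨i + 1, h⟩).1 := by
      intro d; simp only [g2, Fin.ext_iff]; split_ifs <;> omega
    have zt : ∀ d : Fin n → IndexSet m, (act d ⟨i + 1, h⟩ ⟨i + 1, h⟩).1 =
        (d ⟨i, by omega⟩).1 := by
      intro d; simp only [g2]; split_ifs <;> first | omega | rfl
    exact ⟨confluence_three q X (genAction (n := n) q Q ⟨i, by omega⟩) (genAction (n := n) q Q ⟨i + 1, h⟩)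
        (fun d => act d ⟨i, by omega⟩) (fun d => act d ⟨i + 1, h⟩)
        (fun d => leftValue d ⟨i, by omega⟩) (fun d => (d ⟨i, by omega⟩).1)
        (fun d => (d ⟨i + 1, h⟩).1) height (fun d => act_braid_three d i hi h)
        xs ys zs xt yt zt (genAction_braid_three q Q i hi h) μs μt d hA hB,
      confluence_three' q X (genAction (n := n) q Q ⟨i, by omega⟩) (genAction (n := n) q Q ⟨i + 1, h⟩)
        (fun d => act d ⟨i, by omega⟩) (fun d => act d ⟨i + 1, h⟩)
        (fun d => leftValue d ⟨i, by omega⟩) (fun d => (d ⟨i, by omega⟩).1)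
        (fun d => (d ⟨i + 1, h⟩).1) height (fun d => act_braid_three d i hi h)
        xs ys zs xt yt zt (genAction_braid_three q Q i hi h) μs μt d hA hB⟩
  have four : ∀ (h : 1 < n),
      ((d ⟨0, by omega⟩).1 < leftValue d ⟨0, by omega⟩ →
        X d = genAction (n := n) q Q ⟨0, by omega⟩ (X (act d ⟨0, by omega⟩)) →
        GenCompatible q Q X d ⟨1, h⟩) ∧ ((d ⟨1, h⟩).1 < leftValue d ⟨1, h⟩ →
        X d = genAction (n := n) q Q ⟨1, h⟩ (X (act d ⟨1, h⟩)) →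
        GenCompatible q Q X d ⟨0, by omega⟩) := by
    intro h
    have hp : heckeParam q Q 0 = Q := if_pos rfl
    have hp' : heckeParam q Q 1 = q := if_neg Nat.one_ne_zero
    have hl := fun d : Fin n → IndexSet m => leftValue_succ d 0 h
    have hl' := fun d : Fin n → IndexSet m => leftValue_zero d ⟨0, by omega⟩ rfl
    have g1 := act_zero_apply (m := m) (n := n) (t := ⟨0, by omega⟩) (ht := rfl)
    have g2 := act_pos_apply (m := m) (n := n) (t := ⟨1, h⟩) (ht := Nat.one_ne_zero)
    have hA := fun e he => ih e he ⟨0, by omega⟩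
    have hB := fun e he => ih e he ⟨1, h⟩
    simp only [zero_add] at hl
    simp only [GenCompatible, hp, hp', hl, hl'] at hA hB ⊢
    have μs := fun d : Fin n → IndexSet m => height_act_lt d ⟨0, by omega⟩
    have μt := fun d : Fin n → IndexSet m => height_act_lt d ⟨1, h⟩
    simp only [hl] at μt
    simp only [hl'] at μs
    refine confluence_four q Q X (genAction (n := n) q Q ⟨0, by omega⟩) (genAction (n := n) q Q ⟨1, h⟩)
        (fun d => act d ⟨0, by omega⟩) (fun d => act d ⟨1, h⟩)
        (fun d => (d ⟨0, by omega⟩).1)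
        (fun d => (d ⟨1, h⟩).1) height (fun d => act_braid_four d h)
        ?_ ?_ ?_ ?_ (genAction_braid_four q Q h) μs μt d hA hB
    all_goals
      intro d
      simp only [g1, g2, Fin.ext_iff]
      rfl
  have far : (∀ x : N, genAction q Q s (genAction q Q t x) = genAction q Q t (genAction q Q s x)) →
      act (act d s) t = act (act d t) s → 
      (leftValue (act d s) t = leftValue d t) → (act d s t = d t) →
      (leftValue (act d t) s = leftValue d s) → (act d t s = d s) →
      GenCompatible q Q X d t := by
    intro hc hst h1 h2 h3 h4
    have c1 := ih _ (height_act_lt d s hs) t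
    refine ⟨fun h => ?_, fun h => ?_⟩
    · have c2 := (ih _ (height_act_lt d t h) s).1 (by rw [h3, h4]; exact hs)
      rw [hX, c1.1 (by rw [h1, h2]; exact h), c2, hc, hst]
    · rw [hX, ← hc, c1.2 (by rw [h1, h2]; exact h), map_smul]
  obtain ⟨s, hsn⟩ := s
  obtain ⟨t, htn⟩ := t
  rcases lt_trichotomy s t with hlt | rfl | hlt
  · by_cases hadj : t = s + 1
    · subst hadj
      by_cases h0 : s = 0
      · subst h0
        exact (four htn).1 hs hX
      · exact (three s (by omega) htn).1 hs hX
    · have hlt : s + 1 < t := by omega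
      exact far (genAction_comm q Q _ _ hlt) (act_comm _ _ _ hlt)
        (leftValue_act_of_lt _ _ _ hlt) (act_of_lt _ _ _ (by simp only; omega))
        (leftValue_act_of_gt _ _ _ hlt) (act_of_gt _ _ _ hlt)
  · exact ⟨fun _ => hX, fun h => absurd h hs.ne'⟩
  · by_cases hadj : s = t + 1
    · subst hadj
      by_cases h0 : t = 0
      · subst h0
        exact (four hsn).2 hs hX
      · exact (three t (by omega) hsn).2 hs hX
    · have hlt : t + 1 < s := by omega
      exact far (fun x => (genAction_comm q Q _ _ hlt x).symm) (act_comm _ _ _ hlt).symm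
        (leftValue_act_of_gt _ _ _ hlt) (act_of_gt _ _ _ hlt)
        (leftValue_act_of_lt _ _ _ hlt) (act_of_lt _ _ _ (by simp only; omega))

/-- The diamond argument: by induction on height, the descent chosen in `extendVec` is immaterial.
At dominant tuples no rewriting is possible, and only there do the relations have to be assumed. -/
theorem extendVec_genCompatible (g : (Fin n → IndexSet m) → N)
    (hg : ∀ d, IsDominant d → ∀ t, leftValue d t = (d t).1 →
      genAction q Q t (g d) = heckeParam q Q t.1 • g d) (d : Fin n → IndexSet m) (t : Fin n) :
    GenCompatible q Q (extendVec q Q g) d t := by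
  induction hN : height d using Nat.strong_induction_on generalizing d t with | _ N ih
  by_cases hd : IsDominant d
  · refine ⟨fun h => absurd h (hd t).not_gt, fun h => ?_⟩
    rw [extendVec_dominant _ _ _ _ hd, hg d hd t h]
  · obtain ⟨s, hs, hX⟩ := extendVec_exists q Q g d hd
    exact genCompatible_of_descent q Q _ d (fun e he t => ih _ (hN ▸ he) e t rfl) s t hs hX

/-- The homomorphism from tensor space with given values on dominant basis vectors. -/
noncomputable def tensorLift (g : (Fin n → IndexSet m) → N)
    (hg : ∀ d, IsDominant d → ∀ t, leftValue d t = (d t).1 →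
      genAction q Q t (g d) = heckeParam q Q t.1 • g d) :
    TensorSpace q Q n m →ₗ[(Hecke q Q n)ᵐᵒᵖ] N :=
  heckeLinear q Q ((tensorBasis q Q n m).constr k (extendVec q Q g)) (by
    intro t x
    rw [tensorSpace_smul_T, ← genAction_apply, ← LinearMap.comp_apply, ← LinearMap.comp_apply]
    congr 1
    refine (tensorBasis q Q n m).ext fun d => ?_
    have H := extendVec_genCompatible q Q g hg d t
    simp only [LinearMap.comp_apply, Module.Basis.constr_basis]
    have hs := act_self_sub d t
    rcases lt_trichotomy (leftValue d t) (d t).1 with h | h | h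
    · rw [heckeOp_lt _ _ _ _ h, Module.Basis.constr_basis]
      -- An ascent of d is a descent of `act d t`, where compatibility is known.
      have H' := (extendVec_genCompatible q Q g hg (act d t) t).1 (by omega)
      rw [H', act_act]
    · rw [heckeOp_eq _ _ _ _ h, map_smul, Module.Basis.constr_basis, H.2 h, act_of_eq d t h]
    · rw [heckeOp_gt _ _ _ _ h, map_add, map_smul, map_smul, Module.Basis.constr_basis,
        Module.Basis.constr_basis, H.1 h, genAction_quadratic])

theorem tensorLift_dominant (g : (Fin n → IndexSet m) → N)
    (hg : ∀ d, IsDominant d → ∀ t, leftValue d t = (d t).1 →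
      genAction q Q t (g d) = heckeParam q Q t.1 • g d) (d : Fin n → IndexSet m)
    (hd : IsDominant d) : tensorLift q Q g hg (tensorBasis q Q n m d) = g d :=
  ((tensorBasis q Q n m).constr_basis k _ _).trans (extendVec_dominant q Q g d hd)

theorem hecke_smul_smul (c : k) (x : N) : c • x = op (algebraMap k (Hecke q Q n) c) • x := by
  have h1 : op (algebraMap k (Hecke q Q n) c) = c • (1 : (Hecke q Q n)ᵐᵒᵖ) :=
    Algebra.algebraMap_eq_smul_one (A := (Hecke q Q n)ᵐᵒᵖ) c
  rw [h1, smul_assoc, one_smul]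

theorem heckeHom_smul {N' : Type*} [AddCommGroup N'] [Module k N'] [Module (Hecke q Q n)ᵐᵒᵖ N']
    [IsScalarTower k (Hecke q Q n)ᵐᵒᵖ N'] (f : N →ₗ[(Hecke q Q n)ᵐᵒᵖ] N') (c : k) (x : N) :
    f (c • x) = c • f x := by
  rw [hecke_smul_smul q Q (n := n), map_smul, ← hecke_smul_smul]

theorem tensorBasis_act_of_descent (d : Fin n → IndexSet m) (t : Fin n)
    (h : (d t).1 < leftValue d t) :
    tensorBasis q Q n m d = op (Hecke.T q Q t) • tensorBasis q Q n m (act d t) := by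
  have hs := act_self_sub d t
  rw [tensorSpace_smul_T, heckeOp_lt _ _ _ _ (by omega), act_act]

/-- Removing descents shows that the dominant basis vectors generate tensor space. -/
theorem tensorHom_ext {f g : TensorSpace q Q n m →ₗ[(Hecke q Q n)ᵐᵒᵖ] N}
    (h : ∀ d, IsDominant d → f (tensorBasis q Q n m d) = g (tensorBasis q Q n m d)) : f = g := by
  have H : ∀ d, f (tensorBasis q Q n m d) = g (tensorBasis q Q n m d) := by
    intro d
    induction d using descent_induction with
    | hdom d hd => exact h d hd
    | hstep d t ht ih => rw [tensorBasis_act_of_descent q Q d t ht, map_smul, map_smul, ih]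
  let toLin (f : TensorSpace q Q n m →ₗ[(Hecke q Q n)ᵐᵒᵖ] N) : TensorSpace q Q n m →ₗ[k] N :=
    { toFun := f, map_add' := f.map_add, map_smul' := heckeHom_smul q Q f }
  refine LinearMap.ext fun x => ?_
  exact congrArg (fun l => l x) ((tensorBasis q Q n m).ext (f₁ := toLin f) (f₂ := toLin g) H)

end UniversalProperty

noncomputable instance (m : ℕ) : Fintype (IndexSet m) := Fintype.ofFinite _

instance (m : ℕ) : DecidableEq (IndexSet m) := inferInstanceAs (DecidableEq (Subtype _))

/-! ### Dominant tuples as weakly increasing nonnegative ones -/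

section Dominant

variable {n m : ℕ}

theorem IsDominant.mono {d : Fin n → IndexSet m} (hd : IsDominant d) {i j : Fin n} (h : i ≤ j) :
    (d i).1 ≤ (d j).1 := by
  obtain ⟨j, hj⟩ := j
  obtain ⟨i, hi⟩ := i
  have h : i ≤ j := h
  induction j, h using Nat.le_induction with
  | base => exact le_rfl
  | succ j hij ih => 
    refine le_trans (ih (by omega) (by assumption)) ?_
    rw [← leftValue_succ d j hj]
    exact hd _

theorem IsDominant.nonneg {d : Fin n → IndexSet m} (hd : IsDominant d) (i : Fin n) :
    0 ≤ (d i).1 := by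
  have h0 : 0 < n := i.pos
  refine le_trans ?_ (hd.mono (i := ⟨0, h0⟩) (Nat.zero_le _))
  have := hd ⟨0, h0⟩
  rwa [leftValue_zero _ _ rfl] at this

theorem isDominant_of_mono {d : Fin n → IndexSet m} (h0 : ∀ i, 0 ≤ (d i).1)
    (h : ∀ i j, i ≤ j → (d i).1 ≤ (d j).1) : IsDominant d := by
  intro t
  by_cases ht : t.1 = 0
  · rw [leftValue_zero _ _ ht]; exact h0 t
  · rw [leftValue_pos _ _ ht]
    exact h _ _ (by rw [Fin.le_def]; simp only; omega)

end Dominant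

/-! ### Stretching maps into the tensor space with m = 2n -/

section Stretch

variable {n m : ℕ}

theorem IndexSet.natAbs_bounds (j : IndexSet (2 * n)) : 0 < j.1.natAbs ∧ j.1.natAbs ≤ n := by
  have h1 := abs_le.1 j.2.1
  have h2 := j.2.2 (even_two_mul n)
  omega

theorem IndexSet.neg_neg (j : IndexSet m) : - -j = j := Subtype.ext (_root_.neg_neg j.1)

/-- The tuple `(1, 2, …, n)`. -/
def regularTuple (n : ℕ) (i : Fin n) : IndexSet (2 * n) :=
  ⟨i.1 + 1, by rw [abs_le]; omega, fun _ => by omega⟩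

/-- The odd extension to `{±1, …, ±n}` of `i ↦ δ_i`. -/
def stretch (δ : Fin n → IndexSet m) (j : IndexSet (2 * n)) : IndexSet m :=
  if 0 < j.1 then δ ⟨j.1.natAbs - 1, by have := j.natAbs_bounds; omega⟩
  else -δ ⟨j.1.natAbs - 1, by have := j.natAbs_bounds; omega⟩

theorem stretch_neg (δ : Fin n → IndexSet m) (j : IndexSet (2 * n)) :
    stretch δ (-j) = -stretch δ j := by
  have h := j.2.2 (even_two_mul n)
  have h' : (-j).1.natAbs = j.1.natAbs := by rw [neg_val, Int.natAbs_neg]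
  have hv : (-j).1 = -j.1 := neg_val j
  simp only [stretch, h']
  by_cases hj : 0 < j.1
  · rw [if_neg (by omega), if_pos hj]
  · rw [if_pos (by omega), if_neg hj, IndexSet.neg_neg]

theorem stretch_nonneg {δ : Fin n → IndexSet m} (hδ : IsDominant δ) {j : IndexSet (2 * n)}
    (h : 0 ≤ j.1) : 0 ≤ (stretch δ j).1 := by
  have h' := j.2.2 (even_two_mul n)
  rw [stretch, if_pos (by omega)]
  exact hδ.nonneg _

theorem stretch_nonpos {δ : Fin n → IndexSet m} (hδ : IsDominant δ) {j : IndexSet (2 * n)}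
    (h : j.1 ≤ 0) : (stretch δ j).1 ≤ 0 := by
  rw [stretch, if_neg (by omega), neg_val]
  have := hδ.nonneg ⟨j.1.natAbs - 1, by have := j.natAbs_bounds; omega⟩
  omega

theorem stretch_mono {δ : Fin n → IndexSet m} (hδ : IsDominant δ) {i j : IndexSet (2 * n)}
    (h : i.1 ≤ j.1) : (stretch δ i).1 ≤ (stretch δ j).1 := by
  by_cases hi : 0 < i.1
  · rw [stretch, stretch, if_pos hi, if_pos (by omega)]
    exact hδ.mono (by rw [Fin.le_def]; simp only; omega)
  · by_cases hj : 0 < j.1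
    · exact (stretch_nonpos hδ (by omega)).trans (stretch_nonneg hδ hj.le)
    · rw [stretch, stretch, if_neg hi, if_neg hj, neg_val, neg_val, neg_le_neg_iff]
      exact hδ.mono (by rw [Fin.le_def]; simp only; omega)

/-- The tuple obtained by stretching every entry. -/
def stretchTuple (δ : Fin n → IndexSet m) (e : Fin n → IndexSet (2 * n)) : Fin n → IndexSet m :=
  fun i => stretch δ (e i)

theorem stretchTuple_act (δ : Fin n → IndexSet m) (e : Fin n → IndexSet (2 * n)) (t : Fin n) :
    stretchTuple δ (act e t) = act (stretchTuple δ e) t := by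
  funext j
  simp only [stretchTuple]
  by_cases ht : t.1 = 0
  · simp only [act_zero_apply _ _ _ ht]
    split_ifs
    · exact stretch_neg _ _
    · rfl
  · simp only [act_pos_apply _ _ _ ht]
    split_ifs <;> rfl

/-- Stretching may merge entries but never reverses their order, being odd and weakly monotone. Read
contrapositively, a strict inequality after stretching already holds before it. -/
theorem stretchTuple_le {δ : Fin n → IndexSet m} (hδ : IsDominant δ)
    (e : Fin n → IndexSet (2 * n)) (t : Fin n) (h : (e t).1 ≤ leftValue e t) :
    (stretchTuple δ e t).1 ≤ leftValue (stretchTuple δ e) t := by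
  by_cases ht : t.1 = 0
  · rw [leftValue_zero _ _ ht] at h ⊢
    exact stretch_nonpos hδ h
  · rw [leftValue_pos _ _ ht] at h ⊢
    exact stretch_mono hδ h

theorem le_stretchTuple {δ : Fin n → IndexSet m} (hδ : IsDominant δ)
    (e : Fin n → IndexSet (2 * n)) (t : Fin n) (h : leftValue e t ≤ (e t).1) :
    leftValue (stretchTuple δ e) t ≤ (stretchTuple δ e t).1 := by
  by_cases ht : t.1 = 0
  · rw [leftValue_zero _ _ ht] at h ⊢
    exact stretch_nonneg hδ h
  · rw [leftValue_pos _ _ ht] at h ⊢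
    exact stretch_mono hδ h

/-- Signed permutations of `(1, …, n)`. -/
def IsSigned (e : Fin n → IndexSet (2 * n)) : Prop :=
  ∀ i j, (e i).1.natAbs = (e j).1.natAbs → i = j

theorem isSigned_regularTuple : IsSigned (regularTuple n) := by
  intro i j h
  simp only [regularTuple] at h
  exact Fin.ext (by omega)

theorem IsSigned.act {e : Fin n → IndexSet (2 * n)} (he : IsSigned e) (t : Fin n) :
    IsSigned (act e t) := by
  by_cases ht : t.1 = 0
  · have h : ∀ i, (TypeBSchur.act e t i).1.natAbs = (e i).1.natAbs := by
      intro i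
      rw [act_zero_apply _ _ _ ht]
      split_ifs with h
      · rw [h, neg_val, Int.natAbs_neg]
      · rfl
    intro i j hij
    rw [h, h] at hij
    exact he _ _ hij
  · intro i j hij
    rw [act_eq_comp_swap _ _ ht] at hij
    exact (Equiv.swap _ _).injective (he _ _ hij)

theorem IsSigned.leftValue_ne {e : Fin n → IndexSet (2 * n)} (he : IsSigned e) (t : Fin n) :
    leftValue e t ≠ (e t).1 := by
  by_cases ht : t.1 = 0
  · rw [leftValue_zero _ _ ht]
    exact ((e t).2.2 (even_two_mul n)).symm
  · rw [leftValue_pos _ _ ht]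
    intro h
    have := congrArg Fin.val (he _ _ (congrArg Int.natAbs h))
    simp only at this
    omega

open Classical in
/-- The signed permutations stretching to a given tuple. -/
noncomputable def stretchFiber (δ d : Fin n → IndexSet m) : Finset (Fin n → IndexSet (2 * n)) :=
  Finset.univ.filter fun e => IsSigned e ∧ stretchTuple δ e = d

theorem mem_stretchFiber {δ d : Fin n → IndexSet m} {e : Fin n → IndexSet (2 * n)} :
    e ∈ stretchFiber δ d ↔ IsSigned e ∧ stretchTuple δ e = d := by
  simp [stretchFiber]

theorem act_mem_stretchFiber {δ d : Fin n → IndexSet m} {e : Fin n → IndexSet (2 * n)}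
    (t : Fin n) (h : e ∈ stretchFiber δ d) : act e t ∈ stretchFiber δ (act d t) := by
  rw [mem_stretchFiber] at h ⊢
  exact ⟨h.1.act t, by rw [stretchTuple_act, h.2]⟩

theorem sum_stretchFiber_act {M : Type*} [AddCommMonoid M] (δ d : Fin n → IndexSet m) (t : Fin n)
    (f : (Fin n → IndexSet (2 * n)) → M) :
    ∑ e ∈ stretchFiber δ (act d t), f e = ∑ e ∈ stretchFiber δ d, f (act e t) := by
  refine Finset.sum_nbij' (fun e => act e t) (fun e => act e t) ?_ ?_ ?_ ?_ ?_
  · intro e he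
    simpa only [act_act] using act_mem_stretchFiber t he
  · exact fun e he => act_mem_stretchFiber t he
  · exact fun e _ => act_act e t
  · exact fun e _ => act_act e t
  · exact fun e _ => by rw [act_act]

theorem stretchTuple_regularTuple (δ : Fin n → IndexSet m) :
    stretchTuple δ (regularTuple n) = δ := by
  funext i
  rw [stretchTuple, stretch, if_pos (by simp only [regularTuple]; omega)]
  congr 1

/-- A dominant tuple is its own stretch of (1, …, n), and stretching commutes with the generators
that undo descents. -/
theorem exists_stretchFiber (d : Fin n → IndexSet m) :
    ∃ δ, IsDominant δ ∧ (stretchFiber δ d).Nonempty := by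
  induction d using descent_induction with
  | hdom d hd =>
    exact ⟨d, hd, regularTuple n,
      mem_stretchFiber.2 ⟨isSigned_regularTuple, stretchTuple_regularTuple d⟩⟩
  | hstep d t _ ih =>
    obtain ⟨δ, hδ, e, he⟩ := ih
    exact ⟨δ, hδ, act e t, by simpa only [act_act] using act_mem_stretchFiber t he⟩

variable {k : Type u} [Field k] (q Q : k)

/-- The sum of the basis vectors over the signed permutations stretching to `d`. -/
noncomputable def fiberSum (δ d : Fin n → IndexSet m) : TensorSpace q Q n (2 * n) :=
  ∑ e ∈ stretchFiber δ d, tensorBasis q Q n (2 * n) e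

theorem heckeOp_fiberSum_lt {δ : Fin n → IndexSet m} (hδ : IsDominant δ) (d : Fin n → IndexSet m)
    (t : Fin n) (h : leftValue d t < (d t).1) :
    heckeOp q Q t (fiberSum q Q δ d) = fiberSum q Q δ (act d t) := by
  rw [fiberSum, fiberSum, sum_stretchFiber_act, map_sum]
  refine Finset.sum_congr rfl fun e he => ?_
  obtain ⟨_, rfl⟩ := mem_stretchFiber.1 he
  refine heckeOp_lt _ _ _ _ (lt_of_not_ge fun h' => ?_)
  exact absurd (stretchTuple_le hδ e t h') h.not_ge

theorem heckeOp_fiberSum_gt {δ : Fin n → IndexSet m} (hδ : IsDominant δ) (d : Fin n → IndexSet m)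
    (t : Fin n) (h : (d t).1 < leftValue d t) :
    heckeOp q Q t (fiberSum q Q δ d) = heckeParam q Q t.1 • fiberSum q Q δ (act d t) +
        (heckeParam q Q t.1 - 1) • fiberSum q Q δ d := by
  rw [fiberSum, fiberSum, sum_stretchFiber_act, map_sum, Finset.smul_sum, Finset.smul_sum,
    ← Finset.sum_add_distrib]
  refine Finset.sum_congr rfl fun e he => ?_
  obtain ⟨_, rfl⟩ := mem_stretchFiber.1 he
  refine heckeOp_gt _ _ _ _ (lt_of_not_ge fun h' => ?_)
  exact absurd (le_stretchTuple hδ e t h') h.not_ge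

/-- If t fixes d, it acts without fixed points on the fibre of d. In each pair {e, e·s_t} one member
is an ascent and the other a descent, and the quadratic relation makes v_e + v_{e·s_t} an
eigenvector with eigenvalue q_t. -/
theorem heckeOp_fiberSum_eq (δ d : Fin n → IndexSet m)
    (t : Fin n) (h : leftValue d t = (d t).1) :
    heckeOp q Q t (fiberSum q Q δ d) = heckeParam q Q t.1 • fiberSum q Q δ d := by
  rw [← sub_eq_zero, fiberSum, map_sum, Finset.smul_sum, ← Finset.sum_sub_distrib]
  refine Finset.sum_involution (fun e _ => act e t) ?_ ?_ ?_ ?_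
  · intro e he
    have hne := (mem_stretchFiber.1 he).1.leftValue_ne t
    have hs := act_self_sub e t
    rcases hne.lt_or_gt with h1 | h1
    · rw [heckeOp_lt _ _ _ _ h1, heckeOp_gt _ _ _ _ (by omega), act_act]
      module
    · rw [heckeOp_gt _ _ _ _ h1, heckeOp_lt _ _ _ _ (by omega), act_act]
      module
  · intro e he _ heq
    have hne := (mem_stretchFiber.1 he).1.leftValue_ne t
    have hs := act_self_sub e t
    rw [heq] at hs
    omega
  · intro e he
    have := act_mem_stretchFiber t he
    rwa [act_of_eq d t h] at this
  · exact fun e _ => act_act e t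

/-- The homomorphism of tensor spaces sending `v_d` to the sum of the basis vectors over its
fiber. -/
noncomputable def stretchHom (δ : Fin n → IndexSet m) (hδ : IsDominant δ) :
    TensorSpace q Q n m →ₗ[(Hecke q Q n)ᵐᵒᵖ] TensorSpace q Q n (2 * n) :=
  heckeLinear q Q ((tensorBasis q Q n m).constr k (fiberSum q Q δ)) (by
    intro t x
    rw [tensorSpace_smul_T, tensorSpace_smul_T, ← LinearMap.comp_apply, ← LinearMap.comp_apply]
    congr 1
    refine (tensorBasis q Q n m).ext fun d => ?_
    simp only [LinearMap.comp_apply, Module.Basis.constr_basis]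
    rcases lt_trichotomy (leftValue d t) (d t).1 with h | h | h
    · rw [heckeOp_lt _ _ _ _ h, Module.Basis.constr_basis, heckeOp_fiberSum_lt q Q hδ d t h]
    · rw [heckeOp_eq _ _ _ _ h, map_smul, Module.Basis.constr_basis,
        heckeOp_fiberSum_eq q Q δ d t h, act_of_eq d t h]
    · rw [heckeOp_gt _ _ _ _ h, map_add, map_smul, map_smul, Module.Basis.constr_basis,
        Module.Basis.constr_basis, heckeOp_fiberSum_gt q Q hδ d t h])

theorem stretchHom_basis (δ : Fin n → IndexSet m) (hδ : IsDominant δ) (d : Fin n → IndexSet m) :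
    stretchHom q Q δ hδ (tensorBasis q Q n m d) = fiberSum q Q δ d :=
  (tensorBasis q Q n m).constr_basis k _ _

/-- The fibres are disjoint, so v_e occurs only in the image of the basis vector indexed by the
stretch of e. -/
theorem tensorBasis_repr_stretchHom (δ : Fin n → IndexSet m) (hδ : IsDominant δ)
    (x : TensorSpace q Q n m) {e : Fin n → IndexSet (2 * n)} (he : IsSigned e) :
    (tensorBasis q Q n (2 * n)).repr (stretchHom q Q δ hδ x) e =
      (tensorBasis q Q n m).repr x (stretchTuple δ e) := by
  have H : ((tensorBasis q Q n (2 * n)).coord e).comp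
      ((tensorBasis q Q n m).constr k (fiberSum q Q δ)) =
      (tensorBasis q Q n m).coord (stretchTuple δ e) := by
    refine (tensorBasis q Q n m).ext fun d => ?_
    rw [LinearMap.comp_apply, Module.Basis.constr_basis, fiberSum, map_sum]
    simp only [Module.Basis.coord_apply, Module.Basis.repr_self, Finsupp.single_apply]
    rw [Finset.sum_ite_eq']
    simp only [mem_stretchFiber, he, true_and]
    by_cases h : stretchTuple δ e = d
    · rw [if_pos h, if_pos h.symm]
    · rw [if_neg h, if_neg (Ne.symm h)]
  exact congrArg (fun l => l x) H

/-- Every tuple is the stretch of some signed permutation along some δ, so each coefficient of x is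
also a coefficient of some stretched image. -/
theorem eq_zero_of_stretchHom_eq_zero (x : TensorSpace q Q n m)
    (h : ∀ δ hδ, stretchHom q Q δ hδ x = 0) : x = 0 := by
  rw [← (tensorBasis q Q n m).repr.map_eq_zero_iff]
  ext d
  obtain ⟨δ, hδ, e, he⟩ := exists_stretchFiber d
  obtain ⟨he', rfl⟩ := mem_stretchFiber.1 he
  rw [← tensorBasis_repr_stretchHom q Q δ hδ x he', h, map_zero]
  rfl

end Stretch

/-! ### The free vector and finite dimensionality of the Hecke algebra -/

section Regular

variable {k : Type u} [Field k] (q Q : k) (n : ℕ)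

/-- The vector `v_1 ⊗ ⋯ ⊗ v_n`, which generates a free submodule. -/
noncomputable def regularVec : TensorSpace q Q n (2 * n) :=
  tensorBasis q Q n (2 * n) (regularTuple n)

theorem isDominant_regularTuple : IsDominant (regularTuple n) :=
  isDominant_of_mono (fun i => by simp only [regularTuple]; omega)
    (fun i j h => by simp only [regularTuple]; rw [Fin.le_def] at h; omega)

variable {n}

/-- The tuple (1, …, n) has no fixed position, so the presentation allows any image for its vector.
Sending it to 1 and the other dominant vectors to 0 splits the orbit map. Identities in H_n can thus
be verified on this vector. -/
theorem regularVec_smul_injective {h h' : Hecke q Q n}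
    (H : op h • regularVec q Q n = op h' • regularVec q Q n) : h = h' := by
  classical
  let f : TensorSpace q Q n (2 * n) →ₗ[(Hecke q Q n)ᵐᵒᵖ] Hecke q Q n :=
    tensorLift q Q (fun d => if d = regularTuple n then 1 else 0) (by
      intro d _ t ht
      rw [if_neg, map_zero, smul_zero]
      rintro rfl
      exact isSigned_regularTuple.leftValue_ne t ht)
  have hf : f (regularVec q Q n) = 1 :=
    (tensorLift_dominant q Q _ _ _ (isDominant_regularTuple n)).trans (if_pos rfl)
  have := congrArg f H
  simpa [map_smul, hf] using this

noncomputable instance : Module.Finite k (TensorSpace q Q n m) :=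
  Module.Finite.of_basis (tensorBasis q Q n m)

theorem hecke_finite : Module.Finite k (Hecke q Q n) :=
  Module.Finite.of_injective
    ({ toFun := fun h => op h • regularVec q Q n
       map_add' := fun a b => by rw [MulOpposite.op_add, add_smul]
       map_smul' := fun c a => by rw [op_smul, smul_assoc, RingHom.id_apply] } :
      Hecke q Q n →ₗ[k] TensorSpace q Q n (2 * n))
    (fun _ _ H => regularVec_smul_injective q Q H)

end Regular

/-! ### Dominant tuples and bicompositions of type B -/

section Weight

variable {n m : ℕ}

/-- A lower set of a finite chain is the initial segment of its cardinality; this converts part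
sizes into positions. -/
theorem Fin.lt_card_filter_iff (P : Fin n → Prop) [DecidablePred P]
    (hP : ∀ i j, i ≤ j → P j → P i) (i : Fin n) :
    i.1 < (Finset.univ.filter P).card ↔ P i := by
  constructor
  · intro h
    by_contra hi
    have hsub : Finset.univ.filter P ⊆ Finset.Iio i := by
      intro j hj
      rw [Finset.mem_filter] at hj
      rw [Finset.mem_Iio]
      by_contra hij
      exact hi (hP i j (not_lt.1 hij) hj.2)
    have := Finset.card_le_card hsub
    rw [Fin.card_Iio] at this
    omega
  · intro h
    have hsub : Finset.Iic i ⊆ Finset.univ.filter P := by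
      intro j hj
      rw [Finset.mem_filter]
      exact ⟨Finset.mem_univ _, hP j i (Finset.mem_Iic.1 hj) h⟩
    have := Finset.card_le_card hsub
    rw [Fin.card_Iic] at this
    omega

theorem sum_card_fiber {ι κ : Type*} [Fintype ι] [DecidableEq κ] (f : ι → κ) (t : Finset κ) :
    ∑ p ∈ t, (Finset.univ.filter fun i => f i = p).card =
      (Finset.univ.filter fun i => f i ∈ t).card := by
  rw [Finset.card_eq_sum_card_fiberwise (f := f) (s := Finset.univ.filter fun i => f i ∈ t)
    (t := t) (fun i hi => by simpa using hi)]
  refine Finset.sum_congr rfl fun p hp => ?_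
  congr 1
  ext i
  simp only [Finset.mem_filter, Finset.mem_univ, true_and]
  exact ⟨fun h => ⟨h ▸ hp, h⟩, fun h => h.2⟩

theorem IndexSet.natAbs_le (j : IndexSet m) : j.1.natAbs ≤ m / 2 := by
  have h1 := abs_le.1 j.2.1
  omega

/-- The part of a bicomposition to which the position `i` of a tuple belongs. -/
def partOf (d : Fin n → IndexSet m) (i : Fin n) : Fin n ⊕ Fin (m / 2) :=
  if h : (d i).1 = 0 then Sum.inl ⟨0, i.pos⟩
  else Sum.inr ⟨(d i).1.natAbs - 1, by have := (d i).natAbs_le; omega⟩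

/-- The weight of a tuple: the numbers of zeros and of entries of each absolute value. -/
def weight (d : Fin n → IndexSet m) : Bicomposition n (m / 2) :=
  ⟨fun p => (Finset.univ.filter fun i => partOf d i = p).card, by
    rw [sum_card_fiber]
    simp⟩

theorem weight_apply (d : Fin n → IndexSet m) (p : Fin n ⊕ Fin (m / 2)) :
    (weight d).1 p = (Finset.univ.filter fun i => partOf d i = p).card := rfl

theorem partOf_eq_iff (d d' : Fin n → IndexSet m) (i i' : Fin n) :
    partOf d i = partOf d' i' ↔ (d i).1.natAbs = (d' i').1.natAbs := by
  unfold partOf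
  by_cases h : (d i).1 = 0 <;> by_cases h' : (d' i').1 = 0
  · simp [h, h']
  · simp [h, h']; omega
  · simp [h, h']
  · simp [h, h']; omega

theorem partOf_eq_inl (d : Fin n → IndexSet m) (i a : Fin n) (h : partOf d i = Sum.inl a) :
    (d i).1 = 0 ∧ a.1 = 0 := by
  unfold partOf at h
  split_ifs at h with h'
  exact ⟨h', by rw [← Sum.inl.inj h]⟩

theorem weight_isTypeB (d : Fin n → IndexSet m) : (weight d).IsTypeB m := by
  intro a ha
  rw [weight_apply, Finset.card_ne_zero] at ha
  obtain ⟨i, hi⟩ := ha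
  obtain ⟨h1, h2⟩ := partOf_eq_inl d i a (Finset.mem_filter.1 hi).2
  refine ⟨?_, h2⟩
  by_contra hodd
  exact (d i).2.2 (Nat.not_odd_iff_even.1 hodd) h1

/-- The order of the parts of a bicomposition. -/
def partRank : Fin n ⊕ Fin (m / 2) → ℕ := Sum.elim (fun i => i.1) fun j => n + j.1

theorem partRank_injective : Function.Injective (partRank (n := n) (m := m)) := by
  rintro (i | i) (j | j) h <;> simp only [partRank, Sum.elim_inl, Sum.elim_inr] at h
  · rw [Fin.ext h]
  · omega
  · omega
  · rw [Fin.ext (a := i) (b := j) (by omega)]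

theorem fstSize_weight (d : Fin n → IndexSet m) :
    (weight d).fstSize = (Finset.univ.filter fun i => partRank (partOf d i) < n).card := by
  have h := sum_card_fiber (partOf d) (Finset.univ.map ⟨Sum.inl, Sum.inl_injective⟩)
  rw [Finset.sum_map] at h
  refine h.trans (congrArg _ (Finset.filter_congr fun i _ => ?_))
  rcases partOf d i with a | a <;> simp [partRank]

theorem partStart_weight (d : Fin n → IndexSet m) (p : Fin n ⊕ Fin (m / 2)) :
    (weight d).partStart p =
      (Finset.univ.filter fun i => partRank (partOf d i) < partRank p).card := by
  rcases p with b | b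
  · have h := sum_card_fiber (partOf d) ((Finset.Iio b).map ⟨Sum.inl, Sum.inl_injective⟩)
    rw [Finset.sum_map] at h
    refine h.trans (congrArg _ (Finset.filter_congr fun i _ => ?_))
    rcases partOf d i with a | a <;> simp [partRank] 
    omega
  · have h := sum_card_fiber (partOf d) ((Finset.Iio b).map ⟨Sum.inr, Sum.inr_injective⟩)
    rw [Finset.sum_map] at h
    refine (congrArg₂ (· + ·) (fstSize_weight d) h).trans ?_
    rw [← Finset.card_union_of_disjoint, ← Finset.filter_or]
    · refine congrArg _ (Finset.filter_congr fun i _ => ?_)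
      rcases partOf d i with a | a <;> simp [partRank]
      omega
    · rw [Finset.disjoint_filter]
      intro i _ h1 h2
      obtain ⟨a, _, ha⟩ := Finset.mem_map.1 h2
      rw [← ha] at h1
      simp [partRank] at h1

theorem partRank_partOf_mono {d : Fin n → IndexSet m} (hd : IsDominant d) {i j : Fin n}
    (h : i ≤ j) : partRank (partOf d i) ≤ partRank (partOf d j) := by
  have h1 := hd.mono h
  have h2 := hd.nonneg i
  unfold partOf
  split_ifs
  · simp [partRank]
  · simp [partRank]
  · omega
  · simp [partRank]; omega

/-- Dominance sorts the positions by part. The positions in parts before p, and those in parts up to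
p, are initial segments whose lengths are the start and the end of the block. -/
theorem mem_block_weight {d : Fin n → IndexSet m} (hd : IsDominant d) (p : Fin n ⊕ Fin (m / 2))
    (i : Fin n) : i ∈ (weight d).block p ↔ partOf d i = p := by
  have hsum : (weight d).partStart p + (weight d).1 p =
      (Finset.univ.filter fun i => partRank (partOf d i) ≤ partRank p).card := by
    rw [partStart_weight, weight_apply, ← Finset.card_union_of_disjoint, ← Finset.filter_or]
    · refine congrArg _ (Finset.filter_congr fun i _ => ?_)
      rw [le_iff_lt_or_eq, partRank_injective.eq_iff]
    · rw [Finset.disjoint_filter]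
      intro i _ h1 h2
      rw [h2] at h1
      exact lt_irrefl _ h1
  change (weight d).partStart p ≤ i.1 ∧ i.1 < (weight d).partStart p + (weight d).1 p ↔ _
  rw [hsum, partStart_weight, ← not_lt,
    Fin.lt_card_filter_iff _ (fun i j h h' => (partRank_partOf_mono hd h).trans_lt h'),
    Fin.lt_card_filter_iff _ (fun i j h h' => (partRank_partOf_mono hd h).trans h'),
    ← partRank_injective.eq_iff]
  omega

theorem lt_fstSize_weight {d : Fin n → IndexSet m} (hd : IsDominant d) (i : Fin n) :
    i.1 < (weight d).fstSize ↔ (d i).1 = 0 := by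
  rw [fstSize_weight,
    Fin.lt_card_filter_iff _ (fun i j h h' => (partRank_partOf_mono hd h).trans_lt h')]
  unfold partOf
  split_ifs with h
  · simp [partRank, h]
    exact i.pos
  · simp [partRank, h]

theorem IsDominant.eq_of_natAbs {d d' : Fin n → IndexSet m} (hd : IsDominant d)
    (hd' : IsDominant d') (i i' : Fin n) (h : (d i).1.natAbs = (d' i').1.natAbs) :
    d i = d' i' := by
  have h1 := hd.nonneg i
  have h2 := hd'.nonneg i'
  exact Subtype.ext (by omega)

theorem mem_youngSubgroup_weight {d : Fin n → IndexSet m} (hd : IsDominant d)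
    (w : Equiv.Perm (Fin n)) : w ∈ (weight d).youngSubgroup ↔ ∀ i, d (w i) = d i := by
  change (∀ p i, w i ∈ (weight d).block p ↔ i ∈ (weight d).block p) ↔ _
  simp only [mem_block_weight hd]
  constructor
  · intro h i
    have := (h (partOf d i) i).2 rfl
    rw [partOf_eq_iff] at this
    exact hd.eq_of_natAbs hd _ _ this
  · intro h p i
    have : partOf d (w i) = partOf d i := by rw [partOf_eq_iff, h]
    rw [this]

theorem weight_injective {d d' : Fin n → IndexSet m} (hd : IsDominant d) (hd' : IsDominant d')
    (h : weight d = weight d') : d = d' := by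
  funext i
  refine hd.eq_of_natAbs hd' _ _ ?_
  rw [← partOf_eq_iff, ← mem_block_weight hd, h, mem_block_weight hd']

/-- Distribute the positions over the parts by any bijection, label each by the value of its part,
and sort. The type B condition ensures that the label 0 is a legal entry and that only the first
part carries it. -/
theorem exists_dominant_weight {l : Bicomposition n (m / 2)} (hl : l.IsTypeB m) :
    ∃ d : Fin n → IndexSet m, IsDominant d ∧ weight d = l := by
  have hcard : Fintype.card (Fin n) = Fintype.card (Σ p, Fin (l.1 p)) := by
    simp [l.2]
  let e := Fintype.equivOfCardEq hcard
  let val : Fin n ⊕ Fin (m / 2) → ℕ := Sum.elim (fun _ => 0) fun j => j.1 + 1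
  have hval : ∀ i, |((val (e i).1 : ℕ) : ℤ)| ≤ ((m / 2 : ℕ) : ℤ) ∧
      (Even m → ((val (e i).1 : ℕ) : ℤ) ≠ 0) := by
    intro i
    have hpos : l.1 (e i).1 ≠ 0 := (e i).2.pos.ne'
    rcases h : (e i).1 with a | a
    · rw [h] at hpos
      have := (hl a hpos).1
      simp only [val, Sum.elim_inl, Nat.cast_zero, abs_zero]
      exact ⟨by omega, fun he => absurd this (Nat.not_odd_iff_even.2 he)⟩
    · simp only [val, Sum.elim_inr]
      exact ⟨by rw [abs_of_nonneg (by positivity)]; omega, fun _ => by omega⟩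
  let d : Fin n → IndexSet m := fun i => ⟨val (e i).1, hval i⟩
  have hpart : ∀ i, partOf d i = (e i).1 := by
    intro i
    have hpos : l.1 (e i).1 ≠ 0 := (e i).2.pos.ne'
    rcases h : (e i).1 with a | a
    · rw [h] at hpos
      have h0 : (d i).1 = 0 := by simp [d, val, h]
      rw [partOf, dif_pos h0]
      exact congrArg _ (Fin.ext (hl a hpos).2.symm)
    · have h0 : (d i).1 = (a.1 : ℤ) + 1 := by simp [d, val, h]
      rw [partOf, dif_neg (by omega)]
      exact congrArg _ (Fin.ext (by simp only [h0]; omega))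
  let σ := Tuple.sort fun i => (d i).1
  have hσ := Tuple.monotone_sort fun i => (d i).1
  refine ⟨d ∘ σ, isDominant_of_mono (fun i => Int.natCast_nonneg _) (fun i j h => hσ h), ?_⟩
  apply Subtype.ext
  funext p
  rw [weight_apply]
  have h1 : ∀ i, partOf (d ∘ σ) i = (e (σ i)).1 := by
    intro i
    rw [← hpart, partOf_eq_iff]
    rfl
  simp only [h1]
  rw [← Fintype.card_subtype]
  have h2 : Fintype.card {i // (e (σ i)).1 = p} =
      Fintype.card {x : Σ p, Fin (l.1 p) // x.1 = p} :=
    Fintype.card_congr ((σ.trans e).subtypeEquiv fun i => Iff.rfl)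
  rw [h2, Fintype.card_congr (Equiv.sigmaSubtype p), Fintype.card_fin]

end Weight

/-! ### Reduced words and the exchange condition -/

section ReducedWords

variable {n : ℕ}

theorem adjSwap_mul_self (i : {i : Fin n // 0 < i.1}) : adjSwap i * adjSwap i = 1 :=
  Equiv.swap_mul_self _ _

/-- The position to the left of a positive position. -/
def predPos (i : {i : Fin n // 0 < i.1}) : Fin n := ⟨i.1.1 - 1, by omega⟩

theorem predPos_lt (i : {i : Fin n // 0 < i.1}) : predPos i < i.1 := by
  have := i.2
  rw [Fin.lt_def]; simp only [predPos]; omega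

theorem adjSwap_lt_of_lt (i : {i : Fin n // 0 < i.1}) {a b : Fin n} (h : a < b)
    (hne : ¬ (a = predPos i ∧ b = i.1)) : adjSwap i a < adjSwap i b := by
  have := i.2
  change ¬ (a = ⟨i.1.1 - 1, _⟩ ∧ b = i.1) at hne
  simp only [adjSwap, Equiv.swap_apply_def]
  simp only [Fin.ext_iff, Fin.lt_def] at *
  split_ifs <;> (try simp only) <;> omega

/-- The exchange condition. Scanning from the right, some letter is the one that reverses the order
of the preimages of a and b; left multiplication by (a b) amounts to deleting that letter. -/
theorem exists_word_swap_mul (l : List {i : Fin n // 0 < i.1}) (a b : Fin n) (hab : a < b)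
    (h : (l.map adjSwap).prod⁻¹ b < (l.map adjSwap).prod⁻¹ a) :
    ∃ l' : List {i : Fin n // 0 < i.1}, l'.length + 1 = l.length ∧
      (l'.map adjSwap).prod = Equiv.swap a b * (l.map adjSwap).prod := by
  induction l using List.reverseRecOn with
  | nil => exact absurd h (by simpa using hab.le)
  | append_singleton l i ih =>
    set w := (l.map adjSwap).prod with hw
    have hp : ((l ++ [i]).map adjSwap).prod = w * adjSwap i := by simp [hw]
    rw [hp] at h ⊢
    have hinv : ∀ x, (w * adjSwap i)⁻¹ x = adjSwap i (w⁻¹ x) := by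
      intro x
      rw [mul_inv_rev, Equiv.Perm.mul_apply, adjSwap, Equiv.swap_inv]
    rw [hinv, hinv] at h
    rcases lt_trichotomy (w⁻¹ b) (w⁻¹ a) with h1 | h1 | h1
    · obtain ⟨l', h2, h3⟩ := ih h1
      exact ⟨l' ++ [i], by simp [h2], by simp [h3, mul_assoc]⟩
    · exact absurd (w⁻¹.injective h1) hab.ne'
    · refine ⟨l, by simp, ?_⟩
      have hc : w⁻¹ a = predPos i ∧ w⁻¹ b = i.1 := by
        by_contra hne
        exact absurd h (adjSwap_lt_of_lt i h1 hne).not_gt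
      have ha : a = w (predPos i) := by rw [← hc.1]; exact (w.apply_symm_apply a).symm
      have hb : b = w i.1 := by rw [← hc.2]; exact (w.apply_symm_apply b).symm
      have : Equiv.swap a b * w = w * adjSwap i := by
        rw [ha, hb, Equiv.swap_apply_apply]
        simp [adjSwap, predPos]
      rw [← mul_assoc, this, mul_assoc, adjSwap_mul_self, mul_one]

/-- Otherwise the exchange condition would give a shorter word for w. -/
theorem IsReducedWord.lt_of_append {l : List {i : Fin n // 0 < i.1}} {i : {i : Fin n // 0 < i.1}}
    {w : Equiv.Perm (Fin n)} (h : IsReducedWord (l ++ [i]) w) :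
    (l.map adjSwap).prod (predPos i) < (l.map adjSwap).prod i.1 := by
  by_contra hlt
  set v := (l.map adjSwap).prod with hv
  have hne : v i.1 ≠ v (predPos i) := fun he => (predPos_lt i).ne' (v.injective he)
  have hlt := lt_of_le_of_ne (not_lt.1 hlt) hne
  obtain ⟨l', h1, h2⟩ := exists_word_swap_mul l _ _ hlt (by
    rw [← hv]
    exact ((v.symm_apply_apply _).trans_lt (predPos_lt i)).trans_eq (v.symm_apply_apply _).symm)
  have h3 : Equiv.swap (v i.1) (v (predPos i)) * v = w := by
    rw [Equiv.swap_apply_apply, ← h.1, List.map_append, List.prod_append, ← hv]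
    simp [adjSwap, predPos, Equiv.swap_comm]
  have := h.2 l' (h2.trans h3)
  rw [List.length_append, List.length_singleton] at this
  omega

theorem IsReducedWord.of_append {l : List {i : Fin n // 0 < i.1}} {i : {i : Fin n // 0 < i.1}}
    {w : Equiv.Perm (Fin n)} (h : IsReducedWord (l ++ [i]) w) :
    IsReducedWord l (l.map adjSwap).prod := by
  refine ⟨rfl, fun l' hl' => ?_⟩
  have := h.2 (l' ++ [i]) (by rw [List.map_append, List.prod_append, hl', ← h.1]; simp)
  simpa using this

theorem isReducedWord_reducedWord (w : Equiv.Perm (Fin n)) : IsReducedWord (reducedWord w) w :=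
  (exists_reducedWord w).choose_spec

theorem adjSwap_inv (i : {i : Fin n // 0 < i.1}) : (adjSwap i)⁻¹ = adjSwap i :=
  Equiv.swap_inv _ _

theorem adjSwap_predPos (i : {i : Fin n // 0 < i.1}) : adjSwap i (predPos i) = i.1 :=
  Equiv.swap_apply_left _ _

theorem adjSwap_self (i : {i : Fin n // 0 < i.1}) : adjSwap i i.1 = predPos i :=
  Equiv.swap_apply_right _ _

theorem isReducedWord_cons (w : Equiv.Perm (Fin n)) (i : {i : Fin n // 0 < i.1})
    (h : w⁻¹ (predPos i) < w⁻¹ i.1) : IsReducedWord (i :: reducedWord w) (adjSwap i * w) := by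
  have hw := isReducedWord_reducedWord w
  refine ⟨by rw [List.map_cons, List.prod_cons, hw.1], fun l hl => ?_⟩
  obtain ⟨l', h1, h2⟩ := exists_word_swap_mul l _ _ (predPos_lt i) (by
    rw [hl, mul_inv_rev, adjSwap_inv, Equiv.Perm.mul_apply, Equiv.Perm.mul_apply, adjSwap_self,
      adjSwap_predPos]
    exact h)
  have h3 : Equiv.swap (predPos i) i.1 = adjSwap i := rfl
  have := hw.2 l' (by rw [h2, h3, hl, ← mul_assoc, adjSwap_mul_self, one_mul])
  rw [List.length_cons]
  omega

end ReducedWords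

/-! ### The elements T_w and the eigenvector property of x_λ -/

section SymmetricAction

variable {k : Type u} [Field k] (q Q : k) {n m : ℕ}

theorem act_eq_comp_adjSwap (d : Fin n → IndexSet m) (i : {i : Fin n // 0 < i.1}) :
    act d i.1 = d ∘ adjSwap i := act_eq_comp_swap d i.1 i.2.ne'

theorem leftValue_eq_predPos (d : Fin n → IndexSet m) (i : {i : Fin n // 0 < i.1}) :
    leftValue d i.1 = (d (predPos i)).1 := leftValue_pos d i.1 i.2.ne'

/-- Along a reduced word each letter meets an ascent of the permuted strictly increasing tuple, so
the quadratic relation never intervenes. -/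
theorem word_smul_basis (d : Fin n → IndexSet m) (hd : ∀ i j, i < j → (d i).1 < (d j).1)
    (l : List {i : Fin n // 0 < i.1}) (w : Equiv.Perm (Fin n)) (hl : IsReducedWord l w) :
    op ((l.map fun i => Hecke.T q Q i.1).prod) • tensorBasis q Q n m d =
      tensorBasis q Q n m (d ∘ w) := by
  induction l using List.reverseRecOn generalizing w with
  | nil =>
    rw [← hl.1]
    simp
  | append_singleton l i ih =>
    have h1 := hl.lt_of_append
    have h2 := ih _ hl.of_append
    rw [List.map_append, List.prod_append, op_mul, mul_smul, h2, List.map_singleton,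
      List.prod_singleton, tensorSpace_smul_T, heckeOp_lt, act_eq_comp_adjSwap, ← hl.1]
    · simp [Function.comp_assoc]
    · rw [leftValue_eq_predPos]
      exact hd _ _ h1

theorem heckeT_smul_basis (d : Fin n → IndexSet m) (hd : ∀ i j, i < j → (d i).1 < (d j).1)
    (w : Equiv.Perm (Fin n)) :
    op (heckeT q Q w) • tensorBasis q Q n m d = tensorBasis q Q n m (d ∘ w) :=
  word_smul_basis q Q d hd _ w (isReducedWord_reducedWord w)

theorem regularTuple_lt (i j : Fin n) (h : i < j) :
    (regularTuple n i).1 < (regularTuple n j).1 := by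
  simp only [regularTuple]; rw [Fin.lt_def] at h; omega

/-- Matsumoto's independence statement: both products send the free vector to the same basis vector.
-/
theorem heckeT_eq_of_reduced (l : List {i : Fin n // 0 < i.1}) (w : Equiv.Perm (Fin n))
    (hl : IsReducedWord l w) : (l.map fun i => Hecke.T q Q i.1).prod = heckeT q Q w := by
  apply regularVec_smul_injective q Q
  rw [regularVec, word_smul_basis q Q _ regularTuple_lt l w hl,
    heckeT_smul_basis q Q _ regularTuple_lt]

theorem T_mul_heckeT (w : Equiv.Perm (Fin n)) (i : {i : Fin n // 0 < i.1})
    (h : w⁻¹ (predPos i) < w⁻¹ i.1) :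
    Hecke.T q Q i.1 * heckeT q Q w = heckeT q Q (adjSwap i * w) := by
  rw [← heckeT_eq_of_reduced q Q _ _ (isReducedWord_cons w i h), List.map_cons, List.prod_cons]
  rfl

theorem heckeParam_pos (i : {i : Fin n // 0 < i.1}) : heckeParam q Q i.1.1 = q :=
  if_neg i.2.ne'

/-- Pair w with s_i w. On the sum of the two basis elements, left multiplication by T_i is
multiplication by q, by the quadratic relation. -/
theorem T_mul_xElem {r : ℕ} (l : Bicomposition n r) (i : {i : Fin n // 0 < i.1})
    (hi : adjSwap i ∈ l.youngSubgroup) :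
    Hecke.T q Q i.1 * xElem q Q l = q • xElem q Q l := by
  classical
  rw [← sub_eq_zero, xElem, Finset.mul_sum, Finset.smul_sum, ← Finset.sum_sub_distrib]
  have key : ∀ w : Equiv.Perm (Fin n), w⁻¹ (predPos i) < w⁻¹ i.1 →
      (Hecke.T q Q i.1 * heckeT q Q w - q • heckeT q Q w) +
        (Hecke.T q Q i.1 * heckeT q Q (adjSwap i * w) - q • heckeT q Q (adjSwap i * w)) = 0 := by
    intro w hw
    have h1 := Hecke.T_quadratic q Q i.1
    rw [heckeParam_pos] at h1
    rw [← T_mul_heckeT q Q w i hw, ← mul_assoc, h1, add_mul, smul_mul_assoc, smul_mul_assoc,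
      one_mul]
    module
  refine Finset.sum_involution (fun w _ => adjSwap i * w) ?_ ?_ ?_ ?_
  · intro w _
    have hne : w⁻¹ (predPos i) ≠ w⁻¹ i.1 := fun h => (predPos_lt i).ne (w⁻¹.injective h)
    rcases hne.lt_or_gt with h | h
    · exact key w h
    · have := key (adjSwap i * w) (by
        rw [mul_inv_rev, adjSwap_inv, Equiv.Perm.mul_apply, Equiv.Perm.mul_apply, adjSwap_self,
          adjSwap_predPos]
        exact h)
      rw [← mul_assoc, adjSwap_mul_self, one_mul] at this
      rw [add_comm]
      exact this
  · intro w _ _ h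
    have h1 := mul_eq_right.1 h
    have h2 := congrArg (fun σ : Equiv.Perm (Fin n) => σ i.1) h1
    simp only [adjSwap_self, Equiv.Perm.one_apply] at h2
    exact (predPos_lt i).ne h2
  · intro w hw
    rw [Finset.mem_filter] at hw ⊢
    exact ⟨Finset.mem_univ _, mul_mem hi hw.2⟩
  · intro w _
    rw [← mul_assoc, adjSwap_mul_self, one_mul]

end SymmetricAction

/-! ### Inversions of tuples -/

section Inversions

variable {n m : ℕ}

/-- The set of inversions of a tuple. -/
def inversions (d : Fin n → IndexSet m) : Finset (Fin n × Fin n) :=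
  Finset.univ.filter fun x => x.1 < x.2 ∧ (d x.2).1 < (d x.1).1

theorem mem_inversions (d : Fin n → IndexSet m) (x : Fin n × Fin n) :
    x ∈ inversions d ↔ x.1 < x.2 ∧ (d x.2).1 < (d x.1).1 := by
  simp [inversions]

theorem card_inversions_of_descent (d : Fin n → IndexSet m) (i : {i : Fin n // 0 < i.1})
    (h : (d i.1).1 < (d (predPos i)).1) :
    (inversions d).card = (inversions (d ∘ adjSwap i)).card + 1 := by
  have hss : ∀ a, adjSwap i (adjSwap i a) = a := fun a => Equiv.swap_apply_self _ _ a
  have hmem : (predPos i, i.1) ∈ inversions d := (mem_inversions _ _).2 ⟨predPos_lt i, h⟩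
  rw [← Finset.card_erase_add_one hmem]
  congr 1
  refine Finset.card_nbij' (fun x => (adjSwap i x.1, adjSwap i x.2))
    (fun x => (adjSwap i x.1, adjSwap i x.2)) ?_ ?_ ?_ ?_
  · rintro ⟨a, b⟩ hx
    rw [Finset.mem_coe, Finset.mem_erase, mem_inversions] at hx
    rw [Finset.mem_coe, mem_inversions]
    simp only [Function.comp_apply, hss]
    exact ⟨adjSwap_lt_of_lt i hx.2.1 fun hc => hx.1 (Prod.ext hc.1 hc.2), hx.2.2⟩
  · rintro ⟨a, b⟩ hx
    rw [Finset.mem_coe, mem_inversions] at hx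
    rw [Finset.mem_coe, Finset.mem_erase, mem_inversions]
    simp only [Function.comp_apply] at hx ⊢
    refine ⟨fun hc => ?_, adjSwap_lt_of_lt i hx.1 fun hc => ?_, hx.2⟩
    · have h1 := congrArg Prod.fst hc
      have h2 := congrArg Prod.snd hc
      simp only at h1 h2
      have h3 := hss a
      have h4 := hss b
      rw [h1, adjSwap_predPos] at h3
      rw [h2, adjSwap_self] at h4
      have := hx.1
      rw [← h3, ← h4] at this
      exact absurd (predPos_lt i) this.not_gt
    · have := hx.2
      rw [hc.1, hc.2, adjSwap_predPos, adjSwap_self] at this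
      exact absurd h this.not_gt
  · exact fun x _ => Prod.ext (hss _) (hss _)
  · exact fun x _ => Prod.ext (hss _) (hss _)

end Inversions

/-! ### The action of x_λ on signed permutations -/

section YoungSum

variable {k : Type u} [Field k] (q Q : k) {n m : ℕ}

open Classical in
-- Each descent removed from d writes v_d as v_{d·s_i} T_i, and T_i is absorbed by x_λ at the cost
-- of a factor q; the number of such steps is the number of inversions. Once d is strictly
-- increasing, T_w just permutes its places.
theorem xElem_smul_basis {δ : Fin n → IndexSet m} (hδ : IsDominant δ)
    (d : Fin n → IndexSet (2 * n)) (hs : IsSigned d)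
    (hd : ∀ i j, (δ i).1 < (δ j).1 → (d i).1 < (d j).1) :
    op (xElem q Q (weight δ)) • tensorBasis q Q n (2 * n) d =
      q ^ (inversions d).card • ∑ w : Equiv.Perm (Fin n) with w ∈ (weight δ).youngSubgroup,
        tensorBasis q Q n (2 * n) (d ∘ w) := by
  induction hN : height d using Nat.strong_induction_on generalizing d with | _ N ih
  by_cases h : ∃ i : {i : Fin n // 0 < i.1}, (d i.1).1 < (d (predPos i)).1
  · obtain ⟨i, hi⟩ := h
    have hle : (δ (predPos i)).1 ≤ (δ i.1).1 := hδ.mono (predPos_lt i).le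
    -- d increases from block to block, so a descent lies inside a block and s_i belongs to the
    -- Young subgroup.
    have heq : δ (predPos i) = δ i.1 := by
      apply Subtype.ext
      by_contra hne
      exact absurd (hd _ _ (lt_of_le_of_ne hle hne)) hi.not_gt
    have hinv : ∀ j, δ (adjSwap i j) = δ j := by
      intro j
      by_cases h1 : j = predPos i
      · rw [h1, adjSwap_predPos, heq]
      · by_cases h2 : j = i.1
        · rw [h2, adjSwap_self, heq]
        · rw [show adjSwap i j = j from Equiv.swap_apply_of_ne_of_ne h1 h2]
    have hmem : adjSwap i ∈ (weight δ).youngSubgroup :=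
      (mem_youngSubgroup_weight hδ _).2 hinv
    have hdesc : (d i.1).1 < leftValue d i.1 := by rwa [leftValue_eq_predPos]
    have hrec := ih _ (hN ▸ height_act_lt d i.1 hdesc) (act d i.1) (hs.act _) (by
      intro a b hab
      rw [act_eq_comp_adjSwap]
      exact hd _ _ (by rwa [hinv, hinv])) rfl
    rw [tensorBasis_act_of_descent q Q d i.1 hdesc, smul_smul, ← op_mul, T_mul_xElem q Q _ i hmem,
      op_smul, smul_assoc, hrec, smul_smul, card_inversions_of_descent d i hi, pow_succ',
      act_eq_comp_adjSwap]
    congr 1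
    refine Finset.sum_nbij' (fun w => adjSwap i * w) (fun w => adjSwap i * w) ?_ ?_ ?_ ?_ ?_
    · intro w hw
      rw [Finset.mem_filter] at hw ⊢
      exact ⟨Finset.mem_univ _, mul_mem hmem hw.2⟩
    · intro w hw
      rw [Finset.mem_filter] at hw ⊢
      exact ⟨Finset.mem_univ _, mul_mem hmem hw.2⟩
    · intro w _
      rw [← mul_assoc, adjSwap_mul_self, one_mul]
    · intro w _
      rw [← mul_assoc, adjSwap_mul_self, one_mul]
    · intro w _
      rw [Function.comp_assoc, Equiv.Perm.coe_mul]
  · push Not at h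
    have hlt : ∀ i j, i < j → (d i).1 < (d j).1 := by
      rintro ⟨i, hi⟩ ⟨j, hj⟩ hij
      have hij : i + 1 ≤ j := hij
      have step : ∀ j (hj : j + 1 < n), (d ⟨j, by omega⟩).1 < (d ⟨j + 1, hj⟩).1 := by
        intro j hj
        refine lt_of_le_of_ne (h ⟨⟨j + 1, hj⟩, Nat.succ_pos j⟩) fun he => ?_
        have := congrArg Fin.val (hs _ _ (congrArg Int.natAbs he))
        simp at this
      induction j, hij using Nat.le_induction with
      | base => exact step i hj
      | succ j hij ih' => exact lt_trans (ih' (by omega) (by assumption) step) (step j hj)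
    have h0 : inversions d = ∅ := by
      rw [Finset.eq_empty_iff_forall_notMem]
      intro x hx
      rw [mem_inversions] at hx
      exact absurd (hlt _ _ hx.1) hx.2.not_gt
    rw [h0, Finset.card_empty, pow_zero, one_smul, xElem, Finset.op_sum, Finset.sum_smul]
    exact Finset.sum_congr rfl fun w _ => heckeT_smul_basis q Q d hlt w

end YoungSum

/-! ### Jucys-Murphy elements and m_λ on the regular vector -/

section JucysMurphy

variable {k : Type u} [Field k] (q Q : k) {n m : ℕ}

/-- The entry travels to the front, is negated and travels back. Its absolute value dominates those
before it, so every step is an ascent and no extra terms appear; each recursion step contributes one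
factor q⁻¹. -/
theorem jucysMurphy_smul_basis (a : ℕ) (ha : a < n) (d : Fin n → IndexSet m)
    (hpos : 0 < (d ⟨a, ha⟩).1)
    (hd : ∀ i : Fin n, i.1 < a → |(d i).1| < (d ⟨a, ha⟩).1) :
    op (jucysMurphy q Q a ha) • tensorBasis q Q n m d =
      q⁻¹ ^ a • tensorBasis q Q n m (Function.update d ⟨a, ha⟩ (-d ⟨a, ha⟩)) := by
  induction a generalizing d with
  | zero =>
    rw [jucysMurphy, tensorSpace_smul_T, heckeOp_lt, pow_zero, one_smul]
    · rfl
    · rwa [leftValue_zero _ _ rfl]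
  | succ a ih =>
    let i : {i : Fin n // 0 < i.1} := ⟨⟨a + 1, ha⟩, Nat.succ_pos a⟩
    have hp : predPos i = ⟨a, by omega⟩ := rfl
    have hi : i.1 = ⟨a + 1, ha⟩ := rfl
    have hpi : predPos i ≠ i.1 := (predPos_lt i).ne
    have h0 := abs_lt.1 (hd (predPos i) (by rw [hp]; simp only; omega))
    rw [← hi] at hpos hd h0 ⊢
    have e1 : act d i.1 (predPos i) = d i.1 := by
      rw [act_eq_comp_adjSwap, Function.comp_apply, adjSwap_predPos]
    have e2 : act d i.1 i.1 = d (predPos i) := by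
      rw [act_eq_comp_adjSwap, Function.comp_apply, adjSwap_self]
    have e3 : ∀ j, j ≠ predPos i → j ≠ i.1 → act d i.1 j = d j := by
      intro j h1 h2
      rw [act_eq_comp_adjSwap, Function.comp_apply,
        show adjSwap i j = j from Equiv.swap_apply_of_ne_of_ne h1 h2]
    have hrec := ih (by omega) (act d i.1) (by rw [← hp, e1]; exact hpos) (by
      intro j hj
      rw [← hp, e1, e3]
      · exact hd j (by omega)
      · rw [Ne, Fin.ext_iff, hp]; simp only; omega
      · rw [Ne, Fin.ext_iff, hi]; simp only; omega)
    rw [← hp, e1] at hrec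
    have s1 : op (Hecke.T q Q ⟨a + 1, ha⟩) • tensorBasis q Q n m d =
        tensorBasis q Q n m (act d i.1) := by
      rw [tensorSpace_smul_T, ← hi,
        heckeOp_lt q Q i.1 d (by rw [leftValue_eq_predPos]; exact h0.2)]
    have s2 : op (Hecke.T q Q ⟨a + 1, ha⟩) • tensorBasis q Q n m
        (Function.update (act d i.1) (predPos i) (-d i.1)) =
        tensorBasis q Q n m (Function.update d i.1 (-d i.1)) := by
      rw [tensorSpace_smul_T, ← hi, heckeOp_lt]
      · congr 1
        funext j
        rw [act_eq_comp_adjSwap, Function.comp_apply]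
        by_cases h1 : j = i.1
        · rw [h1, adjSwap_self, Function.update_self, Function.update_self]
        · by_cases h2 : j = predPos i
          · rw [h2, adjSwap_predPos, Function.update_of_ne hpi.symm, Function.update_of_ne hpi, e2]
          · rw [show adjSwap i j = j from Equiv.swap_apply_of_ne_of_ne h2 h1,
              Function.update_of_ne h1, Function.update_of_ne h2, e3 j h2 h1]
      · rw [leftValue_eq_predPos, Function.update_self, Function.update_of_ne hpi.symm, e2, neg_val]
        omega
    rw [jucysMurphy, op_smul, smul_assoc, op_mul, op_mul, mul_smul, mul_smul, s1, hrec,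
      smul_comm (op _) (q⁻¹ ^ a), s2, smul_smul, pow_succ']

/-- The tuple `(±1, …, ±n)` with negative entries at the positions in `A`. -/
def signedTuple (A : Finset (Fin n)) (i : Fin n) : IndexSet (2 * n) :=
  if i ∈ A then -regularTuple n i else regularTuple n i

theorem signedTuple_val (A : Finset (Fin n)) (i : Fin n) :
    (signedTuple A i).1 = if i ∈ A then -(i.1 + 1 : ℤ) else i.1 + 1 := by
  unfold signedTuple
  split_ifs
  · rw [neg_val]; rfl
  · rfl

theorem natAbs_signedTuple (A : Finset (Fin n)) (i : Fin n) :
    (signedTuple A i).1.natAbs = i.1 + 1 := by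
  rw [signedTuple_val]
  split_ifs <;> omega

theorem isSigned_signedTuple (A : Finset (Fin n)) : IsSigned (signedTuple A) := by
  intro i j h
  rw [natAbs_signedTuple, natAbs_signedTuple] at h
  exact Fin.ext (by omega)

/-- Absolute values increase, so a negative entry is smaller than everything before it, and a
positive entry is larger. -/
theorem card_inversions_signedTuple (A : Finset (Fin n)) :
    (inversions (signedTuple A)).card = ∑ i ∈ A, i.1 := by
  rw [inversions, Finset.card_filter, Fintype.sum_prod_type_right, ← Finset.sum_subset
    (Finset.subset_univ A)]
  · refine Finset.sum_congr rfl fun j hj => ?_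
    rw [← Finset.card_filter]
    have : (Finset.univ.filter fun i => i < j ∧ (signedTuple A j).1 < (signedTuple A i).1) =
        Finset.Iio j := by
      ext i
      simp only [Finset.mem_filter, Finset.mem_univ, true_and, Finset.mem_Iio,
        and_iff_left_iff_imp]
      intro hij
      rw [Fin.lt_def] at hij
      rw [signedTuple_val, signedTuple_val, if_pos hj]
      split_ifs <;> omega
    simp only [this, Fin.card_Iio]
  · intro j _ hj
    refine Finset.sum_eq_zero fun i _ => if_neg ?_
    rintro ⟨hij, h⟩
    simp only [Fin.lt_def] at hij h
    rw [signedTuple_val, signedTuple_val, if_neg hj] at h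
    split_ifs at h <;> omega

/-- When the factor L_{a+1} + 1 is applied, the entry at index a is still positive and exceeds the
earlier absolute values. So the product expands over the set A of entries to be negated. -/
theorem prod_jucysMurphy_smul_regularVec (a : ℕ) (ha : a ≤ n) :
    op ((((List.finRange n).take a).map fun i => jucysMurphy q Q i.1 i.2 + 1).prod) •
        regularVec q Q n =
      ∑ A ∈ (Finset.univ.filter fun i : Fin n => i.1 < a).powerset,
        q⁻¹ ^ (∑ i ∈ A, i.1) • tensorBasis q Q n (2 * n) (signedTuple A) := by
  induction a with
  | zero =>
    have : (Finset.univ.filter fun i : Fin n => i.1 < 0) = ∅ := by simp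
    rw [this, Finset.powerset_empty, Finset.sum_singleton]
    simp
    rfl
  | succ a ih =>
    have h1 : (List.finRange n).take (a + 1) = (List.finRange n).take a ++ [⟨a, ha⟩] := by
      rw [List.take_succ_eq_append_getElem (by simpa using ha)]
      simp
    have h2 : (Finset.univ.filter fun i : Fin n => i.1 < a + 1) =
        insert ⟨a, ha⟩ (Finset.univ.filter fun i : Fin n => i.1 < a) := by
      ext i
      simp only [Finset.mem_filter, Finset.mem_univ, true_and, Finset.mem_insert, Fin.ext_iff]
      omega
    have h3 : (⟨a, ha⟩ : Fin n) ∉ Finset.univ.filter fun i : Fin n => i.1 < a := by simp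
    rw [h1, List.map_append, List.prod_append, List.map_singleton, List.prod_singleton, op_mul,
      mul_smul, ih (by omega), h2, Finset.sum_powerset_insert h3, MulOpposite.op_add, op_one,
      add_smul, one_smul, add_comm]
    congr 1
    rw [Finset.smul_sum]
    refine Finset.sum_congr rfl fun A hA => ?_
    have hA' : ∀ i ∈ A, i.1 < a := fun i hi => by
      have := Finset.mem_powerset.1 hA hi
      simpa using this
    have hnot : (⟨a, ha⟩ : Fin n) ∉ A := fun h => absurd (hA' _ h) (lt_irrefl a)
    have hv : (signedTuple A ⟨a, ha⟩).1 = a + 1 := by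
      rw [signedTuple_val, if_neg hnot]
    rw [smul_comm, jucysMurphy_smul_basis q Q a ha _ (by rw [hv]; omega), smul_smul,
      Finset.sum_insert hnot, ← pow_add, add_comm a]
    · congr 2
      funext i
      by_cases hi : i = ⟨a, ha⟩
      · rw [hi, Function.update_self, signedTuple, signedTuple, if_neg hnot,
          if_pos (Finset.mem_insert_self _ _)]
      · rw [Function.update_of_ne hi, signedTuple, signedTuple]
        simp only [Finset.mem_insert, hi, false_or]
    · intro i hi
      rw [hv, signedTuple_val, abs_lt]
      split_ifs <;> omega

open Classical in
-- A signed permutation stretches to the dominant tuple δ exactly when its absolute values permute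
-- positions within the blocks of δ and its negative entries are sent to 0, the only value
-- insensitive to the sign.
theorem sum_signedTuple_eq_fiberSum {δ : Fin n → IndexSet m} (hδ : IsDominant δ) :
    ∑ A ∈ (Finset.univ.filter fun i : Fin n => i.1 < (weight δ).fstSize).powerset,
      ∑ w : Equiv.Perm (Fin n) with w ∈ (weight δ).youngSubgroup,
        tensorBasis q Q n (2 * n) (signedTuple A ∘ w) = fiberSum q Q δ δ := by
  rw [← Finset.sum_product', fiberSum]
  have hval : ∀ (A : Finset (Fin n)) (w : Equiv.Perm (Fin n)) i,
      ((signedTuple A ∘ w) i).1.natAbs = (w i).1 + 1 := fun A w i => natAbs_signedTuple A (w i)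
  have hneg : ∀ (A : Finset (Fin n)) i, (signedTuple A i).1 < 0 ↔ i ∈ A := by
    intro A i
    rw [signedTuple_val]
    split_ifs with h
    · exact iff_of_true (by omega) h
    · exact iff_of_false (by omega) h
  refine Finset.sum_nbij (fun x => signedTuple x.1 ∘ x.2) ?_ ?_ ?_ ?_
  · rintro ⟨A, w⟩ h
    rw [Finset.mem_product, Finset.mem_powerset, Finset.mem_filter,
      mem_youngSubgroup_weight hδ] at h
    rw [mem_stretchFiber]
    refine ⟨fun i j hij => ?_, ?_⟩
    · simp only [hval] at hij
      exact w.injective (Fin.ext (by omega))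
    · funext i
      have h1 : ∀ hlt, δ ⟨((signedTuple A ∘ w) i).1.natAbs - 1, hlt⟩ = δ i := by
        intro hlt
        rw [← h.2.2 i]
        congr 1
        exact Fin.ext (by simp only [hval]; omega)
      simp only [stretchTuple, stretch, h1]
      split_ifs with h2
      · rfl
      · have h3 : w i ∈ A := by
          rw [← hneg]
          have h4 := ((signedTuple A ∘ w) i).2.2 (even_two_mul n)
          simp only [Function.comp_apply] at h2 h4
          omega
        have h5 := (Finset.mem_filter.1 (h.1 h3)).2
        rw [lt_fstSize_weight hδ, h.2.2] at h5
        apply Subtype.ext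
        rw [neg_val, h5, neg_zero]
  · rintro ⟨A, w⟩ _ ⟨A', w'⟩ _ h
    have h := congrFun h
    simp only at h
    have hw : w = w' := by
      ext i
      have h1 := hval A w i
      rw [h, hval] at h1
      omega
    subst hw
    refine Prod.ext ?_ rfl
    ext i
    rw [← hneg A, ← hneg A']
    have h1 := h (w⁻¹ i)
    simp only [Function.comp_apply] at h1
    rw [show w (w⁻¹ i) = i from w.apply_symm_apply i] at h1
    rw [h1]
  · intro e he
    rw [Finset.mem_coe, mem_stretchFiber] at he
    obtain ⟨he, hst⟩ := he
    -- For surjectivity, w is read off from the absolute values of e, shifted to start at 0.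
    let f : Fin n → Fin n := fun i =>
      ⟨(e i).1.natAbs - 1, by have := (e i).natAbs_bounds; omega⟩
    have hf : Function.Injective f := by
      intro i j hij
      have h1 := (e i).natAbs_bounds
      have h2 := (e j).natAbs_bounds
      have h3 := congrArg Fin.val hij
      simp only [f] at h3
      exact he i j (by omega)
    let w : Equiv.Perm (Fin n) := Equiv.ofBijective f (Finite.injective_iff_bijective.1 hf)
    have hw : ∀ i, (w i).1 + 1 = (e i).1.natAbs := by
      intro i
      have h1 := (e i).natAbs_bounds
      change (e i).1.natAbs - 1 + 1 = _
      omega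
    have hst' : ∀ i, (if 0 < (e i).1 then δ (w i) else - δ (w i)) = δ i :=
      fun i => congrFun hst i
    have hδw : ∀ i, δ (w i) = δ i ∧ ((e i).1 < 0 → (δ (w i)).1 = 0) := by
      intro i
      have h1 := congrArg Subtype.val (hst' i)
      have h2 := hδ.nonneg i
      have h3 := hδ.nonneg (w i)
      split_ifs at h1 with h4
      · exact ⟨Subtype.ext h1, fun h5 => absurd h4 h5.not_gt⟩
      · rw [neg_val] at h1
        exact ⟨Subtype.ext (by omega), fun _ => by omega⟩
    -- A records which absolute values carry a negative sign, hence the preimage under w.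
    refine ⟨(Finset.univ.filter fun j => (e (w⁻¹ j)).1 < 0, w), ?_, ?_⟩
    · rw [Finset.mem_coe, Finset.mem_product, Finset.mem_powerset, Finset.mem_filter,
        mem_youngSubgroup_weight hδ]
      refine ⟨fun j hj => ?_, Finset.mem_univ _, fun i => (hδw i).1⟩
      rw [Finset.mem_filter] at hj ⊢
      refine ⟨Finset.mem_univ _, ?_⟩
      rw [lt_fstSize_weight hδ]
      have := (hδw (w⁻¹ j)).2 hj.2
      rwa [show w (w⁻¹ j) = j from w.apply_symm_apply j] at this
    · funext i
      apply Subtype.ext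
      simp only [Function.comp_apply, signedTuple_val, Finset.mem_filter, Finset.mem_univ,
        true_and]
      rw [show w⁻¹ (w i) = i from w.symm_apply_apply i]
      have h1 := hw i
      have h2 := (e i).natAbs_bounds
      split_ifs <;> omega
  · exact fun _ _ => rfl

/-- The factor q⁻¹ to the power ∑ A from the Jucys-Murphy elements cancels the power of q that x_λ
produces from the inversions of the same tuple. This is where q must be invertible. -/
theorem mElem_smul_regularVec (hq : q ≠ 0) {δ : Fin n → IndexSet m} (hδ : IsDominant δ) :
    op (mElem q Q (weight δ)) • regularVec q Q n = fiberSum q Q δ δ := by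
  classical
  have hle : (weight δ).fstSize ≤ n := by
    have := (weight δ).2
    rw [Fintype.sum_sum_type] at this
    exact le_of_add_le_left this.le
  rw [mElem, op_mul, mul_smul, uElem, prod_jucysMurphy_smul_regularVec q Q _ hle,
    ← sum_signedTuple_eq_fiberSum q Q hδ, Finset.smul_sum]
  refine Finset.sum_congr rfl fun A hA => ?_
  have hA' : ∀ i ∈ A, (δ i).1 = 0 := fun i hi => by
    have := (Finset.mem_filter.1 (Finset.mem_powerset.1 hA hi)).2
    rwa [lt_fstSize_weight hδ] at this
  rw [smul_comm, xElem_smul_basis q Q hδ _ (isSigned_signedTuple A), card_inversions_signedTuple,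
    smul_smul, ← mul_pow, inv_mul_cancel₀ hq, one_pow, one_smul]
  -- Negative signs occur only in the zero block, which comes first, so the signed tuple still
  -- increases from block to block.
  intro i j hij
  have hj : j ∉ A := fun h => by
    have h1 := hA' j h
    have h2 := hδ.nonneg i
    omega
  have hlt : i < j := by
    by_contra h
    exact absurd (hδ.mono (not_lt.1 h)) hij.not_ge
  rw [Fin.lt_def] at hlt
  rw [signedTuple_val, signedTuple_val, if_neg hj]
  split_ifs <;> omega

end JucysMurphy

/-! ### Corners, direct summands and nested idempotents -/

section CornerEquiv

/-- If `V` is a direct summand of `M` with projector `e`, then `End V` is the corner of `End M`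
at `e`. -/
noncomputable def endCornerEquiv {k R V M : Type*} [Field k] [Ring R] [Algebra k R] [AddCommGroup V]
    [AddCommGroup M] [Module R V] [Module R M] [Module k V] [Module k M] [SMulCommClass R k V]
    [SMulCommClass R k M] [IsScalarTower k R V] [IsScalarTower k R M]
    {e : Module.End R M} (he : IsIdempotentElem e) (F : V →ₗ[R] M) (G : M →ₗ[R] V)
    (hGF : ∀ x, G (F x) = x) (hFG : ∀ y, F (G y) = e y) (hF : ∀ (c : k) x, F (c • x) = c • F x) :
    Module.End R V ≃ₐ[k] he.Corner :=
  AlgEquiv.ofRingEquiv (f :=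
    { toFun := fun a => (⟨F ∘ₗ a ∘ₗ G, (Subsemigroup.mem_corner_iff he).2
        ⟨LinearMap.ext fun y => by
          simp only [Module.End.mul_apply, LinearMap.comp_apply, ← hFG, hGF],
          LinearMap.ext fun y => by
          simp only [Module.End.mul_apply, LinearMap.comp_apply, ← hFG, hGF]⟩⟩ : he.Corner)
      invFun := fun b => G ∘ₗ b.1 ∘ₗ F
      left_inv := fun a => LinearMap.ext fun x => by simp only [LinearMap.comp_apply, hGF]
      right_inv := fun b => Subtype.ext <| LinearMap.ext fun y => by
        have h1 : ∀ y, e (b.1 y) = b.1 y := fun y =>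
          congrArg (fun l : Module.End R M => l y) ((Subsemigroup.mem_corner_iff he).1 b.2).1
        have h2 : ∀ y, b.1 (e y) = b.1 y := fun y =>
          congrArg (fun l : Module.End R M => l y) ((Subsemigroup.mem_corner_iff he).1 b.2).2
        simp only [LinearMap.comp_apply, hFG, h1, h2]
      map_mul' := fun a b => Subtype.ext <| LinearMap.ext fun y => by
        change F (a (b (G y))) = F (a (G (F (b (G y)))))
        rw [hGF]
      map_add' := fun a b => Subtype.ext <| LinearMap.ext fun y => by
        change F (a (G y) + b (G y)) = F (a (G y)) + F (b (G y))
        rw [map_add] })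
    (fun c => Subtype.ext <| LinearMap.ext fun y => by
      change F (c • G y) = c • e y
      rw [hF, hFG])

variable {k A B : Type u} [Field k] [Ring A] [Ring B] [Algebra k A] [Algebra k B] {e p : A}
  (he : IsIdempotentElem e) (hp : IsIdempotentElem p) (Φ : B ≃ₐ[k] he.Corner)
  (hep : e * p = p) (hpe : p * e = p)

/-- The element of `B ≅ e A e` corresponding to an idempotent below `e`. -/
noncomputable def subIdem : B := Φ.symm ⟨p, (Subsemigroup.mem_corner_iff he).2 ⟨hep, hpe⟩⟩

theorem apply_subIdem : (Φ (subIdem he Φ hep hpe)).1 = p :=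
  congrArg Subtype.val (Φ.apply_symm_apply _)

theorem subIdem_idem (hp : IsIdempotentElem p) : IsIdempotentElem (subIdem he Φ hep hpe) := by
  apply Φ.injective
  apply Subtype.ext
  rw [map_mul]
  change (Φ _).1 * (Φ _).1 = _
  rw [apply_subIdem, hp.eq]

/-- The inclusion of `p A p` into `e A e` for an idempotent `p` below `e`. -/
def cornerOfSub {A : Type*} [Ring A] {e p : A} (he : IsIdempotentElem e)
    (hp : IsIdempotentElem p) (hep : e * p = p) (hpe : p * e = p) (a : hp.Corner) : he.Corner :=
  ⟨a.1, (Subsemigroup.mem_corner_iff he).2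
    ⟨by
      have h : e * (p * a.1) = p * a.1 := by rw [← mul_assoc, hep]
      rwa [corner_mul_left hp a] at h,
    by
      have h : a.1 * p * e = a.1 * p := by rw [mul_assoc, hpe]
      rwa [corner_mul_right hp a] at h⟩⟩

/-- Corners of `e A e` are corners of `A`. -/
noncomputable def subCornerEquiv (hf : IsIdempotentElem (subIdem he Φ hep hpe)) : hf.Corner ≃ₐ[k] hp.Corner :=
  AlgEquiv.ofRingEquiv (f :=
    { toFun := fun b => (⟨(Φ b.1).1, (Subsemigroup.mem_corner_iff hp).2
        ⟨(congrArg (· * (Φ b.1).1) (apply_subIdem he Φ hep hpe)).symm.trans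
          ((congrArg Subtype.val (map_mul Φ _ b.1)).symm.trans
            (congrArg (fun x => (Φ x).1) (corner_mul_left hf b))),
          (congrArg ((Φ b.1).1 * ·) (apply_subIdem he Φ hep hpe)).symm.trans
          ((congrArg Subtype.val (map_mul Φ b.1 _)).symm.trans
            (congrArg (fun x => (Φ x).1) (corner_mul_right hf b)))⟩⟩ : hp.Corner)
      invFun := fun a => (⟨Φ.symm (cornerOfSub he hp hep hpe a),
        (Subsemigroup.mem_corner_iff hf).2
          ⟨Φ.injective (Subtype.ext <| (congrArg Subtype.val (map_mul Φ _ _)).trans <|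
              (congrArg₂ (· * ·) (apply_subIdem he Φ hep hpe)
                (congrArg Subtype.val (Φ.apply_symm_apply (cornerOfSub he hp hep hpe a)))).trans <|
              (corner_mul_left hp a).trans (congrArg Subtype.val (Φ.apply_symm_apply (cornerOfSub he hp hep hpe a))).symm),
            Φ.injective (Subtype.ext <| (congrArg Subtype.val (map_mul Φ _ _)).trans <|
              (congrArg₂ (· * ·) (congrArg Subtype.val (Φ.apply_symm_apply (cornerOfSub he hp hep hpe a)))
                (apply_subIdem he Φ hep hpe)).trans <|
              (corner_mul_right hp a).trans
                (congrArg Subtype.val (Φ.apply_symm_apply (cornerOfSub he hp hep hpe a))).symm)⟩⟩ : hf.Corner)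
      left_inv := fun b => Subtype.ext (Φ.symm_apply_apply b.1)
      right_inv := fun a => Subtype.ext
        (congrArg Subtype.val (Φ.apply_symm_apply (cornerOfSub he hp hep hpe a)) :)
      map_mul' := fun a b => Subtype.ext
        (congrArg Subtype.val (map_mul Φ a.1 b.1) :)
      map_add' := fun a b => Subtype.ext
        (congrArg Subtype.val (map_add Φ a.1 b.1) :) })
    (fun c => Subtype.ext (by
      change (Φ (c • subIdem he Φ hep hpe)).1 = c • p
      rw [map_smul]
      exact congrArg (c • ·) (apply_subIdem he Φ hep hpe)))

/-- Inside M, both (M e) f and M p are the set of vectors fixed by p, and h says that H acts on them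
in the same way. -/
theorem cornerFunctor_comp_iso {H : Type u} [Ring H] [Algebra k H] {f : B}
    (hf : IsIdempotentElem f) (hfp : (Φ f).1 = p) (hpe : p * e = p)
    (ψ : H ≃ₐ[k] hp.Corner) (ψ' : H ≃ₐ[k] hf.Corner) (h : ∀ x, (Φ (ψ' x).1).1 = (ψ x).1) :
    Nonempty (cornerFunctor he Φ.toRingEquiv ⋙ cornerFunctor hf ψ'.toRingEquiv ≅
      cornerFunctor hp ψ.toRingEquiv) := by
  let F := cornerFunctor he Φ.toRingEquiv
  let F' := cornerFunctor hf ψ'.toRingEquiv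
  let K := cornerFunctor hp ψ.toRingEquiv
  let inc (M : ModuleCat.{u} Aᵐᵒᵖ) : F'.obj (F.obj M) →+ M :=
    (cornerIncl he Φ.toRingEquiv M).comp (cornerIncl hf ψ'.toRingEquiv (F.obj M))
  have inc_inj : ∀ M, Function.Injective (inc M) := fun M =>
    (cornerIncl_injective he Φ.toRingEquiv M).comp (cornerIncl_injective hf ψ'.toRingEquiv _)
  have inc_p : ∀ M (x : F'.obj (F.obj M)), op p • inc M x = inc M x := by
    intro M x
    rw [← hfp]
    exact congrArg (cornerIncl he Φ.toRingEquiv M)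
      (idem_smul_cornerIncl hf ψ'.toRingEquiv (F.obj M) x)
  let lin (M : ModuleCat.{u} Aᵐᵒᵖ) : F'.obj (F.obj M) ≃ₗ[Hᵐᵒᵖ] K.obj M :=
    { toFun := fun x => cornerMk hp ψ.toRingEquiv M (inc M x) (inc_p M x)
      map_add' := fun x y => cornerIncl_injective hp _ _ (map_add (inc M) x y)
      map_smul' := fun a x => cornerIncl_injective hp _ _ (by
        change op (Φ (ψ' a.unop).1).1 • inc M x = op (ψ a.unop).1 • inc M x
        rw [h])
      invFun := fun y => cornerMk hf ψ'.toRingEquiv (F.obj M)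
        (cornerMk he Φ.toRingEquiv M (cornerIncl hp ψ.toRingEquiv M y) (by
          rw [← idem_smul_cornerIncl hp ψ.toRingEquiv M y, smul_smul, ← op_mul, hpe]))
        (cornerIncl_injective he _ _ (by
          change op (Φ f).1 • cornerIncl hp ψ.toRingEquiv M y = cornerIncl hp ψ.toRingEquiv M y
          rw [hfp]
          exact idem_smul_cornerIncl hp ψ.toRingEquiv M y))
      left_inv := fun x => inc_inj M rfl
      right_inv := fun y => rfl }
  refine ⟨NatIso.ofComponents (fun M => (lin M).toModuleIso) ?_⟩
  intro M N g
  ext x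
  rfl

theorem exists_subcorner_quotientFunctor [Module.Finite k B] {H : Type u} [Ring H] [Algebra k H]
    (hep : e * p = p) (hpe : p * e = p) (ψ : H ≃ₐ[k] hp.Corner) :
    ∃ (f : B) (hf : IsIdempotentElem f) (ψ' : H ≃ₐ[k] hf.Corner),
      (∀ h : H, (Φ (ψ' h).1).1 = (ψ h).1) ∧
      IsModuleQuotientFunctor (cornerFunctor hf ψ'.toRingEquiv) ∧
      Nonempty (cornerFunctor he Φ.toRingEquiv ⋙ cornerFunctor hf ψ'.toRingEquiv ≅
        cornerFunctor hp ψ.toRingEquiv) := by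
  have hf := subIdem_idem he Φ hep hpe hp
  have key : ∀ h, (Φ ((ψ.trans (subCornerEquiv he hp Φ hep hpe hf).symm) h).1).1 = (ψ h).1 :=
    fun h => congrArg Subtype.val ((subCornerEquiv he hp Φ hep hpe hf).apply_symm_apply (ψ h))
  exact ⟨_, hf, _, key, cornerFunctor_isModuleQuotientFunctor hf _,
    cornerFunctor_comp_iso he hp Φ hf (apply_subIdem he Φ hep hpe) hpe ψ _ key⟩

end CornerEquiv

/-! ### Tensor space as the direct summand e_n M^Λ -/

section Embedding

variable {n m : ℕ}

theorem natAbs_stretch (δ : Fin n → IndexSet m) (j : IndexSet (2 * n)) :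
    (stretch δ j).1.natAbs =
      (δ ⟨j.1.natAbs - 1, by have := j.natAbs_bounds; omega⟩).1.natAbs := by
  unfold stretch
  split_ifs
  · rfl
  · rw [neg_val, Int.natAbs_neg]

/-- Weights depend only on absolute values, and stretching along a signed permutation merely
permutes those of δ. -/
theorem weight_stretchTuple (δ : Fin n → IndexSet m) {e : Fin n → IndexSet (2 * n)}
    (he : IsSigned e) : weight (stretchTuple δ e) = weight δ := by
  let σ : Fin n → Fin n := fun i =>
    ⟨(e i).1.natAbs - 1, by have := (e i).natAbs_bounds; omega⟩
  have hσ : Function.Injective σ := fun i j h => he i j (by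
    have h1 := (e i).natAbs_bounds
    have h2 := (e j).natAbs_bounds
    have h3 : (e i).1.natAbs - 1 = (e j).1.natAbs - 1 := congrArg Fin.val h
    omega)
  apply Subtype.ext
  funext p
  rw [weight_apply, weight_apply]
  refine Finset.card_equiv (Equiv.ofBijective σ (Finite.injective_iff_bijective.1 hσ)) fun i => ?_
  have h : partOf (stretchTuple δ e) i = partOf δ (σ i) :=
    (partOf_eq_iff _ _ _ _).2 (natAbs_stretch δ (e i))
  simp [h]

variable {k : Type u} [Field k] (q Q : k)

theorem fiberSum_eq_zero {δ d : Fin n → IndexSet m} (hδ : IsDominant δ) (hd : IsDominant d)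
    (h : d ≠ δ) : fiberSum q Q δ d = 0 := by
  refine Finset.sum_eq_zero fun e he => absurd ?_ h
  obtain ⟨he', rfl⟩ := mem_stretchFiber.1 he
  exact weight_injective hd hδ (weight_stretchTuple δ he')

/-- On the regular vector this is the eigenvector property of the fibre sum. It is the relation that
makes `tensorEmbed` well defined. -/
theorem mElem_mul_T (hq : q ≠ 0) {d : Fin n → IndexSet m} (hd : IsDominant d) (t : Fin n)
    (h : leftValue d t = (d t).1) :
    mElem q Q (weight d) * Hecke.T q Q t = heckeParam q Q t.1 • mElem q Q (weight d) := by
  apply regularVec_smul_injective q Q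
  rw [op_mul, mul_smul, mElem_smul_regularVec q Q hq hd, tensorSpace_smul_T,
    heckeOp_fiberSum_eq q Q d d t h, op_smul, smul_assoc, mElem_smul_regularVec q Q hq hd]

/-- The generator `m_λ` of `M^λ`. -/
noncomputable def permGen (l : Bicomposition n (m / 2)) : permModule q Q l :=
  ⟨mElem q Q l, Submodule.mem_span_singleton_self _⟩

theorem exists_smul_permGen (l : Bicomposition n (m / 2)) (x : permModule q Q l) :
    ∃ a : (Hecke q Q n)ᵐᵒᵖ, x = a • permGen q Q l := by
  obtain ⟨a, ha⟩ := Submodule.mem_span_singleton.1 x.2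
  exact ⟨a, Subtype.ext ha.symm⟩

/-- The embedding of `V^{⊗n}` into `M^Λ` that sends the dominant `v_d` to `m_λ`, where `λ` is the
weight of `d`. -/
noncomputable def tensorEmbed (hq : q ≠ 0) :
    TensorSpace q Q n m →ₗ[(Hecke q Q n)ᵐᵒᵖ] TotalModule q Q n m :=
  tensorLift q Q (fun d => incl q Q (weight d) (permGen q Q (weight d))) (by
    intro d hd t h
    rw [genAction_apply, ← map_smul, ← heckeHom_smul q Q (n := n)]
    exact congrArg _ (Subtype.ext (mElem_mul_T q Q hq hd t h)))

theorem tensorEmbed_dominant (hq : q ≠ 0) {d : Fin n → IndexSet m} (hd : IsDominant d) :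
    tensorEmbed q Q hq (tensorBasis q Q n m d) = incl q Q (weight d) (permGen q Q (weight d)) :=
  tensorLift_dominant q Q _ _ d hd

/-- The orbit map of the regular vector. -/
noncomputable def regularOrbit :
    Hecke q Q n →ₗ[(Hecke q Q n)ᵐᵒᵖ] TensorSpace q Q n (2 * n) where
  toFun h := op h • regularVec q Q n
  map_add' a b := by rw [MulOpposite.op_add, add_smul]
  map_smul' a h := by
    rw [RingHom.id_apply, smul_smul]
    rfl

/-- The homomorphism from `M^Λ` given by the orbit map of the regular vector on `M^λ`. -/
noncomputable def summandOrbit (l : Bicomposition n (m / 2)) :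
    TotalModule q Q n m →ₗ[(Hecke q Q n)ᵐᵒᵖ] TensorSpace q Q n (2 * n) :=
  regularOrbit q Q ∘ₗ (permModule q Q l).subtype ∘ₗ proj q Q l

/-- It suffices to compare dominant vectors. At δ both sides are the fibre sum computed from m_λ; at
any other dominant d the projection vanishes, and so does the fibre sum, because stretching
preserves weight. -/
theorem summandOrbit_comp_tensorEmbed (hq : q ≠ 0) {δ : Fin n → IndexSet m} (hδ : IsDominant δ) :
    summandOrbit q Q (weight δ) ∘ₗ tensorEmbed q Q hq = stretchHom q Q δ hδ := by
  refine tensorHom_ext q Q fun d hd => ?_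
  rw [LinearMap.comp_apply, tensorEmbed_dominant q Q hq hd, stretchHom_basis]
  change op (proj q Q (weight δ) (incl q Q (weight d) (permGen q Q (weight d)))).1 •
    regularVec q Q n = _
  by_cases h : d = δ
  · subst h
    rw [proj_incl_same]
    exact mElem_smul_regularVec q Q hq hd
  · rw [proj_incl_ne q Q _ _ fun h' => h (weight_injective hd hδ h'),
      fiberSum_eq_zero q Q hδ hd h]
    exact zero_smul (Hecke q Q n)ᵐᵒᵖ _

theorem tensorEmbed_injective (hq : q ≠ 0) :
    Function.Injective (tensorEmbed q Q (n := n) (m := m) hq) := by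
  rw [← LinearMap.ker_eq_bot, LinearMap.ker_eq_bot']
  intro x hx
  refine eq_zero_of_stretchHom_eq_zero q Q x fun δ hδ => ?_
  rw [← summandOrbit_comp_tensorEmbed q Q hq hδ, LinearMap.comp_apply, hx, map_zero]

theorem phi_incl (l l' : Bicomposition n (m / 2)) (x : permModule q Q l') :
    phi q Q l (incl q Q l' x) = if l = l' then incl q Q l' x else 0 := by
  change incl q Q l (proj q Q l (incl q Q l' x)) = _
  split_ifs with h
  · subst h
    rw [proj_incl_same]
  · rw [proj_incl_ne q Q l l' (Ne.symm h), map_zero]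

theorem typeBIdem_incl {l : Bicomposition n (m / 2)} (hl : l.IsTypeB m) (x : permModule q Q l) :
    typeBIdem q Q n m (incl q Q l x) = incl q Q l x := by
  classical
  rw [typeBIdem, LinearMap.sum_apply, Finset.sum_congr rfl fun l' _ => phi_incl q Q l' l x,
    Finset.sum_ite_eq', if_pos (by simpa using hl)]

theorem typeBIdem_tensorEmbed (hq : q ≠ 0) (x : TensorSpace q Q n m) :
    typeBIdem q Q n m (tensorEmbed q Q hq x) = tensorEmbed q Q hq x := by
  have H : typeBIdem q Q n m ∘ₗ tensorEmbed q Q hq = tensorEmbed q Q hq :=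
    tensorHom_ext q Q fun d hd => by
      rw [LinearMap.comp_apply, tensorEmbed_dominant q Q hq hd,
        typeBIdem_incl q Q (weight_isTypeB d)]
  exact congrArg (fun f => f x) H

/-- M^λ is cyclic and, for λ of type B, its generator is the image of a dominant vector. -/
theorem incl_mem_range_tensorEmbed (hq : q ≠ 0) {l : Bicomposition n (m / 2)} (hl : l.IsTypeB m)
    (x : permModule q Q l) : incl q Q l x ∈ LinearMap.range (tensorEmbed q Q hq) := by
  obtain ⟨d, hd, rfl⟩ := exists_dominant_weight hl
  obtain ⟨a, rfl⟩ := exists_smul_permGen q Q _ x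
  rw [map_smul, ← tensorEmbed_dominant q Q hq hd]
  exact Submodule.smul_mem _ _ ⟨_, rfl⟩

theorem typeBIdem_mem_range_tensorEmbed (hq : q ≠ 0) (y : TotalModule q Q n m) :
    typeBIdem q Q n m y ∈ LinearMap.range (tensorEmbed q Q hq) := by
  classical
  rw [typeBIdem, LinearMap.sum_apply]
  exact Submodule.sum_mem _ fun l hl =>
    incl_mem_range_tensorEmbed q Q hq (Finset.mem_filter.1 hl).2 (proj q Q l y)

/-- The projection of `M^Λ` onto `V^{⊗n}`. -/
noncomputable def tensorProj (hq : q ≠ 0) :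
    TotalModule q Q n m →ₗ[(Hecke q Q n)ᵐᵒᵖ] TensorSpace q Q n m :=
  (LinearEquiv.ofInjective (tensorEmbed q Q (n := n) (m := m) hq)
      (tensorEmbed_injective q Q hq)).symm.toLinearMap ∘ₗ
    LinearMap.codRestrict _ (typeBIdem q Q n m) (typeBIdem_mem_range_tensorEmbed q Q hq)

theorem tensorEmbed_tensorProj (hq : q ≠ 0) (y : TotalModule q Q n m) :
    tensorEmbed q Q hq (tensorProj q Q hq y) = typeBIdem q Q n m y :=
  congrArg Subtype.val ((LinearEquiv.ofInjective (tensorEmbed q Q (n := n) (m := m) hq)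
    (tensorEmbed_injective q Q hq)).apply_symm_apply
      ⟨typeBIdem q Q n m y, typeBIdem_mem_range_tensorEmbed q Q hq y⟩)

theorem tensorProj_tensorEmbed (hq : q ≠ 0) (x : TensorSpace q Q n m) :
    tensorProj q Q hq (tensorEmbed q Q hq x) = x :=
  tensorEmbed_injective q Q hq (by rw [tensorEmbed_tensorProj, typeBIdem_tensorEmbed])

/-- The isomorphism `L^n(m) ≅ e_n S^n(Λ_{n,m}) e_n`. -/
noncomputable def typeBSchurEquiv (hq : q ≠ 0) :
    TypeBSchurAlgebra q Q n m ≃ₐ[k] (typeBIdem_idem q Q n m).Corner :=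
  endCornerEquiv (typeBIdem_idem q Q n m) (tensorEmbed q Q hq) (tensorProj q Q hq)
    (tensorProj_tensorEmbed q Q hq) (tensorEmbed_tensorProj q Q hq)
    (heckeHom_smul q Q (tensorEmbed q Q hq))

end Embedding

/-! ### Finite dimensionality of the Schur algebras -/

section Finiteness

variable {k : Type u} [Field k] (q Q : k) {n m : ℕ}

instance : Module.Finite k (Hecke q Q n) := hecke_finite q Q

theorem finite_heckeEnd (N : Type*) [AddCommGroup N] [Module k N] [Module (Hecke q Q n)ᵐᵒᵖ N]
    [SMulCommClass (Hecke q Q n)ᵐᵒᵖ k N] [IsScalarTower k (Hecke q Q n)ᵐᵒᵖ N]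
    [Module.Finite k N] : Module.Finite k (Module.End (Hecke q Q n)ᵐᵒᵖ N) :=
  Module.Finite.of_injective
    ({ toFun := fun f =>
         { toFun := f, map_add' := map_add f, map_smul' := heckeHom_smul q Q f }
       map_add' := fun _ _ => rfl
       map_smul' := fun _ _ => rfl } : Module.End (Hecke q Q n)ᵐᵒᵖ N →ₗ[k] (N →ₗ[k] N))
    (fun _ _ h => LinearMap.ext fun x => congrArg (fun l : N →ₗ[k] N => l x) h)

instance (l : Bicomposition n (m / 2)) : Module.Finite k (permModule q Q l) :=
  Module.Finite.of_injective ((permModule q Q l).subtype.restrictScalars k)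
    Subtype.val_injective

instance : Module.Finite k (TotalModule q Q n m) :=
  inferInstanceAs (Module.Finite k (⨁ l : Bicomposition n (m / 2), permModule q Q l))

instance : Module.Finite k (CyclotomicSchurAlgebra q Q n m) := finite_heckeEnd q Q _

instance : Module.Finite k (TypeBSchurAlgebra q Q n m) := finite_heckeEnd q Q _

end Finiteness

/-! ### The summand M^ω = H_n -/

section Column

variable {n m : ℕ}

/-- The tuple `(1, 2, …, n)` with entries in `I(m)`. -/
def columnTuple (hm : 2 * n ≤ m) (i : Fin n) : IndexSet m :=
  ⟨i.1 + 1, by rw [abs_le]; omega, fun _ => by omega⟩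

theorem isDominant_columnTuple (hm : 2 * n ≤ m) : IsDominant (columnTuple hm) :=
  isDominant_of_mono (fun i => by simp only [columnTuple]; omega)
    (fun i j h => by simp only [columnTuple]; rw [Fin.le_def] at h; omega)

theorem weight_columnTuple (hm : 2 * n ≤ m) :
    weight (columnTuple hm) = Bicomposition.column hm := by
  have hp : ∀ i : Fin n, partOf (columnTuple hm) i = Sum.inr ⟨i.1, by omega⟩ := by
    intro i
    have h : (columnTuple hm i).1 ≠ 0 := by simp only [columnTuple]; omega
    rw [partOf, dif_neg h]
    congr 2
  apply Subtype.ext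
  funext p
  rw [weight_apply]
  simp only [hp]
  rcases p with a | j
  · simp [Bicomposition.column]
  · simp only [Bicomposition.column, Sum.elim_inr, Sum.inr.injEq]
    split_ifs with h
    · rw [Finset.card_eq_one]
      refine ⟨⟨j.1, h⟩, ?_⟩
      ext i
      simp [Fin.ext_iff]
    · rw [Finset.card_eq_zero, Finset.filter_eq_empty_iff]
      intro i _ hi
      rw [← hi] at h
      exact h i.2

theorem stretchFiber_columnTuple (hm : 2 * n ≤ m) :
    stretchFiber (columnTuple hm) (columnTuple hm) = {regularTuple n} := by
  ext e
  rw [mem_stretchFiber, Finset.mem_singleton]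
  constructor
  · rintro ⟨-, h⟩
    funext i
    have h1 : (stretch (columnTuple hm) (e i)).1 = i.1 + 1 := congrArg (fun d => (d i).1) h
    have h2 := (e i).natAbs_bounds
    apply Subtype.ext
    simp only [stretch] at h1
    simp only [regularTuple]
    split_ifs at h1 with h3
    · simp only [columnTuple] at h1
      omega
    · rw [neg_val] at h1
      simp only [columnTuple] at h1
      omega
  · rintro rfl
    exact ⟨isSigned_regularTuple, stretchTuple_regularTuple _⟩

variable {k : Type u} [Field k] (q Q : k)

/-- The fibre of the tuple (1, …, n) over itself is a single point, so m_ω fixes the free vector. -/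
theorem mElem_column (hq : q ≠ 0) (hm : 2 * n ≤ m) :
    mElem q Q (Bicomposition.column hm) = 1 := by
  apply regularVec_smul_injective q Q
  rw [← weight_columnTuple, mElem_smul_regularVec q Q hq (isDominant_columnTuple hm), fiberSum,
    stretchFiber_columnTuple, Finset.sum_singleton, op_one, one_smul]
  rfl

theorem mem_permModule_column (hq : q ≠ 0) (hm : 2 * n ≤ m) (x : Hecke q Q n) :
    x ∈ permModule q Q (Bicomposition.column hm) := by
  rw [permModule, mElem_column q Q hq hm]
  exact Submodule.mem_span_singleton.2 ⟨op x, one_mul x⟩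

/-- Left multiplication identifies the Hecke algebra with the endomorphism algebra of its right
regular module. -/
noncomputable def leftMulEquiv (P : Submodule (Hecke q Q n)ᵐᵒᵖ (Hecke q Q n)) (hP : ∀ x, x ∈ P) :
    Hecke q Q n ≃ₐ[k] Module.End (Hecke q Q n)ᵐᵒᵖ P :=
  AlgEquiv.ofRingEquiv (f :=
    { toFun := fun h =>
        ({ toFun := fun x => ⟨h * x.1, hP _⟩
           map_add' := fun x y => Subtype.ext (mul_add h x.1 y.1)
           map_smul' := fun a x => Subtype.ext (mul_assoc h x.1 a.unop).symm } :
          Module.End (Hecke q Q n)ᵐᵒᵖ P)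
      invFun := fun f => (f ⟨1, hP _⟩).1
      left_inv := fun h => mul_one h
      right_inv := fun f => LinearMap.ext fun x => by
        have h : x = op x.1 • (⟨1, hP _⟩ : P) := Subtype.ext (one_mul x.1).symm
        exact (map_smul f (op x.1) ⟨1, hP _⟩).symm.trans (congrArg f h.symm)
      map_mul' := fun a b => LinearMap.ext fun x => Subtype.ext (mul_assoc a b x.1)
      map_add' := fun a b => LinearMap.ext fun x => Subtype.ext (add_mul a b x.1) })
    (fun c => LinearMap.ext fun x => Subtype.ext (Algebra.smul_def c x.1).symm)

theorem leftMulEquiv_apply (P : Submodule (Hecke q Q n)ᵐᵒᵖ (Hecke q Q n)) (hP : ∀ x, x ∈ P)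
    (h : Hecke q Q n) (x : P) : (leftMulEquiv q Q P hP h x).1 = h * x.1 := rfl

theorem isTypeB_column (hm : 2 * n ≤ m) : (Bicomposition.column hm).IsTypeB m :=
  fun _ h => absurd rfl h

theorem typeBIdem_mul_phi {l : Bicomposition n (m / 2)} (hl : l.IsTypeB m) :
    typeBIdem q Q n m * phi q Q l = phi q Q l := by
  classical
  rw [typeBIdem, Finset.sum_mul, Finset.sum_congr rfl fun l' _ => phi_mul q Q l' l,
    Finset.sum_ite_eq', if_pos (by simpa using hl)]

theorem phi_mul_typeBIdem {l : Bicomposition n (m / 2)} (hl : l.IsTypeB m) :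
    phi q Q l * typeBIdem q Q n m = phi q Q l := by
  classical
  rw [typeBIdem, Finset.mul_sum, Finset.sum_congr rfl fun l' _ => phi_mul q Q l l',
    Finset.sum_ite_eq, if_pos (by simpa using hl)]

/-- The isomorphism `H_n ≅ φ_ω S^n(Λ_{n,m}) φ_ω` given by left multiplication. -/
noncomputable def heckeCornerEquiv (hq : q ≠ 0) (hm : 2 * n ≤ m) :
    Hecke q Q n ≃ₐ[k] (phi_idem q Q (Bicomposition.column hm)).Corner :=
  (leftMulEquiv q Q _ (mem_permModule_column q Q hq hm)).trans
    (endCornerEquiv (phi_idem q Q (Bicomposition.column hm)) (incl q Q _) (proj q Q _)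
      (proj_incl_same q Q _) (fun _ => rfl) (heckeHom_smul q Q (incl q Q _)))

theorem proj_heckeCornerEquiv (hq : q ≠ 0) (hm : 2 * n ≤ m) (h : Hecke q Q n)
    (x : permModule q Q (Bicomposition.column hm)) :
    (proj q Q (Bicomposition.column hm) ((heckeCornerEquiv q Q hq hm h).1
      (incl q Q (Bicomposition.column hm) x)) : Hecke q Q n) = h * x.1 := by
  change (proj q Q _ (incl q Q _ (leftMulEquiv q Q _ (mem_permModule_column q Q hq hm) h
    (proj q Q _ (incl q Q _ x))))).1 = _
  rw [proj_incl_same, proj_incl_same, leftMulEquiv_apply]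

end Column

end TypeBSchur

/-! ### The main theorem -/

theorem theoremA {k : Type u} [Field k] (q Q : k) (hq : q ≠ 0) (hQ : Q ≠ 0) (n m : ℕ) :
    ∃ Φ : TypeBSchurAlgebra q Q n m ≃ₐ[k] (typeBIdem_idem q Q n m).Corner,
      IsModuleQuotientFunctor
        (cornerFunctor (typeBIdem_idem q Q n m) Φ.toRingEquiv) ∧
      ∀ hm : 2 * n ≤ m,
        ∃ ψ : Hecke q Q n ≃ₐ[k]
            (phi_idem q Q (Bicomposition.column hm)).Corner,
          (∀ (h : Hecke q Q n)
              (x : permModule q Q (Bicomposition.column hm)),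
            (proj q Q (Bicomposition.column hm)
              ((ψ h).1 (incl q Q (Bicomposition.column hm) x)) :
                Hecke q Q n) = h * x.1) ∧
          ∃ (f : TypeBSchurAlgebra q Q n m) (hf : IsIdempotentElem f)
            (ψ' : Hecke q Q n ≃ₐ[k] hf.Corner),
            (∀ h : Hecke q Q n, (Φ (ψ' h).1).1 = (ψ h).1) ∧
            IsModuleQuotientFunctor
              (cornerFunctor hf ψ'.toRingEquiv) ∧
            Nonempty
              (cornerFunctor (typeBIdem_idem q Q n m) Φ.toRingEquiv ⋙
                  cornerFunctor hf ψ'.toRingEquiv ≅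
                cornerFunctor
                  (phi_idem q Q (Bicomposition.column hm))
                  ψ.toRingEquiv) := by
  exact ⟨typeBSchurEquiv q Q hq, cornerFunctor_isModuleQuotientFunctor _ _, fun hm =>
    ⟨heckeCornerEquiv q Q hq hm, proj_heckeCornerEquiv q Q hq hm,
      exists_subcorner_quotientFunctor _ _ _ (typeBIdem_mul_phi q Q (isTypeB_column hm))
        (phi_mul_typeBIdem q Q (isTypeB_column hm)) _⟩⟩
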